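/- Let $n\ge 1$ and write $\hat f(\xi)=\int_{\mathbb R^n}e^{-ix\cdot\xi}f(x)\,dx$. For $k>0$ let $R_k$ be the outgoing resolvent, $\widehat{R_kf}(\xi)=(-|\xi|^2+k^2+i0)^{-1}\hat f(\xi)$ (the limit $\varepsilon\to0^+$ of $(-|\xi|^2+k^2+i\varepsilon)^{-1}\hat f(\xi)$ in the sense of tempered distributions). For $j\ge2$ and functions $f_1,\dots,f_j$ on $\mathbb R^n$ define $Q_j(f_1,\dots,f_j)$ by $$\widehat{Q_j(f_1,\dots,f_j)}(\xi)=\int_{\mathbb R^n}e^{ik\theta\cdot y}\,(f_1R_k)(f_2R_k)\cdots(f_{j-1}R_k)\bigl(f_j\,e^{ik\theta\cdot(\cdot)}\bigr)(y)\,dy,\qquad k=\tfrac{|\xi|}2,\ \theta=-\tfrac{\xi}{|\xi|},\ \xi\ne0,$$ and, for $C_0>0$ and $\chi^*\in C^\infty(\mathbb R)$ with $\chi^*(t)=1$ for $t\ge 2C_0$ and $\chi^*(t)=0$ for $t<C_0$, define $\widetilde Q_j(f_1,\dots,f_j)$ by $\widehat{\widetilde Q_j(f_1,\dots,f_j)}(\xi)=\chi^*(|\xi|/2)\,\widehat{Q_j(f_1,\dots,f_j)}(\xi)$.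 Write $Q_j(q)=Q_j(q,\dots,q)$ and $\widetilde Q_j(q)=\widetilde Q_j(q,\dots,q)$. **Theorem (Leibniz formula for multiple scattering).** Let $\alpha\in\mathbb N^n$, $j\ge2$, and let $q\in W^{|\alpha|,2}(\mathbb R^n)$ be a complex-valued compactly supported function. If $n\ge 4+2|\alpha|$, assume moreover that $q\in L^r(\mathbb R^n)$ for some $r>n/2$ (for $n<4+2|\alpha|$, in particular for $n\le3$, this is automatic). Then for $q$ and for all multi-indices with $\beta_1+\dots+\beta_j=\alpha$ the weak derivatives $D^{\beta_l}q$ are functions, and the expressions defining $\widehat{Q_j(q)}(\xi)$ and $\widehat{Q_j(D^{\beta_1}q,\dots,D^{\beta_j}q)}(\xi)$ are meaningful for every $\xi\neq0$ (the resolvents exist as functions and the integrals converge absolutely). 1. If $n\ge2$, the functions of $\xi$ so obtained are tempered distributions, so that $Q_j(q)$ and $Q_j(D^{\beta_1}q,\dots,D^{\beta_j}q)$ are well-defined tempered distributions, and $$D^\alpha Q_j(q)=\sum_{\beta_1+\dots+\beta_j=\alpha}\frac{\alpha!}{\beta_1!\cdots\beta_j!}\,Q_j(D^{\beta_1}q,\dots,D^{\beta_j}q).$$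 2. For every $n\ge1$ and every $C_0$, $\chi^*$ as above, the corresponding statements hold for the high-frequency terms: they are well-defined tempered distributions and $$D^\alpha\widetilde Q_j(q)=\sum_{\beta_1+\dots+\beta_j=\alpha}\frac{\alpha!}{\beta_1!\cdots\beta_j!}\,\widetilde Q_j(D^{\beta_1}q,\dots,D^{\beta_j}q).$$ -/

import Mathlib

open MeasureTheory Filter Topology FourierTransform
open scoped SchwartzMap LineDeriv ENNReal ContDiff Nat

noncomputable section

namespace Backscattering

/-- Euclidean space `ℝⁿ`. -/
abbrev Eu (n : ℕ) := EuclideanSpace ℝ (Fin n)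

/-- The tempered distribution `T` is (integration against) the function `u`. -/
def IsFunction {n : ℕ} (T : 𝓢'(Eu n, ℂ)) (u : Eu n → ℂ) : Prop :=
  ∀ ψ : 𝓢(Eu n, ℂ), Integrable (fun x => ψ x * u x) ∧ T ψ = ∫ x, ψ x * u x

/-- The function `u` defines a tempered distribution by integration. -/
def IsTempered {n : ℕ} (u : Eu n → ℂ) : Prop :=
  ∃ T : 𝓢'(Eu n, ℂ), IsFunction T u

open Classical in
/-- The tempered distribution defined by the function `u` (zero if there is none). -/
def toDistribution {n : ℕ} (u : Eu n → ℂ) : 𝓢'(Eu n, ℂ) :=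
  if h : IsTempered u then h.choose else 0

/-- The distributional derivative `D^β T = ∂₁^{β₁} ⋯ ∂ₙ^{βₙ} T`. -/
def multiDeriv {n : ℕ} (β : Fin n → ℕ) (T : 𝓢'(Eu n, ℂ)) : 𝓢'(Eu n, ℂ) :=
  (List.finRange n).foldr
    (fun i S => (fun U : 𝓢'(Eu n, ℂ) => ∂_{EuclideanSpace.single i (1 : ℝ)} U)^[β i] S) T

open Classical in
/-- The weak derivative `D^β u` of a function `u`, as a function (unique up to null sets). -/
def weakDeriv {n : ℕ} (β : Fin n → ℕ) (u : Eu n → ℂ) : Eu n → ℂ :=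
  if h : ∃ v : Eu n → ℂ, IsFunction (multiDeriv β (toDistribution u)) v then h.choose else 0

/-- `u = R_k f`, the outgoing resolvent: as tempered distributions,
`û(ξ) = (k² - |ξ|² + i0)⁻¹ f̂(ξ)`, where `(k² - |ξ|² + i0)⁻¹` is the limit of
`(k² - |ξ|² + iε)⁻¹` as `ε → 0⁺`.  In Mathlib's normalization the frequency `ζ` of `𝓕`
corresponds to `ξ = 2πζ`. -/
def IsOutgoingResolvent {n : ℕ} (k : ℝ) (f u : Eu n → ℂ) : Prop :=
  Integrable f ∧ ∃ T : 𝓢'(Eu n, ℂ), IsFunction T u ∧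
    ∀ ψ : 𝓢(Eu n, ℂ),
      Tendsto
        (fun ε : ℝ => ∫ ζ : Eu n,
          ((k : ℂ) ^ 2 - (‖(2 * Real.pi) • ζ‖ : ℂ) ^ 2 + (ε : ℂ) * Complex.I)⁻¹ * 𝓕 f ζ * ψ ζ)
        (𝓝[>] 0) (𝓝 ((𝓕 T : 𝓢'(Eu n, ℂ)) ψ))

open Classical in
/-- The outgoing resolvent `R_k f` as a function (unique up to null sets). -/
def resolvent {n : ℕ} (k : ℝ) (f : Eu n → ℂ) : Eu n → ℂ :=
  if h : ∃ u : Eu n → ℂ, IsOutgoingResolvent k f u then h.choose else 0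

/-- For `[f₁, …, f_j]`: the function `(f₁ R_k) (f₂ R_k) ⋯ (f_{j-1} R_k) (f_j e)`. -/
def bornChain {n : ℕ} (k : ℝ) (e : Eu n → ℂ) : List (Eu n → ℂ) → Eu n → ℂ
  | [] => 0
  | [f] => fun x => f x * e x
  | f :: g :: l => fun x => f x * resolvent k (bornChain k e (g :: l)) x

/-- Each resolvent occurring in `bornChain` exists as a function. -/
def BornChainDefined {n : ℕ} (k : ℝ) (e : Eu n → ℂ) : List (Eu n → ℂ) → Prop
  | [] => True
  | [_] => True
  | _ :: g :: l => (∃ u : Eu n → ℂ, IsOutgoingResolvent k (bornChain k e (g :: l)) u) ∧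
      BornChainDefined k e (g :: l)

/-- The plane wave `x ↦ e^{i k θ·x}`. -/
def planeWave {n : ℕ} (k : ℝ) (θ : Eu n) (x : Eu n) : ℂ :=
  Complex.exp (Complex.I * ((k * inner ℝ θ x : ℝ) : ℂ))

/-- The wave number `k = |ξ|/2`. -/
def waveNumber {n : ℕ} (ξ : Eu n) : ℝ := ‖ξ‖ / 2

/-- The direction `θ = -ξ/|ξ|`. -/
def direction {n : ℕ} (ξ : Eu n) : Eu n := -(‖ξ‖⁻¹ • ξ)

/-- The integrand `e^{ikθ·y} (f₁ R_k) ⋯ (f_{j-1} R_k) (f_j e^{ikθ·(·)})(y)`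
with `k = |ξ|/2`, `θ = -ξ/|ξ|`. -/
def bornIntegrand {n : ℕ} (f : List (Eu n → ℂ)) (ξ y : Eu n) : ℂ :=
  planeWave (waveNumber ξ) (direction ξ) y *
    bornChain (waveNumber ξ) (planeWave (waveNumber ξ) (direction ξ)) f y

/-- The Fourier transform (convention `∫ e^{-ix·ξ} ⋯ dx`) of `Q_j(f₁, …, f_j)` at `ξ`. -/
def bornFourier {n : ℕ} (f : List (Eu n → ℂ)) (ξ : Eu n) : ℂ :=
  ∫ y, bornIntegrand f ξ y

/-- The expression defining `bornFourier f ξ` is meaningful at every frequency `ξ ≠ 0`. -/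
def BornFourierDefined {n : ℕ} (f : List (Eu n → ℂ)) : Prop :=
  ∀ ξ : Eu n, ξ ≠ 0 →
    BornChainDefined (waveNumber ξ) (planeWave (waveNumber ξ) (direction ξ)) f ∧
      Integrable (bornIntegrand f ξ)

/-- `bornFourier` in Mathlib's frequency variable `ζ = ξ/(2π)`. -/
def bornSymbol {n : ℕ} (f : List (Eu n → ℂ)) (ζ : Eu n) : ℂ :=
  bornFourier f ((2 * Real.pi) • ζ)

/-- `bornSymbol` multiplied by the cutoff `χ(|ξ|/2)`, `ξ = 2πζ`. -/
def bornSymbolCut {n : ℕ} (χ : ℝ → ℝ) (f : List (Eu n → ℂ)) (ζ : Eu n) : ℂ :=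
  (χ (‖(2 * Real.pi) • ζ‖ / 2) : ℂ) * bornSymbol f ζ

/-- The multiple scattering term `Q_j(f₁, …, f_j)` for `f = [f₁, …, f_j]`. -/
def Q {n : ℕ} (f : List (Eu n → ℂ)) : 𝓢'(Eu n, ℂ) :=
  𝓕⁻ (toDistribution (bornSymbol f))

/-- The high-frequency version `Q̃_j(f₁, …, f_j)` with cutoff `χ`. -/
def Qtilde {n : ℕ} (χ : ℝ → ℝ) (f : List (Eu n → ℂ)) : 𝓢'(Eu n, ℂ) :=
  𝓕⁻ (toDistribution (bornSymbolCut χ f))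

/-- `χ ∈ C^∞(ℝ)`, `χ(t) = 1` for `t ≥ 2C₀`, `χ(t) = 0` for `t < C₀`. -/
structure IsHighFrequencyCutoff (C₀ : ℝ) (χ : ℝ → ℝ) : Prop where
  smooth : ContDiff ℝ ∞ χ
  eq_one : ∀ t, 2 * C₀ ≤ t → χ t = 1
  eq_zero : ∀ t, t < C₀ → χ t = 0

/-- All `(β₁, …, β_j)` with `β₁ + ⋯ + β_j = α`. -/
def splittings {n : ℕ} (j : ℕ) (α : Fin n → ℕ) : Finset (Fin j → Fin n → ℕ) :=
  (Fintype.piFinset fun _ : Fin j => Fintype.piFinset fun i : Fin n =>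
    Finset.range (α i + 1)).filter (fun β => ∑ l, β l = α)

/-- The multinomial coefficient `α! / (β₁! ⋯ β_j!)`. -/
def coeff {n j : ℕ} (α : Fin n → ℕ) (β : Fin j → Fin n → ℕ) : ℂ :=
  (∏ i, ((α i)! : ℂ)) / ∏ l, ∏ i, ((β l i)! : ℂ)

/-- The list `[D^{β₁} q, …, D^{β_j} q]`. -/
def derivList {n j : ℕ} (β : Fin j → Fin n → ℕ) (q : Eu n → ℂ) : List (Eu n → ℂ) :=
  List.ofFn fun l => weakDeriv (β l) q

end Backscattering

end

/-!
For a kernel `K` and a plane wave `e` let `B(f₁, …, f_j) = ∫ e f₁ (K * (f₂ (K * ⋯ (f_j e))))`.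
Convolution commutes with derivatives, and for `e(x) = e^{ikθ·x}` with `k = |ξ|/2`, `θ = -ξ/|ξ|`
one has `∂_i e = -(i ξ_i / 2) e`, for both occurrences of `e`. Integrating `∂_i` of the whole
integrand gives zero, whence `i ξ_i B(f₁, …, f_j) = ∑_l B(f₁, …, ∂_i f_l, …, f_j)` for test
functions (`fderiv_chain`, `integral_leibniz`). Applied with `K` the outgoing fundamental solution
of the Helmholtz equation and iterated, this is the Leibniz formula on the Fourier side; the
multinomial coefficients come from their recursion (`sum_coeff_raise`,
`Setting.prod_mul_bornFourier`). An identity of symbols that are tempered functions carries over to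
distributions (`multiDeriv_eq_sum`). What remains is to make sense of these expressions for a
Sobolev potential, which rests on three facts.

*The resolvent is a convolution.* The fundamental solution for `k² + iε` is a superposition of
heat kernels along a path of times running from `0` to `1` and then to `1 + i∞`. After an
integration by parts on the second half, the integral converges absolutely for `ε = 0` as well
(`unitGreen`, `unitGreen_fourier`), with singularity at most `|x|^{-σ}` for any `σ ≥ 0` exceeding
`n - 2`, and with explicit dependence on `k` (`norm_green_le`). Dominated convergence as `ε → 0`
identifies the outgoing resolvent of an integrable function of bounded support with the
convolution (`isOutgoingResolvent_convOp`, `resolvent_ae_eq`). This works in every dimension and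
uses no Bessel functions.

*Integrability of the derivatives.* There are `ρ < 2/n` and `κ ≥ 0` with `ρ + |α| κ ≤ 1/2` such that
`D^β q` lies in `L^p`, `1/p = ρ + |β| κ`, for `|β| ≤ |α|` (`WeakJet.exists_exponents`). In low
dimensions `p = 2` suffices; if `4 ≤ n < 4 + 2|α|` this is the Sobolev embedding, and if
`n ≥ 4 + 2|α|` it follows from `q ∈ L^r` by Gagliardo–Nirenberg interpolation (`eLpNorm_sq_le`).

*Chains are bounded and continuous in their factors.* A kernel in `L^{1/(1-ρ)}`, which the truncated
fundamental solution is because `ρ n < 2`, maps `L^{1/(ρ+C)}` to `L^{1/C}` by Young's inequality,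
and multiplication by a function in `L^{1/(ρ+c)}` then leads to `L^{1/(ρ+c+C)}`
(`eLpNorm_mul_convOp_le`). As the orders `|β_l|` add up to `|α|`, the exponents of a chain add up
to at most `1` in the reciprocal. So the chains converge absolutely, and mollification extends the
formula from test functions to `q` (`tendsto_eLpNorm_chain_sub`, `Setting.tendsto_born`,
`Setting.mul_bornFourier`). The same estimate bounds the symbols by powers of `|ξ|`
(`exists_norm_bornFourier_le`). With `σ` close to `n - 2`, which is possible when `n ≥ 2`, the
singularity at the origin is integrable; for `n = 1` it is removed by the cutoff
(`isTempered_bornSymbol`, `isTempered_bornSymbolCut`).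
-/

noncomputable section

namespace Backscattering

variable {n : ℕ}

/-! ### Tempered functions and their derivatives -/

lemma IsFunction.locallyIntegrable {T : 𝓢'(Eu n, ℂ)} {u : Eu n → ℂ} (h : IsFunction T u) :
    LocallyIntegrable u := by
  intro x
  let f : ContDiffBump x := ⟨1, 2, one_pos, one_lt_two⟩
  have h1 : HasCompactSupport (Complex.ofRealCLM ∘ f) := f.hasCompactSupport.comp_left rfl
  have h2 : ContDiff ℝ ∞ (Complex.ofRealCLM ∘ f) := Complex.ofRealCLM.contDiff.comp f.contDiff
  have h3 := (h (h1.toSchwartzMap h2)).1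
  refine ⟨Metric.closedBall x 1, Metric.closedBall_mem_nhds x one_pos, ?_⟩
  refine (h3.integrableOn (s := Metric.closedBall x 1)).congr_fun ?_
    measurableSet_closedBall
  intro y hy
  have : f y = 1 := f.one_of_mem_closedBall hy
  simp [this]

lemma IsFunction.integral_smul {T : 𝓢'(Eu n, ℂ)} {u : Eu n → ℂ} (h : IsFunction T u)
    {g : Eu n → ℝ} (hg : ContDiff ℝ ∞ g) (hc : HasCompactSupport g) :
    ∫ x, g x • u x = T ((hc.comp_left (g := Complex.ofRealCLM) rfl).toSchwartzMap
      (Complex.ofRealCLM.contDiff.comp hg)) := by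
  rw [(h _).2]
  simp

lemma IsFunction.ae_unique {T : 𝓢'(Eu n, ℂ)} {u v : Eu n → ℂ} (hu : IsFunction T u)
    (hv : IsFunction T v) : u =ᵐ[volume] v := by
  refine ae_eq_of_integral_contDiff_smul_eq hu.locallyIntegrable hv.locallyIntegrable ?_
  intro g hg hc
  rw [hu.integral_smul hg hc, hv.integral_smul hg hc]

lemma IsFunction.congr {T : 𝓢'(Eu n, ℂ)} {u v : Eu n → ℂ} (hu : IsFunction T u)
    (h : u =ᵐ[volume] v) : IsFunction T v := by
  intro ψ
  have h1 : (fun x => ψ x * u x) =ᵐ[volume] fun x => ψ x * v x := by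
    filter_upwards [h] with x hx
    rw [hx]
  exact ⟨(hu ψ).1.congr h1, by rw [(hu ψ).2, integral_congr_ae h1]⟩

lemma IsFunction.eq {T S : 𝓢'(Eu n, ℂ)} {u : Eu n → ℂ} (hT : IsFunction T u)
    (hS : IsFunction S u) : T = S := by
  ext ψ
  rw [(hT ψ).2, (hS ψ).2]

lemma IsFunction.toDistribution_eq {T : 𝓢'(Eu n, ℂ)} {u : Eu n → ℂ} (hT : IsFunction T u) :
    toDistribution u = T := by
  have h : IsTempered u := ⟨T, hT⟩
  rw [toDistribution, dif_pos h]
  exact h.choose_spec.eq hT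

lemma IsTempered.isFunction {u : Eu n → ℂ} (h : IsTempered u) :
    IsFunction (toDistribution u) u := by
  obtain ⟨T, hT⟩ := h
  rwa [hT.toDistribution_eq]

/-- `weakDeriv β u` represents the distributional derivative as soon as some function does. -/
lemma isFunction_weakDeriv {T : 𝓢'(Eu n, ℂ)} {u v : Eu n → ℂ} {β : Fin n → ℕ}
    (hT : IsFunction T u) (hv : IsFunction (multiDeriv β T) v) :
    IsFunction (multiDeriv β T) (weakDeriv β u) := by
  rw [← hT.toDistribution_eq] at hv ⊢
  have h : ∃ v : Eu n → ℂ, IsFunction (multiDeriv β (toDistribution u)) v := ⟨v, hv⟩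
  rw [weakDeriv, dif_pos h]
  exact h.choose_spec

lemma isFunction_toLp {u : Eu n → ℂ} {p : ℝ≥0∞} [Fact (1 ≤ p)] (hu : MemLp u p volume) :
    IsFunction (Lp.toTemperedDistribution (hu.toLp u)) u := by
  intro ψ
  have h1 : (fun x => ψ x • (hu.toLp u) x) =ᵐ[volume] fun x => ψ x * u x := by
    filter_upwards [hu.coeFn_toLp] with x hx
    rw [hx, smul_eq_mul]
  refine ⟨?_, by rw [Lp.toTemperedDistribution_apply, integral_congr_ae h1]⟩
  have : ENNReal.HolderConjugate p (1 - p⁻¹)⁻¹ :=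
    ENNReal.HolderConjugate.inv_one_sub_inv' Fact.out
  exact (ψ.memLp (1 - p⁻¹)⁻¹ volume).integrable_mul hu

/-- A function that becomes integrable after division by a power of `1 + ‖x‖` is a tempered
distribution. -/
lemma isTempered_of_integrable {u : Eu n → ℂ} (N : ℕ)
    (hu : Integrable (fun x => ((1 + ‖x‖) ^ N)⁻¹ • u x)) : IsTempered u := by
  have hbound : ∀ (ψ : 𝓢(Eu n, ℂ)) (x : Eu n), ‖ψ x * u x‖ ≤
      2 ^ N * (Finset.Iic ((N, 0) : ℕ × ℕ)).sup (schwartzSeminormFamily ℂ (Eu n) ℂ) ψ *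
        ‖((1 + ‖x‖) ^ N)⁻¹ • u x‖ := by
    intro ψ x
    have h1 := ψ.one_add_le_sup_seminorm_apply (𝕜 := ℂ) (m := (N, 0)) (k := N) (n := 0)
      le_rfl le_rfl x
    rw [norm_iteratedFDeriv_zero] at h1
    have h2 : 0 < (1 + ‖x‖) ^ N := by positivity
    rw [norm_mul, norm_smul, norm_inv, Real.norm_of_nonneg h2.le]
    calc ‖ψ x‖ * ‖u x‖ = (1 + ‖x‖) ^ N * ‖ψ x‖ * (((1 + ‖x‖) ^ N)⁻¹ * ‖u x‖) := by
          field_simp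
      _ ≤ _ := mul_le_mul_of_nonneg_right h1 (by positivity)
  have hmeas : AEStronglyMeasurable u volume := by
    have h1 : AEStronglyMeasurable (fun x : Eu n => (1 + ‖x‖) ^ N) volume := by
      fun_prop
    have h2 := h1.smul hu.aestronglyMeasurable
    refine h2.congr (Eventually.of_forall fun x => ?_)
    have : (0 : ℝ) < (1 + ‖x‖) ^ N := by positivity
    simp only [Pi.smul_apply', smul_smul]
    rw [mul_inv_cancel₀ this.ne', one_smul]
  have hint : ∀ ψ : 𝓢(Eu n, ℂ), Integrable (fun x => ψ x * u x) := fun ψ =>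
    (hu.norm.const_mul _).mono' (ψ.continuous.aestronglyMeasurable.mul hmeas)
      (Eventually.of_forall (hbound ψ))
  let T : 𝓢(Eu n, ℂ) →L[ℂ] ℂ := SchwartzMap.mkCLMtoNormedSpace (𝕜 := ℂ)
    (fun ψ : 𝓢(Eu n, ℂ) => ∫ x, ψ x * u x)
    (fun f g => by
      rw [← integral_add (hint f) (hint g)]
      simp [add_mul])
    (fun a f => by
      rw [RingHom.id_apply, smul_eq_mul, ← integral_const_mul]
      simp [mul_assoc])
    ⟨Finset.Iic ((N, 0) : ℕ × ℕ), 2 ^ N * ∫ x, ‖((1 + ‖x‖) ^ N)⁻¹ • u x‖,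
      by positivity, fun ψ => by
      refine (norm_integral_le_integral_norm _).trans ?_
      refine (integral_mono (hint ψ).norm (hu.norm.const_mul _) (hbound ψ)).trans ?_
      rw [integral_const_mul]
      apply le_of_eq
      ring⟩
  exact ⟨ContinuousLinearMap.toPointwiseConvergenceCLM _ _ _ _ T,
    fun ψ => ⟨hint ψ, rfl⟩⟩

/-- The Fourier symbol `∏ᵢ (2πi ζᵢ)^{αᵢ}` of `D^α`. -/
def derivSymbol (α : Fin n → ℕ) (ζ : Eu n) : ℂ :=
  ∏ i, (2 * Real.pi * Complex.I * (ζ i : ℂ)) ^ α i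

lemma hasTemperateGrowth_coordSymbol (i : Fin n) :
    (fun ζ : Eu n => 2 * Real.pi * Complex.I * (ζ i : ℂ)).HasTemperateGrowth := by
  have h : (fun ζ : Eu n => ((EuclideanSpace.proj i : Eu n →L[ℝ] ℝ) ζ)).HasTemperateGrowth :=
    ContinuousLinearMap.hasTemperateGrowth _
  have h2 : (fun ζ : Eu n => (Complex.ofRealCLM
      ((EuclideanSpace.proj i : Eu n →L[ℝ] ℝ) ζ))).HasTemperateGrowth :=
    Complex.ofRealCLM.hasTemperateGrowth.comp h
  exact (Function.HasTemperateGrowth.const _).mul h2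

lemma hasTemperateGrowth_coordSymbol_pow (i : Fin n) (k : ℕ) :
    (fun ζ : Eu n => (2 * Real.pi * Complex.I * (ζ i : ℂ)) ^ k).HasTemperateGrowth := by
  induction k with
  | zero => simp
  | succ k ih =>
    simp only [pow_succ]
    exact ih.mul (hasTemperateGrowth_coordSymbol i)

lemma hasTemperateGrowth_listSymbol (α : Fin n → ℕ) (l : List (Fin n)) :
    (fun ζ : Eu n => (l.map fun i => (2 * Real.pi * Complex.I * (ζ i : ℂ)) ^ α i).prod
      ).HasTemperateGrowth := by
  induction l with
  | nil => simp
  | cons i l ih =>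
    simp only [List.map_cons, List.prod_cons]
    exact (hasTemperateGrowth_coordSymbol_pow i (α i)).mul ih

lemma lineDeriv_fourierInv (S : 𝓢'(Eu n, ℂ)) (i : Fin n) :
    ∂_{EuclideanSpace.single i (1 : ℝ)} (𝓕⁻ S) = 𝓕⁻ (TemperedDistribution.smulLeftCLM ℂ
      (fun ζ : Eu n => 2 * Real.pi * Complex.I * (ζ i : ℂ)) S) := by
  rw [TemperedDistribution.lineDerivOp_fourierInv_eq]
  congr 1
  have h : (fun ζ : Eu n => ((inner ℝ ζ (EuclideanSpace.single i (1 : ℝ)) : ℝ) : ℂ)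
      ).HasTemperateGrowth := by fun_prop
  rw [← _root_.smul_apply, ← TemperedDistribution.smulLeftCLM_smul h]
  congr 2
  ext ζ
  simp [EuclideanSpace.inner_single_right]

/-- On the Fourier side `D^α` is multiplication by its symbol. -/
lemma multiDeriv_fourierInv (α : Fin n → ℕ) (S : 𝓢'(Eu n, ℂ)) :
    multiDeriv α (𝓕⁻ S) = 𝓕⁻ (TemperedDistribution.smulLeftCLM ℂ (derivSymbol α) S) := by
  have hit : ∀ (i : Fin n) (k : ℕ) (g : Eu n → ℂ), g.HasTemperateGrowth →
      (fun U : 𝓢'(Eu n, ℂ) => ∂_{EuclideanSpace.single i (1 : ℝ)} U)^[k]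
        (𝓕⁻ (TemperedDistribution.smulLeftCLM ℂ g S)) =
      𝓕⁻ (TemperedDistribution.smulLeftCLM ℂ
        (fun ζ => (2 * Real.pi * Complex.I * (ζ i : ℂ)) ^ k * g ζ) S) := by
    intro i k g hg
    induction k with
    | zero => simp
    | succ k ih =>
      rw [Function.iterate_succ_apply', ih, lineDeriv_fourierInv,
        TemperedDistribution.smulLeftCLM_smulLeftCLM_apply
          (g₁ := fun ζ => (2 * Real.pi * Complex.I * (ζ i : ℂ)) ^ k * g ζ)
          ((hasTemperateGrowth_coordSymbol_pow i k).mul hg) (hasTemperateGrowth_coordSymbol i)]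
      congr 3
      ext ζ
      simp only [Pi.mul_apply]
      ring
  have hl : ∀ l : List (Fin n), l.foldr
      (fun i S => (fun U : 𝓢'(Eu n, ℂ) => ∂_{EuclideanSpace.single i (1 : ℝ)} U)^[α i] S)
        (𝓕⁻ S) = 𝓕⁻ (TemperedDistribution.smulLeftCLM ℂ
          (fun ζ => (l.map fun i => (2 * Real.pi * Complex.I * (ζ i : ℂ)) ^ α i).prod) S) := by
    intro l
    induction l with
    | nil => simp
    | cons i l ih =>
      rw [List.foldr_cons, ih, hit _ _ _ (hasTemperateGrowth_listSymbol α l)]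
      simp
  have hs : (fun ζ : Eu n => ((List.finRange n).map
      fun i => (2 * Real.pi * Complex.I * (ζ i : ℂ)) ^ α i).prod) = derivSymbol α := by
    ext ζ
    rw [derivSymbol, ← List.prod_ofFn, List.ofFn_eq_map]
  rw [multiDeriv, hl, hs]

lemma hasTemperateGrowth_derivSymbol (α : Fin n → ℕ) :
    (derivSymbol α : Eu n → ℂ).HasTemperateGrowth := by
  have := hasTemperateGrowth_listSymbol α (List.finRange n)
  convert this using 2 with ζ
  rw [derivSymbol, ← List.prod_ofFn, List.ofFn_eq_map]

lemma multiDeriv_eq (α : Fin n → ℕ) (T : 𝓢'(Eu n, ℂ)) :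
    multiDeriv α T = 𝓕⁻ (TemperedDistribution.smulLeftCLM ℂ (derivSymbol α) (𝓕 T)) := by
  rw [← multiDeriv_fourierInv, FourierTransform.fourierInv_fourier_eq]

lemma multiDeriv_zero (T : 𝓢'(Eu n, ℂ)) : multiDeriv 0 T = T := by
  rw [multiDeriv_eq]
  have : (derivSymbol 0 : Eu n → ℂ) = fun _ => 1 := by
    ext ζ; simp [derivSymbol]
  rw [this]
  simp

lemma multiDeriv_add_single (β : Fin n → ℕ) (i : Fin n) (T : 𝓢'(Eu n, ℂ)) :
    multiDeriv (β + Pi.single i 1) T =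
      ∂_{EuclideanSpace.single i (1 : ℝ)} (multiDeriv β T) := by
  rw [multiDeriv_eq, multiDeriv_eq, lineDeriv_fourierInv,
    TemperedDistribution.smulLeftCLM_smulLeftCLM_apply (hasTemperateGrowth_derivSymbol β)
      (hasTemperateGrowth_coordSymbol i)]
  congr 3
  ext ζ
  simp only [derivSymbol, Pi.mul_apply, Pi.add_apply, pow_add, Finset.prod_mul_distrib]
  congr 1
  rw [Finset.prod_eq_single i]
  · simp
  · intro j _ hj
    simp [hj]
  · simp

lemma IsFunction.smulLeft {S : 𝓢'(Eu n, ℂ)} {u g : Eu n → ℂ} (hS : IsFunction S u)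
    (hg : g.HasTemperateGrowth) :
    IsFunction (TemperedDistribution.smulLeftCLM ℂ g S) (fun ζ => g ζ * u ζ) := by
  intro ψ
  have := hS (SchwartzMap.smulLeftCLM ℂ g ψ)
  rw [TemperedDistribution.smulLeftCLM_apply_apply]
  simp only [SchwartzMap.smulLeftCLM_apply_apply hg, smul_eq_mul] at this
  simp only [mul_assoc, mul_left_comm (g _)] at this
  exact this

lemma IsFunction.add {S T : 𝓢'(Eu n, ℂ)} {u v : Eu n → ℂ} (hS : IsFunction S u)
    (hT : IsFunction T v) : IsFunction (S + T) (fun ζ => u ζ + v ζ) := by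
  intro ψ
  have h1 := hS ψ
  have h2 := hT ψ
  simp only [mul_add]
  refine ⟨h1.1.add h2.1, ?_⟩
  rw [integral_add h1.1 h2.1, ← h1.2, ← h2.2]
  rfl

lemma IsFunction.const_smul {S : 𝓢'(Eu n, ℂ)} {u : Eu n → ℂ} (c : ℂ) (hS : IsFunction S u) :
    IsFunction (c • S) (fun ζ => c * u ζ) := by
  intro ψ
  have h1 := hS ψ
  simp only [mul_left_comm _ c]
  refine ⟨h1.1.const_mul c, ?_⟩
  rw [integral_const_mul, ← h1.2]
  rfl

lemma isFunction_zero : IsFunction (0 : 𝓢'(Eu n, ℂ)) (fun _ => 0) := by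
  intro ψ
  simp

lemma IsFunction.sum {ι : Type*} (s : Finset ι) {S : ι → 𝓢'(Eu n, ℂ)} {u : ι → Eu n → ℂ}
    (h : ∀ i ∈ s, IsFunction (S i) (u i)) :
    IsFunction (∑ i ∈ s, S i) (fun ζ => ∑ i ∈ s, u i ζ) := by
  classical
  induction s using Finset.induction_on with
  | empty => simpa using isFunction_zero
  | insert a s ha ih =>
    simp only [Finset.sum_insert ha]
    exact (h a (Finset.mem_insert_self _ _)).add
      (ih fun i hi => h i (Finset.mem_insert_of_mem hi))

/-! ### Young's inequality -/

/-- The integral operator with convolution kernel `K`. -/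
def convOp (K g : Eu n → ℂ) (x : Eu n) : ℂ := ∫ y, K (x - y) * g y

/-- The Lebesgue exponent with reciprocal `c`. -/
def recipExp (c : ℝ) : ℝ≥0∞ := ENNReal.ofReal c⁻¹

lemma recipExp_ne_top (c : ℝ) : recipExp c ≠ ⊤ := ENNReal.ofReal_ne_top

lemma recipExp_ne_zero {c : ℝ} (hc : 0 < c) : recipExp c ≠ 0 := by
  simp [recipExp, hc]

lemma recipExp_toReal {c : ℝ} (hc : 0 < c) : (recipExp c).toReal = c⁻¹ := by
  rw [recipExp, ENNReal.toReal_ofReal (by positivity)]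

lemma recipExp_inv {c : ℝ} (hc : 0 < c) : (recipExp c)⁻¹ = ENNReal.ofReal c := by
  rw [recipExp, ENNReal.ofReal_inv_of_pos hc, inv_inv]

lemma one_le_recipExp {c : ℝ} (hc : 0 < c) (hc1 : c ≤ 1) : 1 ≤ recipExp c := by
  rw [recipExp, ENNReal.one_le_ofReal]
  exact (one_le_inv₀ hc).2 hc1

lemma recipExp_le {c d : ℝ} (hc : 0 < c) (hd : c ≤ d) : recipExp d ≤ recipExp c :=
  ENNReal.ofReal_le_ofReal (inv_anti₀ hc hd)

lemma recipExp_one : recipExp 1 = 1 := by simp [recipExp]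

lemma recipExp_half : recipExp (1 / 2) = 2 := by simp [recipExp]

lemma eLpNorm_recipExp {F : Type*} [NormedAddCommGroup F] {c : ℝ} (hc : 0 < c) (f : Eu n → F) :
    eLpNorm f (recipExp c) volume = (∫⁻ x, ‖f x‖ₑ ^ c⁻¹) ^ c := by
  rw [eLpNorm_eq_lintegral_rpow_enorm_toReal (recipExp_ne_zero hc) (recipExp_ne_top c),
    recipExp_toReal hc, one_div, inv_inv]

lemma holderTriple_recipExp {a b : ℝ} (ha : 0 < a) (hb : 0 < b) :
    ENNReal.HolderTriple (recipExp a) (recipExp b) (recipExp (a + b)) := by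
  refine ⟨?_⟩
  rw [recipExp_inv ha, recipExp_inv hb, recipExp_inv (by positivity),
    ENNReal.ofReal_add ha.le hb.le]

/-- **Young's convolution inequality**: the exponents have reciprocals `ρ + C`, `1 - ρ`
and `C`. -/
lemma lintegral_conv_rpow_le {ρ C : ℝ} (hρ : 0 ≤ ρ) (hC : 0 < C) (h : ρ + C ≤ 1)
    {g K : Eu n → ℝ≥0∞} (hg : AEMeasurable g volume) (hK : AEMeasurable K volume) :
    ∫⁻ x, (∫⁻ y, K (x - y) * g y) ^ C⁻¹ ≤
      (∫⁻ y, g y ^ (ρ + C)⁻¹) ^ ((ρ + C) * C⁻¹) *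
        (∫⁻ y, K y ^ (1 - ρ)⁻¹) ^ ((1 - ρ) * C⁻¹) := by
  set a := (ρ + C)⁻¹ with ha
  set b := (1 - ρ)⁻¹ with hb
  have hρC : 0 < ρ + C := by positivity
  have hρ1 : 0 < 1 - ρ := by linarith
  have ha0 : 0 < a := by positivity
  have hb0 : 0 < b := by positivity
  set A := ∫⁻ y, g y ^ a
  set B := ∫⁻ y, K y ^ b
  have hKx : ∀ x : Eu n, AEMeasurable (fun y => K (x - y)) volume := fun x =>
    hK.comp_quasiMeasurePreserving (quasiMeasurePreserving_sub_left volume x)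
  have hKB : ∀ x : Eu n, ∫⁻ y, K (x - y) ^ b = B := fun x =>
    lintegral_sub_left_eq_self (μ := (volume : Measure (Eu n))) (fun y => K y ^ b) x
  have key : ∀ x : Eu n, (∫⁻ y, K (x - y) * g y) ≤
      (∫⁻ y, g y ^ a * K (x - y) ^ b) ^ C * A ^ ρ * B ^ (1 - ρ - C) := by
    intro x
    have h3 := ENNReal.lintegral_prod_norm_pow_le (μ := (volume : Measure (Eu n)))
      (Finset.univ : Finset (Fin 3))
      (f := ![fun y => g y ^ a * K (x - y) ^ b, fun y => g y ^ a, fun y => K (x - y) ^ b])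
      (p := ![C, ρ, 1 - ρ - C])
      (by
        intro i _
        fin_cases i
        · exact (hg.pow_const a).mul ((hKx x).pow_const b)
        · exact hg.pow_const a
        · exact (hKx x).pow_const b)
      (by
        simp only [Fin.sum_univ_three, Matrix.cons_val_zero, Matrix.cons_val_one, Matrix.cons_val]
        ring)
      (by
        intro i _
        fin_cases i
        · exact hC.le
        · exact hρ
        · show 0 ≤ 1 - ρ - C
          linarith)
    simp only [Fin.prod_univ_three, Matrix.cons_val_zero, Matrix.cons_val_one,
      Matrix.cons_val_two, Matrix.tail_cons, Matrix.head_cons] at h3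
    rw [hKB x] at h3
    refine le_trans (le_of_eq (lintegral_congr fun y => ?_)) h3
    rw [ENNReal.mul_rpow_of_nonneg _ _ hC.le, ← ENNReal.rpow_mul, ← ENNReal.rpow_mul,
      ← ENNReal.rpow_mul, ← ENNReal.rpow_mul]
    have e1 : g y = g y ^ (a * C) * g y ^ (a * ρ) := by
      rw [← ENNReal.rpow_add_of_nonneg _ _ (by positivity) (by positivity), ← mul_add,
        add_comm C, ha, inv_mul_cancel₀ hρC.ne', ENNReal.rpow_one]
    have e2 : K (x - y) = K (x - y) ^ (b * C) * K (x - y) ^ (b * (1 - ρ - C)) := by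
      rw [← ENNReal.rpow_add_of_nonneg _ _ (by positivity)
        (mul_nonneg hb0.le (by linarith)), ← mul_add]
      have : C + (1 - ρ - C) = 1 - ρ := by ring
      rw [this, hb, inv_mul_cancel₀ hρ1.ne', ENNReal.rpow_one]
    conv_lhs => rw [e1, e2]
    ring
  have hfub : ∫⁻ x, ∫⁻ y, g y ^ a * K (x - y) ^ b = A * B := by
    rw [lintegral_lintegral_swap]
    · have : ∀ y : Eu n, ∫⁻ x, g y ^ a * K (x - y) ^ b = g y ^ a * B := by
        intro y
        rw [lintegral_const_mul'']
        · congr 1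
          exact lintegral_sub_right_eq_self (μ := (volume : Measure (Eu n)))
            (fun y => K y ^ b) y
        · exact (hK.comp_quasiMeasurePreserving
            (measurePreserving_sub_right volume y).quasiMeasurePreserving).pow_const b
      simp_rw [this]
      rw [lintegral_mul_const'' _ (hg.pow_const a)]
    · refine ((hg.comp_snd).pow_const a).mul (AEMeasurable.pow_const ?_ b)
      exact hK.comp_quasiMeasurePreserving
        (quasiMeasurePreserving_sub_of_right_invariant volume volume)
  calc ∫⁻ x, (∫⁻ y, K (x - y) * g y) ^ C⁻¹
      ≤ ∫⁻ x, (∫⁻ y, g y ^ a * K (x - y) ^ b) *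
          (A ^ (ρ * C⁻¹) * B ^ ((1 - ρ - C) * C⁻¹)) := by
        refine lintegral_mono fun x => ?_
        refine (ENNReal.rpow_le_rpow (key x) (by positivity)).trans (le_of_eq ?_)
        rw [ENNReal.mul_rpow_of_nonneg _ _ (by positivity),
          ENNReal.mul_rpow_of_nonneg _ _ (by positivity), ← ENNReal.rpow_mul,
          ← ENNReal.rpow_mul, ← ENNReal.rpow_mul, mul_inv_cancel₀ hC.ne', ENNReal.rpow_one,
          mul_assoc]
    _ = A * B * (A ^ (ρ * C⁻¹) * B ^ ((1 - ρ - C) * C⁻¹)) := by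
        rw [lintegral_mul_const'', hfub]
        have := (((hg.comp_snd (μ := (volume : Measure (Eu n)))).pow_const a).mul
          ((hK.comp_quasiMeasurePreserving
          (quasiMeasurePreserving_sub_of_right_invariant volume volume)).pow_const
            b)).lintegral_prod_right'
        exact this
    _ = A ^ ((ρ + C) * C⁻¹) * B ^ ((1 - ρ) * C⁻¹) := by
        have e1 : A ^ ((ρ + C) * C⁻¹) = A * A ^ (ρ * C⁻¹) := by
          rw [add_mul, mul_inv_cancel₀ hC.ne', add_comm,
            ENNReal.rpow_add_of_nonneg _ _ zero_le_one (by positivity), ENNReal.rpow_one]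
        have e2 : B ^ ((1 - ρ) * C⁻¹) = B * B ^ ((1 - ρ - C) * C⁻¹) := by
          have : (1 - ρ) * C⁻¹ = 1 + (1 - ρ - C) * C⁻¹ := by field_simp; ring
          rw [this, ENNReal.rpow_add_of_nonneg _ _ zero_le_one
            (mul_nonneg (by linarith) (by positivity)), ENNReal.rpow_one]
        rw [e1, e2]
        ring

lemma aestronglyMeasurable_convOp {K g : Eu n → ℂ} (hK : AEStronglyMeasurable K volume)
    (hg : AEStronglyMeasurable g volume) : AEStronglyMeasurable (convOp K g) volume := by
  have h1 : AEStronglyMeasurable (fun p : Eu n × Eu n => K (p.1 - p.2) * g p.2)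
      (volume.prod volume) :=
    (hK.comp_quasiMeasurePreserving
      (quasiMeasurePreserving_sub_of_right_invariant volume volume)).mul hg.comp_snd
  exact h1.integral_prod_right'

lemma eLpNorm_convOp_le {ρ C : ℝ} (hρ : 0 ≤ ρ) (hC : 0 < C) (h : ρ + C ≤ 1)
    {K g : Eu n → ℂ} (hK : AEStronglyMeasurable K volume) (hg : AEStronglyMeasurable g volume) :
    eLpNorm (convOp K g) (recipExp C) volume ≤
      eLpNorm K (recipExp (1 - ρ)) volume * eLpNorm g (recipExp (ρ + C)) volume := by
  have hρC : 0 < ρ + C := by positivity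
  have hρ1 : 0 < 1 - ρ := by linarith
  rw [eLpNorm_recipExp hC, eLpNorm_recipExp hρ1, eLpNorm_recipExp hρC]
  have h1 : ∫⁻ x, ‖convOp K g x‖ₑ ^ C⁻¹ ≤ ∫⁻ x, (∫⁻ y, ‖K (x - y)‖ₑ * ‖g y‖ₑ) ^ C⁻¹ := by
    refine lintegral_mono fun x => ENNReal.rpow_le_rpow ?_ (by positivity)
    refine (enorm_integral_le_lintegral_enorm _).trans (le_of_eq ?_)
    simp [enorm_mul]
  have h2 := h1.trans (lintegral_conv_rpow_le hρ hC h hg.enorm hK.enorm)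
  refine (ENNReal.rpow_le_rpow h2 hC.le).trans (le_of_eq ?_)
  rw [ENNReal.mul_rpow_of_nonneg _ _ hC.le, ← ENNReal.rpow_mul, ← ENNReal.rpow_mul,
    mul_assoc, mul_assoc, inv_mul_cancel₀ hC.ne', mul_one, mul_one, mul_comm]

lemma eLpNorm_mul_convOp_le {ρ c C : ℝ} (hρ : 0 ≤ ρ) (hc : 0 < c) (hC : 0 < C)
    (h : ρ + C ≤ 1) {f K g : Eu n → ℂ} (hf : AEStronglyMeasurable f volume)
    (hK : AEStronglyMeasurable K volume) (hg : AEStronglyMeasurable g volume) :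
    eLpNorm (fun x => f x * convOp K g x) (recipExp (c + C)) volume ≤
      eLpNorm f (recipExp c) volume *
        (eLpNorm K (recipExp (1 - ρ)) volume * eLpNorm g (recipExp (ρ + C)) volume) := by
  have := holderTriple_recipExp hc hC
  refine (eLpNorm_smul_le_mul_eLpNorm (p := recipExp c) (q := recipExp C)
    (aestronglyMeasurable_convOp hK hg) hf).trans ?_
  gcongr
  exact eLpNorm_convOp_le hρ hC h hK hg

/-! ### Weak derivatives of compactly supported Sobolev functions -/

/-- `f` vanishes almost everywhere outside the ball of radius `R` about the origin. -/
def SupportedIn (R : ℝ) (f : Eu n → ℂ) : Prop := ∀ᵐ x, R < ‖x‖ → f x = 0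

/-- A family `v` indexed by the multi-indices of order at most `m`: square integrable functions
supported in the ball of radius `R`, each of them the weak partial derivative of its
predecessors. -/
structure WeakJet (m : ℕ) (R : ℝ) (v : (Fin n → ℕ) → Eu n → ℂ) : Prop where
  memLp : ∀ β, ∑ i, β i ≤ m → MemLp (v β) 2 volume
  supp : ∀ β, ∑ i, β i ≤ m → SupportedIn R (v β)
  parts : ∀ β i, ∑ i, β i + 1 ≤ m → ∀ g : Eu n → ℝ, ContDiff ℝ ∞ g → HasCompactSupport g →
    ∫ x, g x • v (β + Pi.single i 1) x =
      -∫ x, fderiv ℝ g x (EuclideanSpace.single i 1) • v β x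

/-- A derivative of order `|β|` costs `|β|` orders of Sobolev regularity. -/
lemma memSobolev_multiDeriv {s : ℝ} {T : 𝓢'(Eu n, ℂ)}
    (hT : TemperedDistribution.MemSobolev s 2 T) (β : Fin n → ℕ) :
    TemperedDistribution.MemSobolev (s - (∑ i, β i : ℕ)) 2 (multiDeriv β T) := by
  have hit : ∀ (i : Fin n) (k : ℕ) (s : ℝ) (S : 𝓢'(Eu n, ℂ)),
      TemperedDistribution.MemSobolev s 2 S → TemperedDistribution.MemSobolev (s - k) 2
      ((fun U : 𝓢'(Eu n, ℂ) => ∂_{EuclideanSpace.single i (1 : ℝ)} U)^[k] S) := by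
    intro i k s S hS
    induction k with
    | zero => simpa using hS
    | succ k ih =>
      rw [Function.iterate_succ_apply']
      have := ih.lineDerivOp (m := EuclideanSpace.single i (1 : ℝ))
      have e : s - ((k + 1 : ℕ) : ℝ) = s - k - 1 := by
        push_cast
        ring
      rw [e]
      exact this
  have hl : ∀ l : List (Fin n), TemperedDistribution.MemSobolev (s - ((l.map β).sum : ℕ)) 2
      (l.foldr (fun i S =>
        (fun U : 𝓢'(Eu n, ℂ) => ∂_{EuclideanSpace.single i (1 : ℝ)} U)^[β i] S) T) := by
    intro l
    induction l with
    | nil => simpa using hT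
    | cons i l ih =>
      rw [List.foldr_cons]
      have := hit i (β i) _ _ ih
      have e : s - (((i :: l).map β).sum : ℕ) = s - ((l.map β).sum : ℕ) - (β i : ℝ) := by
        simp only [List.map_cons, List.sum_cons]
        push_cast
        ring
      rw [e]
      exact this
  have := hl (List.finRange n)
  rwa [← List.ofFn_eq_map, List.sum_ofFn] at this

lemma exists_memLp_multiDeriv {m : ℕ} {T : 𝓢'(Eu n, ℂ)}
    (hT : TemperedDistribution.MemSobolev (m : ℝ) 2 T) {β : Fin n → ℕ} (hβ : ∑ i, β i ≤ m) :
    ∃ v : Eu n → ℂ, MemLp v 2 volume ∧ IsFunction (multiDeriv β T) v := by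
  have h1 := (memSobolev_multiDeriv hT β).mono (s' := 0)
    (by rw [sub_nonneg]; exact_mod_cast hβ)
  rw [TemperedDistribution.memSobolev_zero_iff] at h1
  obtain ⟨f, hf⟩ := h1
  refine ⟨f, Lp.memLp f, ?_⟩
  rw [hf]
  have := isFunction_toLp (Lp.memLp f)
  rwa [Lp.toLp_coeFn] at this

lemma IsFunction.parts {T : 𝓢'(Eu n, ℂ)} {u v : Eu n → ℂ} {i : Fin n} (hu : IsFunction T u)
    (hv : IsFunction (∂_{EuclideanSpace.single i (1 : ℝ)} T) v) {g : Eu n → ℝ}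
    (hg : ContDiff ℝ ∞ g) (hc : HasCompactSupport g) :
    ∫ x, g x • v x = -∫ x, fderiv ℝ g x (EuclideanSpace.single i 1) • u x := by
  rw [hv.integral_smul hg hc, TemperedDistribution.lineDerivOp_apply_apply, map_neg, (hu _).2]
  congr 1
  refine integral_congr_ae (Eventually.of_forall fun x => ?_)
  simp only [SchwartzMap.lineDerivOp_apply_eq_fderiv]
  have h1 : HasFDerivAt (Complex.ofRealCLM ∘ g) (Complex.ofRealCLM.comp (fderiv ℝ g x)) x :=
    Complex.ofRealCLM.hasFDerivAt.comp x
      ((hg.differentiable (by simp)).differentiableAt.hasFDerivAt)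
  have h2 : fderiv ℝ ((hc.comp_left (g := Complex.ofRealCLM) rfl).toSchwartzMap
      (Complex.ofRealCLM.contDiff.comp hg) : Eu n → ℂ) x =
      Complex.ofRealCLM.comp (fderiv ℝ g x) := h1.fderiv
  rw [h2]
  simp

lemma SupportedIn.weakDeriv {T : 𝓢'(Eu n, ℂ)} {u v : Eu n → ℂ} {i : Fin n} {R : ℝ}
    (hu : IsFunction T u) (hs : SupportedIn R u)
    (hv : IsFunction (∂_{EuclideanSpace.single i (1 : ℝ)} T) v) : SupportedIn R v := by
  have hU : IsOpen {x : Eu n | R < ‖x‖} := isOpen_lt continuous_const continuous_norm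
  refine hU.ae_eq_zero_of_integral_contDiff_smul_eq_zero
    (hv.locallyIntegrable.locallyIntegrableOn _) ?_
  intro g hg hc hsub
  rw [hu.parts hv hg hc, neg_eq_zero]
  refine integral_eq_zero_of_ae ?_
  filter_upwards [hs] with x hx
  by_cases hxR : R < ‖x‖
  · simp [hx hxR]
  · have : x ∉ tsupport g := fun h => hxR (hsub h)
    have : fderiv ℝ g x = 0 := by
      by_contra h0
      exact this (support_fderiv_subset ℝ h0)
    simp [this]

/-- The derivatives up to order `m` of a compactly supported potential in `W^{m,2}` are square
integrable functions supported in a common ball. -/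
lemma exists_weakJet {m : ℕ} {q : Eu n → ℂ} (hq : MemLp q 2 volume) (hsupp : HasCompactSupport q)
    (hsob : TemperedDistribution.MemSobolev (m : ℝ) 2 (Lp.toTemperedDistribution (hq.toLp q))) :
    (∀ β, ∑ i, β i ≤ m → IsFunction (multiDeriv β (Lp.toTemperedDistribution (hq.toLp q)))
      (weakDeriv β q)) ∧ weakDeriv 0 q =ᵐ[volume] q ∧
    ∃ R : ℝ, 0 < R ∧ WeakJet m R (fun β => weakDeriv β q) := by
  set T := Lp.toTemperedDistribution (hq.toLp q) with hTdef
  have hT : IsFunction T q := isFunction_toLp hq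
  have hF : ∀ β, ∑ i, β i ≤ m → IsFunction (multiDeriv β T) (weakDeriv β q) := fun β hβ => by
    obtain ⟨v, -, hv⟩ := exists_memLp_multiDeriv hsob hβ
    exact isFunction_weakDeriv hT hv
  have h0 : weakDeriv 0 q =ᵐ[volume] q := by
    refine (hF 0 (by simp)).ae_unique ?_
    rwa [multiDeriv_zero]
  obtain ⟨R, hRpos, hR⟩ := hsupp.isCompact.isBounded.exists_pos_norm_le
  have hS0 : SupportedIn R q := Eventually.of_forall fun x hx => by
    by_contra h
    exact absurd (hR x (subset_tsupport q h)) (not_le.2 hx)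
  refine ⟨hF, h0, R, hRpos, ⟨?_, ?_, ?_⟩⟩
  · intro β hβ
    obtain ⟨v, hv2, hv⟩ := exists_memLp_multiDeriv hsob hβ
    exact hv2.ae_eq (hv.ae_unique (hF β hβ))
  -- the supports are controlled one derivative at a time
  · have : ∀ k, ∀ β : Fin n → ℕ, ∑ i, β i = k → k ≤ m → SupportedIn R (weakDeriv β q) := by
      intro k
      induction k with
      | zero =>
        intro β hβ _
        have : β = 0 := by
          ext i
          exact (Finset.sum_eq_zero_iff.1 hβ) i (Finset.mem_univ i)
        rw [this]
        filter_upwards [h0, hS0] with x h1 h2 h3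
        rw [h1, h2 h3]
      | succ k ih =>
        intro β hβ hk
        obtain ⟨i, hi⟩ : ∃ i, β i ≠ 0 := by
          by_contra! h
          simp [h] at hβ
        have hβ' : β = (β - Pi.single i 1) + Pi.single i 1 := by
          refine (tsub_add_cancel_of_le ?_).symm
          intro l
          by_cases hl : l = i
          · subst hl; simp; omega
          · simp [hl]
        have hsum : ∑ l, (β - Pi.single i 1 : Fin n → ℕ) l = k := by
          have h1 : ∑ l, β l = ∑ l, (β - Pi.single i 1 : Fin n → ℕ) l + 1 := by
            conv_lhs => rw [hβ']
            simp [Finset.sum_add_distrib]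
          omega
        have h2 := hF β (by omega)
        rw [hβ', multiDeriv_add_single, ← hβ'] at h2
        exact SupportedIn.weakDeriv (hF _ (by omega)) (ih _ hsum (by omega)) h2
    exact fun β hβ => this _ β rfl hβ
  · intro β i hβ g hg hc
    have h1 := hF (β + Pi.single i 1) (by simpa [Finset.sum_add_distrib] using hβ)
    rw [multiDeriv_add_single] at h1
    exact (hF β (by omega)).parts h1 hg hc

/-! ### Mollification -/

/-- Smooth bumps whose supports shrink to the origin. The ratio of the two radii is kept fixed, as
is needed for the almost everywhere convergence of the mollifications. -/
def shrinkingBump (n k : ℕ) : ContDiffBump (0 : Eu n) where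
  rIn := 1 / (2 * (k + 1))
  rOut := 1 / (k + 1)
  rIn_pos := by positivity
  rIn_lt_rOut := by
    apply one_div_lt_one_div_of_lt (by positivity)
    have : (0 : ℝ) < k + 1 := by positivity
    linarith

/-- The mollification of `f` at scale `1 / (k + 1)`. -/
def mollify (k : ℕ) (f : Eu n → ℂ) : Eu n → ℂ :=
  convolution ((shrinkingBump n k).normed volume) f (ContinuousLinearMap.lsmul ℝ ℝ) volume

lemma mollify_apply (k : ℕ) (f : Eu n → ℂ) (x : Eu n) :
    mollify k f x = ∫ t, (shrinkingBump n k).normed volume (x - t) • f t :=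
  convolution_lsmul_swap

lemma mollify_eq_convOp (k : ℕ) (f : Eu n → ℂ) :
    mollify k f = convOp (fun x => ((shrinkingBump n k).normed volume x : ℂ)) f := by
  ext x
  simp [mollify_apply, convOp]

lemma contDiff_mollify (k : ℕ) {f : Eu n → ℂ} (hf : LocallyIntegrable f) :
    ContDiff ℝ ∞ (mollify k f) :=
  (shrinkingBump n k).hasCompactSupport_normed.contDiff_convolution_left _
    (shrinkingBump n k).contDiff_normed hf

lemma mollify_eq_zero (k : ℕ) {f : Eu n → ℂ} {R : ℝ} (hf : SupportedIn R f) {x : Eu n}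
    (hx : R + 1 < ‖x‖) : mollify k f x = 0 := by
  rw [mollify_apply]
  refine integral_eq_zero_of_ae ?_
  filter_upwards [hf] with t ht
  by_cases htR : R < ‖t‖
  · simp [ht htR]
  · have h1 : x - t ∉ Function.support ((shrinkingBump n k).normed volume) := by
      rw [ContDiffBump.support_normed_eq, Metric.mem_ball, dist_zero_right, not_lt]
      have h2 : (shrinkingBump n k).rOut ≤ 1 := by
        show (1 : ℝ) / (k + 1) ≤ 1
        rw [div_le_one (by positivity)]
        have : (0 : ℝ) ≤ k := by positivity
        linarith
      have h3 := norm_sub_norm_le x t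
      linarith [not_lt.1 htR]
    simp [Function.notMem_support.1 h1]

lemma hasCompactSupport_mollify (k : ℕ) {f : Eu n → ℂ} {R : ℝ} (hf : SupportedIn R f) :
    HasCompactSupport (mollify k f) := by
  refine HasCompactSupport.intro (isCompact_closedBall (0 : Eu n) (R + 1)) fun x hx => ?_
  refine mollify_eq_zero k hf ?_
  simpa using hx

/-- Mollification commutes with weak differentiation, since the derivative of the mollifier can be
moved to the other factor. -/
lemma fderiv_mollify (k : ℕ) {m : ℕ} {R : ℝ} {v : (Fin n → ℕ) → Eu n → ℂ} (hv : WeakJet m R v)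
    {β : Fin n → ℕ} {i : Fin n} (hβ : ∑ i, β i + 1 ≤ m) (x : Eu n) :
    fderiv ℝ (mollify k (v β)) x (EuclideanSpace.single i 1) =
      mollify k (v (β + Pi.single i 1)) x := by
  set w := (shrinkingBump n k).normed (volume : Measure (Eu n)) with hw
  have hwc : ContDiff ℝ ∞ w := (shrinkingBump n k).contDiff_normed
  have hws : HasCompactSupport w := (shrinkingBump n k).hasCompactSupport_normed
  have hloc : LocallyIntegrable (v β) :=
    (hv.memLp β (by omega)).locallyIntegrable (by norm_num)
  have h1 := hws.hasFDerivAt_convolution_left (ContinuousLinearMap.lsmul ℝ ℝ)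
    (hwc.of_le (by simp)) hloc x
  have h2 : fderiv ℝ (mollify k (v β)) x = _ := h1.fderiv
  rw [h2, convolution_eq_swap]
  have hex : Integrable (fun t => ((ContinuousLinearMap.lsmul ℝ ℝ : ℝ →L[ℝ] ℂ →L[ℝ] ℂ).precompL
      (Eu n)) (fderiv ℝ w (x - t)) (v β t)) := by
    have h3 := (hws.fderiv (𝕜 := ℝ)).convolutionExists_left
      ((ContinuousLinearMap.lsmul ℝ ℝ : ℝ →L[ℝ] ℂ →L[ℝ] ℂ).precompL (Eu n))
      (hwc.continuous_fderiv (by simp)) hloc x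
    exact h3.integrable_swap
  rw [ContinuousLinearMap.integral_apply hex, mollify_apply]
  have hg : ContDiff ℝ ∞ (fun t => w (x - t)) := hwc.comp (contDiff_const.sub contDiff_id)
  have hc : HasCompactSupport (fun t => w (x - t)) :=
    hws.comp_homeomorph (Homeomorph.subLeft x)
  rw [hv.parts β i hβ _ hg hc, ← integral_neg]
  refine integral_congr_ae (Eventually.of_forall fun t => ?_)
  have h4 : HasFDerivAt (fun t => w (x - t)) ((fderiv ℝ w (x - t)).comp
      (-ContinuousLinearMap.id ℝ (Eu n))) t := by
    have h5 : HasFDerivAt (fun t : Eu n => x - t) (-ContinuousLinearMap.id ℝ (Eu n)) t := by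
      simpa using (hasFDerivAt_id t).const_sub x
    exact ((hwc.differentiable (by simp)).differentiableAt.hasFDerivAt).comp t h5
  simp only [h4.fderiv]
  simp [ContinuousLinearMap.precompL_apply]

lemma ae_tendsto_mollify {f : Eu n → ℂ} (hf : LocallyIntegrable f) :
    ∀ᵐ x, Tendsto (fun k => mollify k f x) atTop (𝓝 (f x)) := by
  refine ContDiffBump.ae_convolution_tendsto_right_of_locallyIntegrable (K := 2) ?_ ?_ hf
  · exact tendsto_one_div_add_atTop_nhds_zero_nat
  · refine Eventually.of_forall fun k => ?_
    show (1 : ℝ) / (k + 1) ≤ 2 * (1 / (2 * (k + 1)))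
    apply le_of_eq
    field_simp

lemma eLpNorm_mollify_le (k : ℕ) {c : ℝ} (hc : 0 < c) (hc1 : c ≤ 1) {f : Eu n → ℂ}
    (hf : AEStronglyMeasurable f volume) :
    eLpNorm (mollify k f) (recipExp c) volume ≤ eLpNorm f (recipExp c) volume := by
  set w := (shrinkingBump n k).normed (volume : Measure (Eu n)) with hw
  have hwi : Integrable w := (shrinkingBump n k).integrable_normed
  have h1 := eLpNorm_convOp_le (ρ := 0) (C := c) le_rfl hc (by simpa using hc1)
    (K := fun x => (w x : ℂ)) (g := f) hwi.ofReal.aestronglyMeasurable hf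
  rw [mollify_eq_convOp]
  refine h1.trans (le_of_eq ?_)
  have h2 : eLpNorm (fun x => (w x : ℂ)) (recipExp (1 - 0)) volume = 1 := by
    rw [sub_zero, recipExp_one, eLpNorm_one_eq_lintegral_enorm]
    have : ∀ x, ‖(w x : ℂ)‖ₑ = ENNReal.ofReal (w x) := fun x => by
      rw [← ofReal_norm, Complex.norm_real, Real.norm_of_nonneg]
      exact (shrinkingBump n k).nonneg_normed x
    simp_rw [this]
    rw [← ofReal_integral_eq_lintegral_ofReal hwi
      (Eventually.of_forall (shrinkingBump n k).nonneg_normed), hw,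
      ContDiffBump.integral_normed, ENNReal.ofReal_one]
  rw [h2, one_mul, zero_add]

lemma aestronglyMeasurable_mollify (k : ℕ) {f : Eu n → ℂ} (hf : AEStronglyMeasurable f volume) :
    AEStronglyMeasurable (mollify k f) volume := by
  rw [mollify_eq_convOp]
  exact aestronglyMeasurable_convOp
    ((shrinkingBump n k).integrable_normed).ofReal.aestronglyMeasurable hf

lemma mollify_sub (k : ℕ) {f g : Eu n → ℂ} (hf : LocallyIntegrable f)
    (hg : LocallyIntegrable g) : mollify k (f - g) = mollify k f - mollify k g := by
  have hE : ∀ {f : Eu n → ℂ}, LocallyIntegrable f → ConvolutionExists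
      ((shrinkingBump n k).normed volume) f (ContinuousLinearMap.lsmul ℝ ℝ) volume := fun hf =>
    (shrinkingBump n k).hasCompactSupport_normed.convolutionExists_left _
      (shrinkingBump n k).continuous_normed hf
  ext x
  have h1 := (hE hf x)
  have h2 := (hE hg x)
  simp only [mollify, Pi.sub_apply]
  rw [convolution_def, convolution_def, convolution_def, ← integral_sub h1 h2]
  simp [smul_sub]

/-- Mollifications converge in `Lᵖ` for finite `p`: this is clear for continuous functions of compact
support, for which the convergence is uniform, and they are dense. -/
lemma tendsto_eLpNorm_mollify_sub {c : ℝ} (hc : 0 < c) (hc1 : c ≤ 1) {f : Eu n → ℂ}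
    (hf : MemLp f (recipExp c) volume) :
    Tendsto (fun k => eLpNorm (mollify k f - f) (recipExp c) volume) atTop (𝓝 0) := by
  have hp1 : 1 ≤ recipExp c := one_le_recipExp hc hc1
  have hloc := hf.locallyIntegrable hp1
  rw [ENNReal.tendsto_atTop_zero]
  intro ε hε
  wlog hεtop : ε ≠ ⊤ generalizing ε
  · exact ⟨0, fun k _ => by simp [not_not.1 hεtop]⟩
  set δ := ε.toReal / 3 with hδ
  have hδpos : 0 < δ := by
    have := ENNReal.toReal_pos hε.ne' hεtop
    positivity
  obtain ⟨h, hhc, hhs, hfh⟩ := hf.exist_eLpNorm_sub_le (recipExp_ne_top c) hp1 hδpos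
  have hhloc : LocallyIntegrable h := hhs.continuous.locallyIntegrable
  obtain ⟨R, hRpos, hR⟩ := hhc.isCompact.isBounded.exists_pos_norm_le
  have hS : ∀ x, R < ‖x‖ → h x = 0 := fun x hx => by
    by_contra h0
    exact absurd (hR x (subset_tsupport h h0)) (not_le.2 hx)
  set V := volume (Metric.closedBall (0 : Eu n) (R + 1)) with hV
  have hVtop : V ≠ ⊤ := measure_closedBall_lt_top.ne
  set W := (V ^ (1 / (recipExp c).toReal)).toReal with hW
  have hWtop : V ^ (1 / (recipExp c).toReal) ≠ ⊤ := ENNReal.rpow_ne_top_of_nonneg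
    (by positivity) hVtop
  set η := δ / (W + 1) with hη
  have hW0 : 0 ≤ W := ENNReal.toReal_nonneg
  have hηpos : 0 < η := by positivity
  have huc : UniformContinuous h := hhc.uniformContinuous_of_continuous hhs.continuous
  obtain ⟨r, hrpos, hr⟩ := Metric.uniformContinuous_iff.1 huc η hηpos
  obtain ⟨N, hN⟩ := exists_nat_one_div_lt hrpos
  refine ⟨N, fun k hk => ?_⟩
  have hdist : ∀ x, dist (mollify k h x) (h x) ≤ η := by
    intro x
    refine ContDiffBump.dist_normed_convolution_le hhs.continuous.aestronglyMeasurable ?_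
    intro y hy
    refine (hr ?_).le
    refine (Metric.mem_ball.1 hy).trans (lt_of_le_of_lt ?_ hN)
    show (1 : ℝ) / (k + 1) ≤ 1 / (N + 1)
    apply one_div_le_one_div_of_le (by positivity)
    have : (N : ℝ) ≤ k := by exact_mod_cast hk
    linarith
  have h2 : eLpNorm (mollify k h - h) (recipExp c) volume ≤ ENNReal.ofReal δ := by
    refine (eLpNorm_sub_le_of_dist_bdd volume (recipExp_ne_top c)
      (measurableSet_closedBall (x := (0 : Eu n)) (ε := R + 1)) hηpos.le hdist ?_ ?_).trans ?_
    · intro x hx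
      by_contra hx'
      exact hx (mollify_eq_zero k (Eventually.of_forall hS) (by simpa using hx'))
    · intro x hx
      by_contra hx'
      exact hx (hS x (by
        have : R + 1 < ‖x‖ := by simpa using hx'
        linarith))
    · rw [← hV, ← ENNReal.ofReal_toReal hWtop, ← ENNReal.ofReal_mul hηpos.le]
      apply ENNReal.ofReal_le_ofReal
      rw [← hW, hη, div_mul_eq_mul_div, div_le_iff₀ (by positivity)]
      nlinarith
  have h1 : eLpNorm (mollify k f - mollify k h) (recipExp c) volume ≤ ENNReal.ofReal δ := by
    rw [← mollify_sub k hloc hhloc]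
    exact (eLpNorm_mollify_le k hc hc1
      (hf.aestronglyMeasurable.sub hhs.continuous.aestronglyMeasurable)).trans hfh
  have h3 : eLpNorm (h - f) (recipExp c) volume ≤ ENNReal.ofReal δ := by
    rw [eLpNorm_sub_comm]
    exact hfh
  have hmf := aestronglyMeasurable_mollify k hf.aestronglyMeasurable
  have hmh := aestronglyMeasurable_mollify k (f := h) hhs.continuous.aestronglyMeasurable
  have hhm : AEStronglyMeasurable h volume := hhs.continuous.aestronglyMeasurable
  have e : mollify k f - f = (mollify k f - mollify k h) + ((mollify k h - h) + (h - f)) := by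
    abel
  rw [e]
  refine (eLpNorm_add_le (hmf.sub hmh) ((hmh.sub hhm).add (hhm.sub hf.aestronglyMeasurable))
    hp1).trans ?_
  refine (add_le_add h1 ((eLpNorm_add_le (hmh.sub hhm) (hhm.sub hf.aestronglyMeasurable)
    hp1).trans (add_le_add h2 h3))).trans ?_
  rw [← ENNReal.ofReal_add hδpos.le hδpos.le, ← ENNReal.ofReal_add hδpos.le (by positivity)]
  refine (ENNReal.ofReal_le_iff_le_toReal hεtop).2 ?_
  rw [hδ]
  linarith

/-! ### Gagliardo–Nirenberg and Sobolev inequalities -/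

/-- The integration by parts behind the Gagliardo–Nirenberg inequality, with the singular power
`|∂w|^{2s}` regularized by `δ`. -/
lemma integral_regularized_le {w u u' : Eu n → ℂ} {e : Eu n} {s δ : ℝ} (hs : 0 ≤ s) (hδ : 0 < δ)
    (hw : ContDiff ℝ 1 w) (hu : ContDiff ℝ 1 u) (hwc : HasCompactSupport w)
    (huc : HasCompactSupport u) (h1 : ∀ x, fderiv ℝ w x e = u x)
    (h2 : ∀ x, fderiv ℝ u x e = u' x) (hu' : Continuous u') :
    ∫ x, ‖u x‖ ^ 2 * (‖u x‖ ^ 2 + δ) ^ s ≤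
      (1 + 2 * s) * ∫ x, ‖w x‖ * ‖u' x‖ * (‖u x‖ ^ 2 + δ) ^ s := by
  set N : Eu n → ℝ := fun x => ‖u x‖ ^ 2 + δ with hN
  have hNpos : ∀ x, 0 < N x := fun x => by positivity
  have hNc : Continuous N := (hu.continuous.norm.pow 2).add continuous_const
  have hpow : ∀ t : ℝ, Continuous fun x => N x ^ t := fun t =>
    hNc.rpow_const fun x => Or.inl (hNpos x).ne'
  have hdu : ∀ x, HasFDerivAt u (fderiv ℝ u x) x := fun x =>
    (hu.differentiable (by simp)).differentiableAt.hasFDerivAt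
  -- the derivative of the regularized power of `u`
  set P : Eu n → ℂ := fun x => (starRingEnd ℂ) (u x) * ((N x ^ s : ℝ) : ℂ) with hP
  set P' : Eu n → ℂ := fun x => (starRingEnd ℂ) (u x) *
      ((s * N x ^ (s - 1) * (2 * inner ℝ (u x) (u' x)) : ℝ) : ℂ) +
      ((N x ^ s : ℝ) : ℂ) * (starRingEnd ℂ) (u' x) with hP'
  have hPd : ∀ x, ∃ L : Eu n →L[ℝ] ℂ, HasFDerivAt P L x ∧ L e = P' x := by
    intro x
    have d1 : HasFDerivAt (fun x => (starRingEnd ℂ) (u x))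
        ((Complex.conjCLE : ℂ →L[ℝ] ℂ).comp (fderiv ℝ u x)) x :=
      (Complex.conjCLE : ℂ →L[ℝ] ℂ).hasFDerivAt.comp x (hdu x)
    have d2 : HasFDerivAt N (2 • (innerSL ℝ (u x)).comp (fderiv ℝ u x)) x := by
      exact ((hdu x).norm_sq).add_const δ
    have d3 : HasFDerivAt (fun x => N x ^ s)
        ((s * N x ^ (s - 1)) • (2 • (innerSL ℝ (u x)).comp (fderiv ℝ u x))) x :=
      d2.rpow_const (Or.inl (hNpos x).ne')
    have d4 := Complex.ofRealCLM.hasFDerivAt.comp x d3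
    refine ⟨_, d1.mul d4, ?_⟩
    simp only [hP', add_apply, smul_apply, smul_eq_mul,
      ContinuousLinearMap.comp_apply, Complex.ofRealCLM_apply, innerSL_apply_apply, h2,
      nsmul_eq_mul, ContinuousLinearEquiv.coe_coe, Complex.conjCLE_apply, Nat.cast_ofNat]
  have hPdiff : Differentiable ℝ P := fun x => (hPd x).choose_spec.1.differentiableAt
  have hPfd : ∀ x, fderiv ℝ P x e = P' x := fun x => by
    rw [(hPd x).choose_spec.1.fderiv]
    exact (hPd x).choose_spec.2
  have hPc : Continuous P := hPdiff.continuous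
  have hP'c : Continuous P' := by
    refine ((Complex.continuous_conj.comp hu.continuous).mul (Complex.continuous_ofReal.comp
      ((continuous_const.mul (hpow _)).mul (continuous_const.mul
        (hu.continuous.inner hu'))))).add ((Complex.continuous_ofReal.comp (hpow s)).mul
      (Complex.continuous_conj.comp hu'))
  have hPs : HasCompactSupport P := by
    refine huc.mono fun x hx hux => hx ?_
    simp [hP, show u x = 0 from hux]
  have hP's : ∀ x, ‖P' x‖ ≤ (1 + 2 * s) * (‖u' x‖ * N x ^ s) := by
    intro x
    have i1 : |inner ℝ (u x) (u' x)| ≤ ‖u x‖ * ‖u' x‖ := abs_real_inner_le_norm _ _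
    have i2 : ‖u x‖ ^ 2 * N x ^ (s - 1) ≤ N x ^ s := by
      have : N x ^ s = N x * N x ^ (s - 1) := by
        rw [mul_comm, ← Real.rpow_add_one (hNpos x).ne', sub_add_cancel]
      rw [this]
      have h0 : 0 ≤ N x ^ (s - 1) := Real.rpow_nonneg (hNpos x).le _
      exact mul_le_mul_of_nonneg_right (by simp [hN, hδ.le]) h0
    have h0 : 0 ≤ N x ^ (s - 1) := Real.rpow_nonneg (hNpos x).le _
    have h0' : 0 ≤ N x ^ s := Real.rpow_nonneg (hNpos x).le _
    calc ‖P' x‖ ≤ ‖u x‖ * (s * N x ^ (s - 1) * (2 * |inner ℝ (u x) (u' x)|)) +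
          N x ^ s * ‖u' x‖ := by
          refine (norm_add_le _ _).trans (le_of_eq ?_)
          rw [norm_mul, norm_mul, Complex.norm_real, Complex.norm_real, RCLike.norm_conj,
            RCLike.norm_conj, Real.norm_of_nonneg h0', Real.norm_eq_abs, abs_mul, abs_mul,
            abs_of_nonneg hs, abs_of_nonneg h0, abs_mul, abs_two]
      _ ≤ ‖u x‖ * (s * N x ^ (s - 1) * (2 * (‖u x‖ * ‖u' x‖))) + N x ^ s * ‖u' x‖ := by
          gcongr
      _ = 2 * s * ‖u' x‖ * (‖u x‖ ^ 2 * N x ^ (s - 1)) + N x ^ s * ‖u' x‖ := by ring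
      _ ≤ 2 * s * ‖u' x‖ * N x ^ s + N x ^ s * ‖u' x‖ := by gcongr
      _ = _ := by ring
  have hi1 : Integrable (fun x => fderiv ℝ P x e * w x) := by
    simp_rw [hPfd]
    exact (hP'c.mul hw.continuous).integrable_of_hasCompactSupport hwc.mul_left
  have hi2 : Integrable (fun x => P x * fderiv ℝ w x e) := by
    simp_rw [h1]
    exact (hPc.mul hu.continuous).integrable_of_hasCompactSupport huc.mul_left
  have hi3 : Integrable (fun x => P x * w x) :=
    (hPc.mul hw.continuous).integrable_of_hasCompactSupport hwc.mul_left
  have hparts := integral_mul_fderiv_eq_neg_fderiv_mul_of_integrable hi1 hi2 hi3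
    (fun x _ => hPdiff x) (fun x _ => (hw.differentiable (by simp)) x)
  simp_rw [hPfd, h1] at hparts
  have hlhs : ∫ x, P x * u x = ((∫ x, ‖u x‖ ^ 2 * N x ^ s : ℝ) : ℂ) := by
    rw [← integral_complex_ofReal]
    refine integral_congr_ae (Eventually.of_forall fun x => ?_)
    simp only [hP]
    rw [mul_right_comm, ← Complex.normSq_eq_conj_mul_self, Complex.normSq_eq_norm_sq]
    push_cast
    ring
  have hnn : 0 ≤ ∫ x, ‖u x‖ ^ 2 * N x ^ s := integral_nonneg fun x => by
    have : 0 ≤ N x ^ s := Real.rpow_nonneg (hNpos x).le _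
    positivity
  calc ∫ x, ‖u x‖ ^ 2 * N x ^ s = ‖∫ x, P x * u x‖ := by
        rw [hlhs, Complex.norm_real, Real.norm_of_nonneg hnn]
    _ = ‖∫ x, P' x * w x‖ := by rw [hparts, norm_neg]
    _ ≤ ∫ x, (1 + 2 * s) * (‖w x‖ * ‖u' x‖ * N x ^ s) := by
        refine norm_integral_le_of_norm_le ?_ (Eventually.of_forall fun x => ?_)
        · refine Integrable.const_mul ?_ _
          refine ((hw.continuous.norm.mul hu'.norm).mul (hpow s)).integrable_of_hasCompactSupport ?_
          exact (hwc.norm.mul_right).mul_right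
        · rw [norm_mul]
          calc ‖P' x‖ * ‖w x‖ ≤ (1 + 2 * s) * (‖u' x‖ * N x ^ s) * ‖w x‖ := by
                gcongr
                exact hP's x
            _ = _ := by ring
    _ = _ := by rw [integral_const_mul]

/-- The limit `δ → 0` of `integral_regularized_le`. -/
lemma integral_norm_rpow_le {w u u' : Eu n → ℂ} {e : Eu n} {s : ℝ} (hs : 0 ≤ s)
    (hw : ContDiff ℝ 1 w) (hu : ContDiff ℝ 1 u) (hwc : HasCompactSupport w)
    (huc : HasCompactSupport u) (h1 : ∀ x, fderiv ℝ w x e = u x)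
    (h2 : ∀ x, fderiv ℝ u x e = u' x) (hu' : Continuous u') :
    ∫ x, ‖u x‖ ^ 2 * (‖u x‖ ^ 2) ^ s ≤
      (1 + 2 * s) * ∫ x, ‖w x‖ * ‖u' x‖ * (‖u x‖ ^ 2) ^ s := by
  have hlim : ∀ (g : Eu n → ℝ), Continuous g → HasCompactSupport g →
      Tendsto (fun δ : ℝ => ∫ x, g x * (‖u x‖ ^ 2 + δ) ^ s) (𝓝[>] 0)
        (𝓝 (∫ x, g x * (‖u x‖ ^ 2) ^ s)) := by
    intro g hg hgc
    have hc : ∀ δ : ℝ, Continuous fun x => (‖u x‖ ^ 2 + δ) ^ s := fun δ =>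
      ((hu.continuous.norm.pow 2).add continuous_const).rpow_const fun x => Or.inr hs
    refine tendsto_integral_filter_of_dominated_convergence
      (fun x => |g x| * (‖u x‖ ^ 2 + 1) ^ s) ?_ ?_ ?_ ?_
    · exact Eventually.of_forall fun δ => (hg.mul (hc δ)).aestronglyMeasurable
    · filter_upwards [Ioc_mem_nhdsGT (zero_lt_one' ℝ)] with δ hδ
      refine Eventually.of_forall fun x => ?_
      have : 0 ≤ ‖u x‖ ^ 2 + δ := by have := hδ.1; positivity
      rw [norm_mul, Real.norm_eq_abs, Real.norm_of_nonneg (Real.rpow_nonneg this _)]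
      gcongr
      exact hδ.2
    · exact (hg.abs.mul (hc 1)).integrable_of_hasCompactSupport (hgc.norm.mul_right)
    · refine Eventually.of_forall fun x => ?_
      refine Tendsto.const_mul _ ?_
      have h3 : ContinuousAt (fun δ : ℝ => (‖u x‖ ^ 2 + δ) ^ s) 0 :=
        (continuousAt_const.add continuousAt_id).rpow_const (Or.inr hs)
      have h4 := h3.tendsto
      simp only [add_zero] at h4
      exact h4.mono_left nhdsWithin_le_nhds
  refine le_of_tendsto_of_tendsto
    (hlim (fun x => ‖u x‖ ^ 2) (hu.continuous.norm.pow 2) ?_)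
    ((hlim (fun x => ‖w x‖ * ‖u' x‖) (hw.continuous.norm.mul hu'.norm) hwc.norm.mul_right).const_mul
      (1 + 2 * s)) ?_
  · exact huc.norm.comp_left (g := fun t : ℝ => t ^ 2) (by simp)
  · filter_upwards [self_mem_nhdsWithin] with δ hδ
    exact integral_regularized_le hs hδ hw hu hwc huc h1 h2 hu'

lemma ENNReal_rpow_le_of_le_mul {X D : ℝ≥0∞} {c : ℝ} (hc : 0 < c) (hc2 : 0 ≤ 1 - 2 * c)
    (hX : X ≠ ⊤) (h : X ≤ D * X ^ (1 - 2 * c)) : X ^ (c * 2) ≤ D := by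
  by_cases hX0 : X = 0
  · rw [hX0, ENNReal.zero_rpow_of_pos (by positivity)]
    exact zero_le
  · have hsplit : X ^ (c * 2) * X ^ (1 - 2 * c) = X := by
      rw [← ENNReal.rpow_add _ _ hX0 hX, show c * 2 + (1 - 2 * c) = 1 by ring, ENNReal.rpow_one]
    have hne0 : X ^ (1 - 2 * c) ≠ 0 := by
      rw [Ne, ENNReal.rpow_eq_zero_iff]
      tauto
    have hnet : X ^ (1 - 2 * c) ≠ ⊤ := ENNReal.rpow_ne_top_of_nonneg hc2 hX
    refine (ENNReal.mul_le_mul_iff_left hne0 hnet).1 ?_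
    rw [hsplit]
    exact h

/-- Hölder's inequality for three functions. -/
lemma lintegral_mul_mul_rpow_le {f g h : Eu n → ℝ≥0∞} (hf : AEMeasurable f volume)
    (hg : AEMeasurable g volume) (hh : AEMeasurable h volume) {a b c : ℝ} (ha : 0 ≤ a)
    (hb : 0 ≤ b) (hc : 0 ≤ c) (habc : a + b + c = 1) :
    ∫⁻ x, f x ^ a * g x ^ b * h x ^ c ≤
      (∫⁻ x, f x) ^ a * (∫⁻ x, g x) ^ b * (∫⁻ x, h x) ^ c := by
  have h3 := ENNReal.lintegral_prod_norm_pow_le (μ := (volume : Measure (Eu n)))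
    (Finset.univ : Finset (Fin 3)) (f := ![f, g, h]) (p := ![a, b, c])
    (by
      intro i _
      fin_cases i
      · exact hf
      · exact hg
      · exact hh)
    (by
      simp only [Fin.sum_univ_three, Matrix.cons_val_zero, Matrix.cons_val_one, Matrix.cons_val]
      linarith)
    (by
      intro i _
      fin_cases i
      · exact ha
      · exact hb
      · exact hc)
  simpa only [Fin.prod_univ_three, Matrix.cons_val_zero, Matrix.cons_val_one,
    Matrix.cons_val_two, Matrix.tail_cons, Matrix.head_cons] using h3

/-- The **Gagliardo–Nirenberg inequality** for one pure second derivative: the exponent of the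
first derivative `u = ∂w` is the harmonic mean of those of `w` and `u' = ∂²w`. -/
lemma eLpNorm_sq_le {w u u' : Eu n → ℂ} {e : Eu n} {a b c : ℝ} (ha : 0 < a) (hb : 0 < b)
    (hc : 0 < c) (habc : a + b = 2 * c) (hc2 : c ≤ 1 / 2)
    (hw : ContDiff ℝ 1 w) (hu : ContDiff ℝ 1 u) (hwc : HasCompactSupport w)
    (huc : HasCompactSupport u) (h1 : ∀ x, fderiv ℝ w x e = u x)
    (h2 : ∀ x, fderiv ℝ u x e = u' x) (hu' : Continuous u') :
    eLpNorm u (recipExp c) volume ^ 2 ≤ ENNReal.ofReal c⁻¹ *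
      (eLpNorm w (recipExp a) volume * eLpNorm u' (recipExp b) volume) := by
  -- the exponent for which the left side of `integral_norm_rpow_le` is the power `1/c` of `u`
  set s := (c⁻¹ - 2) / 2 with hsdef
  have hcinv : 2 ≤ c⁻¹ := by
    rw [le_inv_comm₀ (by norm_num) hc]; linarith
  have hs : 0 ≤ s := by rw [hsdef]; linarith
  have hp : c⁻¹ = 2 + 2 * s := by rw [hsdef]; ring
  have hpow : ∀ x, (‖u x‖ ^ 2) ^ s = ‖u x‖ ^ (2 * s) := fun x => by
    rw [← Real.rpow_natCast, ← Real.rpow_mul (norm_nonneg _)]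
    norm_num
  have hmain := integral_norm_rpow_le hs hw hu hwc huc h1 h2 hu'
  have hucts := hu.continuous
  have hcont2 : Continuous fun x => (‖u x‖ ^ 2) ^ s :=
    (hucts.norm.pow 2).rpow_const fun x => Or.inr hs
  have hc1 : HasCompactSupport fun x => ‖u x‖ ^ 2 :=
    huc.norm.comp_left (g := fun t : ℝ => t ^ 2) (by simp)
  have hc2' : HasCompactSupport fun x => ‖w x‖ * ‖u' x‖ := hwc.norm.mul_right
  have hI1 : Integrable fun x => ‖u x‖ ^ 2 * (‖u x‖ ^ 2) ^ s := by
    refine ((hucts.norm.pow 2).mul hcont2).integrable_of_hasCompactSupport ?_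
    exact hc1.mul_right
  have hI2 : Integrable fun x => ‖w x‖ * ‖u' x‖ * (‖u x‖ ^ 2) ^ s := by
    refine ((hw.continuous.norm.mul hu'.norm).mul hcont2).integrable_of_hasCompactSupport ?_
    exact hc2'.mul_right
  set X := ∫⁻ x, ‖u x‖ₑ ^ c⁻¹ with hX
  have hXeq : X = ENNReal.ofReal (∫ x, ‖u x‖ ^ 2 * (‖u x‖ ^ 2) ^ s) := by
    rw [ofReal_integral_eq_lintegral_ofReal hI1 (Eventually.of_forall fun x => by positivity)]
    refine lintegral_congr fun x => ?_
    rw [hpow, ← Real.rpow_natCast, ← Real.rpow_add_of_nonneg (norm_nonneg _) (by norm_num)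
      (by positivity), ← ofReal_norm, ENNReal.ofReal_rpow_of_nonneg (norm_nonneg _) (by positivity)]
    congr 2
  have hXtop : X ≠ ⊤ := by rw [hXeq]; exact ENNReal.ofReal_ne_top
  set A := ∫⁻ x, ‖w x‖ₑ ^ a⁻¹ with hA
  set B := ∫⁻ x, ‖u' x‖ₑ ^ b⁻¹ with hB
  have hYeq : ENNReal.ofReal (∫ x, ‖w x‖ * ‖u' x‖ * (‖u x‖ ^ 2) ^ s) =
      ∫⁻ x, ‖w x‖ₑ * ‖u' x‖ₑ * ‖u x‖ₑ ^ (2 * s) := by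
    rw [ofReal_integral_eq_lintegral_ofReal hI2 (Eventually.of_forall fun x => by positivity)]
    refine lintegral_congr fun x => ?_
    rw [hpow, ENNReal.ofReal_mul (by positivity), ENNReal.ofReal_mul (by positivity), ofReal_norm,
      ofReal_norm, ← ENNReal.ofReal_rpow_of_nonneg (norm_nonneg _) (by positivity), ofReal_norm]
  have h12 : 0 ≤ 1 - 2 * c := by linarith
  have hhol : ∫⁻ x, ‖w x‖ₑ * ‖u' x‖ₑ * ‖u x‖ₑ ^ (2 * s) ≤ A ^ a * B ^ b * X ^ (1 - 2 * c) := by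
    have h3 := lintegral_mul_mul_rpow_le (hw.continuous.aestronglyMeasurable.enorm.pow_const a⁻¹)
      (hu'.aestronglyMeasurable.enorm.pow_const b⁻¹)
      (hucts.aestronglyMeasurable.enorm.pow_const c⁻¹) ha.le hb.le h12 (by linarith)
    rw [← hA, ← hB, ← hX] at h3
    refine le_trans (le_of_eq ?_) h3
    refine lintegral_congr fun x => ?_
    rw [← ENNReal.rpow_mul, ← ENNReal.rpow_mul, ← ENNReal.rpow_mul, inv_mul_cancel₀ ha.ne',
      inv_mul_cancel₀ hb.ne', ENNReal.rpow_one, ENNReal.rpow_one]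
    congr 2
    rw [mul_sub, mul_one, hp, mul_left_comm, ← hp, inv_mul_cancel₀ hc.ne', hp]
    ring
  -- the factor `X ^ (1 - 2c)` is absorbed, as `X` is finite
  have hXle : X ≤ ENNReal.ofReal c⁻¹ * (A ^ a * B ^ b) * X ^ (1 - 2 * c) := by
    have h4 := ENNReal.ofReal_le_ofReal hmain
    rw [ENNReal.ofReal_mul (by positivity), hYeq, ← hXeq] at h4
    have h5 : ENNReal.ofReal (1 + 2 * s) ≤ ENNReal.ofReal c⁻¹ :=
      ENNReal.ofReal_le_ofReal (by rw [hp]; linarith)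
    rw [mul_assoc]
    exact h4.trans (mul_le_mul' h5 hhol)
  rw [eLpNorm_recipExp hc, eLpNorm_recipExp ha, eLpNorm_recipExp hb, ← ENNReal.rpow_natCast,
    ← ENNReal.rpow_mul]
  have h6 := ENNReal_rpow_le_of_le_mul hc h12 hXtop hXle
  exact_mod_cast h6

/-! ### Integrability of the weak derivatives -/

lemma SupportedIn.memLp_mono {R : ℝ} {f : Eu n → ℂ} (hs : SupportedIn R f) {p q : ℝ≥0∞}
    (hqp : q ≤ p) (hf : MemLp f p volume) : MemLp f q volume := by
  have h1 : f =ᵐ[volume] (Metric.closedBall (0 : Eu n) R).indicator f := by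
    filter_upwards [hs] with x hx
    by_cases h : x ∈ Metric.closedBall (0 : Eu n) R
    · rw [Set.indicator_of_mem h]
    · rw [Set.indicator_of_notMem h]
      exact hx (by simpa using h)
  have h2 := (hf.ae_eq h1).mono_exponent_of_measure_support_ne_top
    (s := Metric.closedBall (0 : Eu n) R) (fun x hx => Set.indicator_of_notMem hx f)
    measure_closedBall_lt_top.ne hqp
  exact h2.ae_eq h1.symm

/-- Fatou's lemma for mollifications. -/
lemma memLp_of_eLpNorm_mollify_le {f : Eu n → ℂ} (hf : LocallyIntegrable f) {p M : ℝ≥0∞}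
    (hM : M ≠ ⊤) (h : ∀ k, eLpNorm (mollify k f) p volume ≤ M) : MemLp f p volume := by
  refine ⟨hf.aestronglyMeasurable, ?_⟩
  have h1 := Lp.eLpNorm_lim_le_liminf_eLpNorm (p := p)
    (fun k => aestronglyMeasurable_mollify k hf.aestronglyMeasurable) f (ae_tendsto_mollify hf)
  refine h1.trans_lt (lt_of_le_of_lt ?_ hM.lt_top)
  exact liminf_le_of_le (by isBoundedDefault) fun b hb => by
    obtain ⟨k, hk⟩ := hb.exists
    exact hk.trans (h k)

lemma norm_le_sum_norm_single (L : Eu n →L[ℝ] ℂ) :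
    ‖L‖ ≤ ∑ i, ‖L (EuclideanSpace.single i 1)‖ := by
  refine ContinuousLinearMap.opNorm_le_bound _ (Finset.sum_nonneg fun _ _ => norm_nonneg _) ?_
  intro x
  have hx : x = ∑ i, x i • EuclideanSpace.single i (1 : ℝ) := by
    have := (EuclideanSpace.basisFun (Fin n) ℝ).sum_repr x
    simpa using this.symm
  conv_lhs => rw [hx]
  rw [map_sum, Finset.sum_mul]
  refine (norm_sum_le _ _).trans (Finset.sum_le_sum fun i _ => ?_)
  rw [map_smul, norm_smul, mul_comm]
  gcongr
  exact PiLp.norm_apply_le x i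

lemma eLpNorm_fderiv_le_sum {u : Eu n → ℂ} (hu : ContDiff ℝ 1 u) {p : ℝ≥0∞} (hp : 1 ≤ p) :
    eLpNorm (fderiv ℝ u) p volume ≤
      ∑ i, eLpNorm (fun x => fderiv ℝ u x (EuclideanSpace.single i 1)) p volume := by
  have hc : ∀ i : Fin n, Continuous fun x => fderiv ℝ u x (EuclideanSpace.single i 1) := fun i =>
    (hu.continuous_fderiv (by simp)).clm_apply continuous_const
  have h1 : eLpNorm (fderiv ℝ u) p volume ≤
      eLpNorm (∑ i, fun x => ‖fderiv ℝ u x (EuclideanSpace.single i 1)‖) p volume := by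
    refine eLpNorm_mono_real fun x => ?_
    rw [Finset.sum_apply]
    exact norm_le_sum_norm_single _
  refine h1.trans ((eLpNorm_sum_le (fun i _ => (hc i).norm.aestronglyMeasurable) hp).trans ?_)
  simp only [eLpNorm_norm, le_refl]

/-- The Sobolev inequality on functions with a fixed bounded support, in terms of the partial
derivatives. -/
lemma exists_eLpNorm_le_sum_partial {R : ℝ} {a b : ℝ} (ha : 0 < a) (hb : 1 / n < b) (hb1 : b ≤ 1)
    (hn : 1 ≤ n) (hab : b - 1 / n ≤ a) :
    ∃ C : ℝ≥0∞, C ≠ ⊤ ∧ ∀ u : Eu n → ℂ, ContDiff ℝ 1 u → (∀ x, R < ‖x‖ → u x = 0) →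
      eLpNorm u (recipExp a) volume ≤ C *
        ∑ i, eLpNorm (fun x => fderiv ℝ u x (EuclideanSpace.single i 1)) (recipExp b) volume := by
  have hn0 : (0 : ℝ) < n := by exact_mod_cast hn
  have hb0 : 0 < b := lt_trans (by positivity) hb
  refine ⟨(eLpNormLESNormFDerivOfLeConst ℂ (volume : Measure (Eu n))
    (Metric.closedBall (0 : Eu n) R) (Real.toNNReal b⁻¹) (Real.toNNReal a⁻¹) : ℝ≥0∞),
    ENNReal.coe_ne_top, fun u hu hsupp => ?_⟩
  have h1 := eLpNorm_le_eLpNorm_fderiv_of_le (volume : Measure (Eu n)) (u := u)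
    (s := Metric.closedBall (0 : Eu n) R) (p := Real.toNNReal b⁻¹) (q := Real.toNNReal a⁻¹) hu
    (fun x hx => by
      by_contra h
      exact hx (hsupp x (by simpa using h)))
    (by
      rw [Real.one_le_toNNReal]
      exact (one_le_inv₀ hb0).2 hb1)
    (by
      rw [finrank_euclideanSpace_fin, Real.toNNReal_lt_natCast (by omega)]
      rw [inv_lt_comm₀ hb0 hn0]
      simpa using hb)
    (by
      rw [finrank_euclideanSpace_fin, NNReal.coe_inv, Real.coe_toNNReal _ (by positivity),
        Real.coe_toNNReal _ (by positivity), inv_inv, inv_inv]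
      simpa using hab)
    Metric.isBounded_closedBall
  refine h1.trans ?_
  gcongr
  exact eLpNorm_fderiv_le_sum hu (one_le_recipExp hb0 hb1)

variable {m : ℕ} {R : ℝ} {v : (Fin n → ℕ) → Eu n → ℂ}

lemma WeakJet.locallyIntegrable (hv : WeakJet m R v) {β : Fin n → ℕ} (hβ : ∑ i, β i ≤ m) :
    LocallyIntegrable (v β) :=
  (hv.memLp β hβ).locallyIntegrable (by norm_num)

lemma sum_add_single (β : Fin n → ℕ) (i : Fin n) :
    ∑ l, (β + Pi.single i 1 : Fin n → ℕ) l = ∑ l, β l + 1 := by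
  simp [Finset.sum_add_distrib]

/-- Sobolev embedding: every derivative of order `i ≤ m` is integrable to a power interpolating
between the exponent `2` at order `m` and the exponent `1/ρ` at order `0`. -/
lemma WeakJet.memLp_sobolev (hv : WeakJet m R v) (hn : 1 ≤ n) {ρ κ : ℝ} (hρ : 1 / n < ρ)
    (hκ : 0 ≤ κ) (hκn : κ ≤ 1 / n) (hsum : ρ + m * κ = 1 / 2) :
    ∀ β, ∑ i, β i ≤ m → MemLp (v β) (recipExp (ρ + (∑ i, β i : ℕ) * κ)) volume := by
  have hn0 : (0 : ℝ) < n := by exact_mod_cast hn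
  have hρ0 : 0 < ρ := lt_trans (by positivity) hρ
  have hle : ∀ i : ℕ, i ≤ m → ρ + i * κ ≤ 1 / 2 := fun i hi => by
    rw [← hsum]
    gcongr
  -- induction on the number `d` of orders missing to `m`, with bounds uniform in the mollification
  have key : ∀ d : ℕ, ∀ β : Fin n → ℕ, ∑ i, β i + d = m → ∃ M : ℝ≥0∞, M ≠ ⊤ ∧
      ∀ k, eLpNorm (mollify k (v β)) (recipExp (ρ + (∑ i, β i : ℕ) * κ)) volume ≤ M := by
    intro d
    induction d with
    | zero =>
      intro β hβ
      rw [add_zero] at hβ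
      refine ⟨eLpNorm (v β) 2 volume, (hv.memLp β hβ.le).2.ne, fun k => ?_⟩
      have h1 := eLpNorm_mollify_le k (c := 1 / 2) (by norm_num) (by norm_num)
        (hv.memLp β hβ.le).1
      rw [recipExp_half] at h1
      rw [hβ, hsum, recipExp_half]
      exact h1
    | succ d ih =>
      intro β hβ
      have h1 : ∀ i : Fin n, ∑ l, (β + Pi.single i 1 : Fin n → ℕ) l + d = m := fun i => by
        rw [sum_add_single]; omega
      choose M hM hMk using fun i => ih (β + Pi.single i 1) (h1 i)
      have hc1 := hle (∑ i, β i + 1) (by omega)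
      have hc0 : 0 ≤ ((∑ i, β i : ℕ) : ℝ) * κ := by positivity
      push_cast at hc1 hc0
      obtain ⟨C, hC, hCu⟩ := exists_eLpNorm_le_sum_partial (R := R + 1)
        (a := ρ + (∑ i, β i : ℕ) * κ) (b := ρ + ((∑ i, β i + 1 : ℕ) : ℝ) * κ) (n := n)
        (by positivity) (by push_cast; nlinarith) (by push_cast; linarith) hn
        (by push_cast; nlinarith)
      refine ⟨C * ∑ i, M i, ENNReal.mul_ne_top hC (ENNReal.sum_ne_top.2 fun i _ => hM i),
        fun k => ?_⟩
      refine (hCu (mollify k (v β))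
        ((contDiff_mollify k (hv.locallyIntegrable (by omega))).of_le (by simp))
        (fun x hx => mollify_eq_zero k (hv.supp β (by omega)) hx)).trans ?_
      gcongr with i
      have h2 : (fun x => fderiv ℝ (mollify k (v β)) x (EuclideanSpace.single i 1)) =
          mollify k (v (β + Pi.single i 1)) := by
        ext x
        exact fderiv_mollify k hv (by omega) x
      have h3 := hMk i k
      rw [sum_add_single] at h3
      rw [h2]
      exact h3
  intro β hβ
  obtain ⟨M, hM, hMk⟩ := key (m - ∑ i, β i) β (by omega)
  exact memLp_of_eLpNorm_mollify_le (hv.locallyIntegrable hβ) hM hMk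

/-- A finite family of nonnegative numbers that is strictly convex in the logarithmic sense,
up to a constant, is bounded by its extreme members. -/
lemma le_of_interpolation {A : (Fin n → ℕ) → ℝ} {C M : ℝ} (hA : ∀ β, 0 ≤ A β) (hC : 1 ≤ C)
    (hM : 0 ≤ M) (hend : ∀ β, ∑ i, β i = 0 ∨ ∑ i, β i = m → A β ≤ M)
    (hstep : ∀ β i, ∑ l, β l + 2 ≤ m →
      A (β + Pi.single i 1) ^ 2 ≤ C * (A β * A (β + Pi.single i 1 + Pi.single i 1))) :
    ∀ β, ∑ i, β i ≤ m → A β ≤ (2 * C) ^ (m ^ 2) * M := by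
  classical
  set S : Finset (Fin n → ℕ) :=
    (Fintype.piFinset fun _ : Fin n => Finset.range (m + 1)).filter fun β => ∑ i, β i ≤ m with hS
  have hmem : ∀ β : Fin n → ℕ, ∑ i, β i ≤ m → β ∈ S := by
    intro β hβ
    rw [hS, Finset.mem_filter, Fintype.mem_piFinset]
    refine ⟨fun i => ?_, hβ⟩
    rw [Finset.mem_range]
    have : β i ≤ ∑ l, β l := Finset.single_le_sum (fun _ _ => Nat.zero_le _) (Finset.mem_univ i)
    omega
  -- with the weights `L^{|β|²}` the interpolation inequality gains a factor `1/2`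
  set L := 2 * C with hL
  have hL1 : 1 ≤ L := by linarith
  set B : (Fin n → ℕ) → ℝ := fun β => L ^ ((∑ i, β i) ^ 2) * A β with hB
  have hB0 : ∀ β, 0 ≤ B β := fun β => mul_nonneg (by positivity) (hA β)
  obtain ⟨γ, hγ, hmax⟩ := S.exists_max_image B ⟨0, hmem 0 (by simp)⟩
  have hγm : ∑ i, γ i ≤ m := (Finset.mem_filter.1 hγ).2
  have hBγ : B γ ≤ L ^ (m ^ 2) * M := by
    by_cases hγ0 : ∑ i, γ i = 0 ∨ ∑ i, γ i = m
    · have h1 : L ^ ((∑ i, γ i) ^ 2) ≤ L ^ (m ^ 2) :=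
        pow_le_pow_right₀ hL1 (Nat.pow_le_pow_left hγm 2)
      exact mul_le_mul h1 (hend γ hγ0) (hA γ) (by positivity)
    · push Not at hγ0
      obtain ⟨i, hi⟩ : ∃ i, γ i ≠ 0 := by
        by_contra! h
        exact hγ0.1 (by simp [h])
      set δ : Fin n → ℕ := γ - Pi.single i 1 with hδ
      have hγδ : γ = δ + Pi.single i 1 := by
        refine (tsub_add_cancel_of_le ?_).symm
        intro l
        by_cases hl : l = i
        · subst hl; simp; omega
        · simp [hl]
      have hsγ : ∑ l, γ l = ∑ l, δ l + 1 := by rw [hγδ, sum_add_single]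
      set s := ∑ l, δ l with hs
      have hsm : s + 2 ≤ m := by have := hγ0.2; omega
      have h1 := hstep δ i hsm
      rw [← hγδ] at h1
      have hs2 : ∑ l, (γ + Pi.single i 1 : Fin n → ℕ) l = s + 2 := by rw [sum_add_single, hsγ]
      have b1 := hmax δ (hmem δ (by omega))
      have b2 := hmax (γ + Pi.single i 1) (hmem _ (by omega))
      have e0 : B γ = L ^ ((s + 1) ^ 2) * A γ := by rw [hB]; simp only [hsγ]
      have e1 : B δ = L ^ (s ^ 2) * A δ := rfl
      have e2 : B (γ + Pi.single i 1) = L ^ ((s + 2) ^ 2) * A (γ + Pi.single i 1) := by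
        rw [hB]; simp only [hs2]
      have h2 : 2 * B γ ^ 2 ≤ B δ * B (γ + Pi.single i 1) := by
        rw [e0, e1, e2, mul_pow]
        have hpow : L ^ (s ^ 2) * L ^ ((s + 2) ^ 2) = (L ^ ((s + 1) ^ 2)) ^ 2 * (L * L) := by
          rw [← pow_add, ← pow_mul, ← sq, ← pow_add]
          congr 1
          ring
        have hAA : 0 ≤ A δ * A (γ + Pi.single i 1) := mul_nonneg (hA _) (hA _)
        calc 2 * ((L ^ ((s + 1) ^ 2)) ^ 2 * A γ ^ 2)
            ≤ 2 * ((L ^ ((s + 1) ^ 2)) ^ 2 * (C * (A δ * A (γ + Pi.single i 1)))) := by gcongr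
          _ = (L ^ ((s + 1) ^ 2)) ^ 2 * (L * 1) * (A δ * A (γ + Pi.single i 1)) := by
              rw [hL]; ring
          _ ≤ (L ^ ((s + 1) ^ 2)) ^ 2 * (L * L) * (A δ * A (γ + Pi.single i 1)) := by gcongr
          _ = _ := by rw [← hpow]; ring
      have h3 : B δ * B (γ + Pi.single i 1) ≤ B γ * B γ :=
        mul_le_mul b1 b2 (hB0 _) (hB0 _)
      have h4 : B γ = 0 := by
        have : B γ ^ 2 ≤ 0 := by nlinarith
        exact pow_eq_zero_iff two_ne_zero |>.1 (le_antisymm this (sq_nonneg _))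
      rw [h4]
      positivity
  intro β hβ
  refine le_trans ?_ ((hmax β (hmem β hβ)).trans hBγ)
  have : 1 ≤ L ^ ((∑ i, β i) ^ 2) := one_le_pow₀ hL1
  calc A β = 1 * A β := (one_mul _).symm
    _ ≤ _ := mul_le_mul_of_nonneg_right this (hA β)

/-- Gagliardo–Nirenberg interpolation between `v 0 ∈ L^{1/ρ}` and square integrable derivatives
of order `m`. -/
lemma WeakJet.memLp_interpolation (hv : WeakJet m R v) {ρ κ : ℝ} (hρ : 0 < ρ)
    (hκ : 0 ≤ κ) (hsum : ρ + m * κ = 1 / 2) (h0 : MemLp (v 0) (recipExp ρ) volume) :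
    ∀ β, ∑ i, β i ≤ m → MemLp (v β) (recipExp (ρ + (∑ i, β i : ℕ) * κ)) volume := by
  have hle : ∀ i : ℕ, i ≤ m → ρ + i * κ ≤ 1 / 2 := fun i hi => by
    rw [← hsum]
    gcongr
  have hpos : ∀ i : ℕ, 0 < ρ + i * κ := fun i => by positivity
  have hcd : ∀ k β, ∑ i, β i ≤ m → ContDiff ℝ ∞ (mollify k (v β)) := fun k β hβ =>
    contDiff_mollify k (hv.locallyIntegrable hβ)
  have hcs : ∀ k β, ∑ i, β i ≤ m → HasCompactSupport (mollify k (v β)) := fun k β hβ =>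
    hasCompactSupport_mollify k (hv.supp β hβ)
  have hfin : ∀ k β, ∑ i, β i ≤ m → ∀ p, eLpNorm (mollify k (v β)) p volume ≠ ⊤ :=
    fun k β hβ p => ((hcd k β hβ).continuous.memLp_of_hasCompactSupport (hcs k β hβ)).2.ne
  have hinv : 1 ≤ ρ⁻¹ := (one_le_inv₀ hρ).2 (by have := hle 0 (Nat.zero_le m); simp at this; linarith)
  set M0 : ℝ := (eLpNorm (v 0) (recipExp ρ) volume).toReal with hM0
  obtain ⟨M1, hM1nn, hM1⟩ : ∃ M1 : ℝ, 0 ≤ M1 ∧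
      ∀ β, ∑ i, β i = m → (eLpNorm (v β) 2 volume).toReal ≤ M1 := by
    classical
    set S : Finset (Fin n → ℕ) := Fintype.piFinset fun _ : Fin n => Finset.range (m + 1)
    refine ⟨∑ β ∈ S, (eLpNorm (v β) 2 volume).toReal,
      Finset.sum_nonneg fun _ _ => ENNReal.toReal_nonneg, fun β hβ => ?_⟩
    refine Finset.single_le_sum (f := fun β => (eLpNorm (v β) 2 volume).toReal)
      (fun _ _ => ENNReal.toReal_nonneg) ?_
    rw [Fintype.mem_piFinset]
    intro i
    rw [Finset.mem_range]
    have : β i ≤ ∑ l, β l := Finset.single_le_sum (fun _ _ => Nat.zero_le _) (Finset.mem_univ i)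
    omega
  have key : ∀ k β, ∑ i, β i ≤ m →
      (eLpNorm (mollify k (v β)) (recipExp (ρ + (∑ i, β i : ℕ) * κ)) volume).toReal ≤
        (2 * ρ⁻¹) ^ (m ^ 2) * (M0 + M1) := by
    intro k
    refine le_of_interpolation (m := m) (A := fun β =>
      (eLpNorm (mollify k (v β)) (recipExp (ρ + (∑ i, β i : ℕ) * κ)) volume).toReal)
      (fun _ => ENNReal.toReal_nonneg) hinv (add_nonneg ENNReal.toReal_nonneg hM1nn) ?_ ?_
    · rintro β (hβ | hβ)
      · have hβ0 : β = 0 := by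
          ext i
          exact (Finset.sum_eq_zero_iff.1 hβ) i (Finset.mem_univ i)
        have h1 : ρ ≤ 1 := by have := hle 0 (Nat.zero_le m); simp at this; linarith
        simp only [hβ, Nat.cast_zero, zero_mul, add_zero]
        rw [hβ0]
        refine (ENNReal.toReal_mono h0.2.ne (eLpNorm_mollify_le k hρ h1 h0.1)).trans ?_
        rw [← hM0]
        linarith
      · simp only [hβ]
        rw [hsum, recipExp_half]
        have h1 := eLpNorm_mollify_le k (c := 1 / 2) (by norm_num) (by norm_num)
          (hv.memLp β hβ.le).1
        rw [recipExp_half] at h1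
        refine (ENNReal.toReal_mono (hv.memLp β hβ.le).2.ne h1).trans ((hM1 β hβ).trans ?_)
        have : 0 ≤ M0 := ENNReal.toReal_nonneg
        linarith
    · intro β i hβ
      have s1 : ∑ l, (β + Pi.single i 1 : Fin n → ℕ) l = ∑ l, β l + 1 := sum_add_single β i
      have s2 : ∑ l, (β + Pi.single i 1 + Pi.single i 1 : Fin n → ℕ) l = ∑ l, β l + 2 := by
        rw [sum_add_single, s1]
      have h1 := eLpNorm_sq_le (w := mollify k (v β)) (u := mollify k (v (β + Pi.single i 1)))
        (u' := mollify k (v (β + Pi.single i 1 + Pi.single i 1)))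
        (e := EuclideanSpace.single i 1) (a := ρ + (∑ l, β l : ℕ) * κ)
        (b := ρ + ((∑ l, β l + 2 : ℕ) : ℝ) * κ) (c := ρ + ((∑ l, β l + 1 : ℕ) : ℝ) * κ)
        (hpos _) (hpos _) (hpos _) (by push_cast; ring) (hle _ (by omega))
        ((hcd k β (by omega)).of_le (by simp)) ((hcd k _ (by omega)).of_le (by simp))
        (hcs k β (by omega)) (hcs k _ (by omega)) (fderiv_mollify k hv (by omega))
        (fderiv_mollify k hv (by omega)) (hcd k _ (by omega)).continuous
      simp only [s1, s2]
      have hfin2 : ENNReal.ofReal (ρ + ((∑ l, β l + 1 : ℕ) : ℝ) * κ)⁻¹ *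
          (eLpNorm (mollify k (v β)) (recipExp (ρ + (∑ l, β l : ℕ) * κ)) volume *
          eLpNorm (mollify k (v (β + Pi.single i 1 + Pi.single i 1)))
            (recipExp (ρ + ((∑ l, β l + 2 : ℕ) : ℝ) * κ)) volume) ≠ ⊤ :=
        ENNReal.mul_ne_top ENNReal.ofReal_ne_top
          (ENNReal.mul_ne_top (hfin k _ (by omega) _) (hfin k _ (by omega) _))
      have h2 := ENNReal.toReal_mono hfin2 h1
      rw [ENNReal.toReal_pow, ENNReal.toReal_mul, ENNReal.toReal_mul,
        ENNReal.toReal_ofReal (inv_nonneg.2 (hpos _).le)] at h2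
      refine h2.trans ?_
      gcongr
      have : 0 ≤ ((∑ l, β l + 1 : ℕ) : ℝ) * κ := by positivity
      linarith
  intro β hβ
  refine memLp_of_eLpNorm_mollify_le (hv.locallyIntegrable hβ)
    (M := ENNReal.ofReal ((2 * ρ⁻¹) ^ (m ^ 2) * (M0 + M1))) ENNReal.ofReal_ne_top fun k => ?_
  rw [ENNReal.le_ofReal_iff_toReal_le (hfin k β hβ _) ?_]
  · exact key k β hβ
  · exact ENNReal.toReal_nonneg.trans (key k β hβ)

/-- Integrability of the derivatives of the potential: the reciprocal exponent grows linearly with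
the order of the derivative, from `ρ < 2/n` at order `0` to at most `1/2` at order `m`. -/
lemma WeakJet.exists_exponents (hv : WeakJet m R v) (hn : 1 ≤ n)
    (hdim : 4 + 2 * m ≤ n → ∃ r : ℝ≥0∞, (n : ℝ≥0∞) / 2 < r ∧ MemLp (v 0) r volume) :
    ∃ ρ κ : ℝ, 0 < ρ ∧ ρ * n < 2 ∧ 0 ≤ κ ∧ ρ + m * κ ≤ 1 / 2 ∧
      ∀ β, ∑ i, β i ≤ m → MemLp (v β) (recipExp (ρ + (∑ i, β i : ℕ) * κ)) volume := by
  have hn0 : (0 : ℝ) < n := by exact_mod_cast hn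
  by_cases hn3 : n ≤ 3
  · refine ⟨1 / 2, 0, by norm_num, ?_, le_rfl, by simp, fun β hβ => ?_⟩
    · have : (n : ℝ) ≤ 3 := by exact_mod_cast hn3
      linarith
    · rw [mul_zero, add_zero, recipExp_half]
      exact hv.memLp β hβ
  have hn4 : (4 : ℝ) ≤ n := by exact_mod_cast (by omega : 4 ≤ n)
  by_cases hd : 4 + 2 * m ≤ n
  · obtain ⟨r, hr, hvr⟩ := hdim hd
    -- the exponent `r` may be infinite, and may be lowered by the boundedness of the support
    have hr' : ∃ ρ : ℝ, 0 < ρ ∧ ρ * n < 2 ∧ recipExp ρ ≤ r := by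
      refine ⟨(min r n).toReal⁻¹, ?_, ?_, ?_⟩
      · rw [inv_pos]
        refine ENNReal.toReal_pos ?_ (by simp)
        refine (lt_min (lt_of_le_of_lt zero_le hr) ?_).ne'
        exact_mod_cast hn
      · have hlt : (n : ℝ≥0∞) / 2 < min r n := by
          refine lt_min hr ?_
          exact ENNReal.half_lt_self (by exact_mod_cast (by omega : n ≠ 0)) (by simp)
        have h2 := (ENNReal.toReal_lt_toReal (ENNReal.div_ne_top (by simp) (by simp))
          (by simp)).2 hlt
        rw [ENNReal.toReal_div] at h2
        simp only [ENNReal.toReal_natCast, ENNReal.toReal_ofNat] at h2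
        have h3 : 0 < (min r n).toReal := lt_trans (by positivity) h2
        rw [inv_mul_lt_iff₀ h3]
        linarith
      · rw [recipExp, inv_inv, ENNReal.ofReal_toReal (by simp)]
        exact min_le_left _ _
    obtain ⟨ρ, hρ0, hρn, hρr⟩ := hr'
    have hρ2 : ρ ≤ 1 / 2 := by nlinarith
    have hv0 : MemLp (v 0) (recipExp ρ) volume :=
      (hv.supp 0 (by simp)).memLp_mono hρr hvr
    by_cases hm : m = 0
    · refine ⟨ρ, 0, hρ0, hρn, le_rfl, by simpa using hρ2, fun β hβ => ?_⟩
      have hβ0 : β = 0 := by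
        ext i
        exact (Finset.sum_eq_zero_iff.1 (by omega : ∑ i, β i = 0)) i (Finset.mem_univ i)
      rw [mul_zero, add_zero, hβ0]
      exact hv0
    · have hm0 : (0 : ℝ) < m := by exact_mod_cast Nat.pos_of_ne_zero hm
      have hs : ρ + m * ((1 / 2 - ρ) / m) = 1 / 2 := by field_simp; ring
      have hκ : 0 ≤ (1 / 2 - ρ) / m := div_nonneg (by linarith) hm0.le
      exact ⟨ρ, (1 / 2 - ρ) / m, hρ0, hρn, hκ, hs.le,
        hv.memLp_interpolation hρ0 hκ hs hv0⟩
  -- any `ρ` with `1/n < ρ < 2/n` for which the slope `κ` is at most `1/n` admits the Sobolev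
  -- embedding; here `ρ = 3/(2n)` and `n ≤ 2m + 3`
  · have hm : 1 ≤ m := by omega
    have hm0 : (0 : ℝ) < m := by exact_mod_cast hm
    have hnm : (n : ℝ) ≤ 3 + 2 * m := by exact_mod_cast (by omega : n ≤ 3 + 2 * m)
    have hρ2 : (3 : ℝ) / 2 / n ≤ 1 / 2 := by
      rw [div_le_iff₀ hn0]; linarith
    have hs : (3 : ℝ) / 2 / n + m * ((1 / 2 - 3 / 2 / n) / m) = 1 / 2 := by field_simp; ring
    have hκ : 0 ≤ (1 / 2 - (3 : ℝ) / 2 / n) / m := div_nonneg (by linarith) hm0.le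
    refine ⟨3 / 2 / n, (1 / 2 - 3 / 2 / n) / m, by positivity, ?_, hκ, hs.le,
      hv.memLp_sobolev hn ?_ hκ ?_ hs⟩
    · rw [div_mul_cancel₀ _ hn0.ne']; norm_num
    · gcongr; norm_num
    · rw [div_le_iff₀ hm0, sub_le_iff_le_add, div_mul_eq_mul_div, ← add_div,
        le_div_iff₀ hn0]
      linarith

/-! ### The heat kernel at complex times -/

/-- The heat kernel `(4πs)^{-n/2} e^{-|x|²/(4s)}` at complex time `s`. -/
def heat (s : ℂ) (x : Eu n) : ℂ :=
  (4 * Real.pi * s) ^ ((-(n / 2 : ℝ) : ℝ) : ℂ) * Complex.exp (-(‖x‖ : ℂ) ^ 2 / (4 * s))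

lemma measurable_heat : Measurable (fun p : ℂ × Eu n => heat p.1 p.2) := by
  unfold heat
  fun_prop

lemma re_pos_ne_zero {s : ℂ} (hs : 0 < s.re) : s ≠ 0 := by
  rintro rfl
  simp at hs

lemma norm_heat (s : ℂ) (x : Eu n) :
    ‖heat s x‖ = (4 * Real.pi * ‖s‖) ^ (-(n / 2 : ℝ)) *
      Real.exp (-‖x‖ ^ 2 / 4 * (s.re / ‖s‖ ^ 2)) := by
  rw [heat, norm_mul, Complex.norm_cpow_real, Complex.norm_exp]
  congr 2
  · simp [abs_of_pos Real.pi_pos]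
  · have : -(‖x‖ : ℂ) ^ 2 / (4 * s) = ((-‖x‖ ^ 2 / 4 : ℝ) : ℂ) * s⁻¹ := by
      rw [div_eq_mul_inv, mul_inv]; push_cast; ring
    rw [this, Complex.re_ofReal_mul, Complex.inv_re, Complex.normSq_eq_norm_sq]

lemma inv_four_mul_re_pos {s : ℂ} (hs : 0 < s.re) : 0 < ((4 * s)⁻¹).re := by
  rw [Complex.inv_re]
  refine div_pos (by simpa using hs) (Complex.normSq_pos.2 ?_)
  exact mul_ne_zero (by norm_num) (re_pos_ne_zero hs)

lemma heat_eq_gaussian (s : ℂ) : (heat s : Eu n → ℂ) = fun x =>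
    (4 * Real.pi * s) ^ ((-(n / 2 : ℝ) : ℝ) : ℂ) *
      Complex.exp (-((4 * s)⁻¹) * (‖x‖ : ℂ) ^ 2) := by
  ext x
  rw [heat]
  congr 2
  rw [div_eq_mul_inv]
  ring

lemma integrable_heat {s : ℂ} (hs : 0 < s.re) : Integrable (heat s : Eu n → ℂ) := by
  rw [heat_eq_gaussian]
  have := GaussianFourier.integrable_cexp_neg_mul_sq_norm_add (V := Eu n)
    (inv_four_mul_re_pos hs) 0 0
  simp only [zero_mul, add_zero] at this
  exact this.const_mul _

/-- The Fourier multiplier of the heat flow at complex time `s`. -/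
lemma fourier_heat {s : ℂ} (hs : 0 < s.re) (ζ : Eu n) :
    𝓕 (heat s : Eu n → ℂ) ζ = Complex.exp (-(s * (‖(2 * Real.pi) • ζ‖ : ℂ) ^ 2)) := by
  have h1 := fourier_gaussian_innerProductSpace (V := Eu n) (inv_four_mul_re_pos hs) ζ
  have hs0 := re_pos_ne_zero hs
  have h2 : 𝓕 (heat s : Eu n → ℂ) ζ = (4 * Real.pi * s) ^ ((-(n / 2 : ℝ) : ℝ) : ℂ) *
      𝓕 (fun x : Eu n => Complex.exp (-((4 * s)⁻¹) * (‖x‖ : ℂ) ^ 2)) ζ := by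
    rw [heat_eq_gaussian, Real.fourier_eq, Real.fourier_eq, ← integral_const_mul]
    refine integral_congr_ae (Eventually.of_forall fun x => ?_)
    simp only [Circle.smul_def, smul_eq_mul]
    ring
  rw [h2, h1, ← mul_assoc]
  have hne : (4 * Real.pi * s : ℂ) ≠ 0 := by
    refine mul_ne_zero (mul_ne_zero (by norm_num) ?_) hs0
    exact_mod_cast Real.pi_ne_zero
  have e1 : (Real.pi / (4 * s)⁻¹ : ℂ) = 4 * Real.pi * s := by
    rw [div_inv_eq_mul]; ring
  have e2 : ((Module.finrank ℝ (Eu n) : ℂ) / 2) = ((n / 2 : ℝ) : ℂ) := by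
    rw [finrank_euclideanSpace_fin]; push_cast; rfl
  rw [e1, e2, Complex.ofReal_neg, Complex.cpow_neg, inv_mul_cancel₀, one_mul]
  · congr 1
    rw [norm_smul, Real.norm_of_nonneg (by positivity)]
    rw [div_inv_eq_mul]
    push_cast
    ring
  · rw [Ne, Complex.cpow_eq_zero_iff]
    tauto

lemma integral_heat_real {t : ℝ} (ht : 0 < t) : ∫ x : Eu n, heat (t : ℂ) x = 1 := by
  have h := fourier_heat (n := n) (s := (t : ℂ)) (by simpa using ht) 0
  rw [Real.fourier_eq] at h
  simpa using h

lemma integral_norm_heat_real {t : ℝ} (ht : 0 < t) : ∫ x : Eu n, ‖heat (t : ℂ) x‖ = 1 := by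
  have h1 : ∀ x : Eu n, heat (t : ℂ) x = ((‖heat (t : ℂ) x‖ : ℝ) : ℂ) := by
    intro x
    have : heat (t : ℂ) x = (((4 * Real.pi * t) ^ (-(n / 2 : ℝ)) *
        Real.exp (-‖x‖ ^ 2 / (4 * t)) : ℝ) : ℂ) := by
      rw [heat, Complex.ofReal_mul, Complex.ofReal_cpow (by positivity)]
      push_cast
      rfl
    rw [this, Complex.norm_real, Real.norm_of_nonneg (by positivity)]
  have h2 := integral_heat_real (n := n) ht
  rw [integral_congr_ae (Eventually.of_forall h1), integral_complex_ofReal] at h2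
  exact_mod_cast h2

lemma integral_norm_heat {s : ℂ} (hs : 0 < s.re) :
    ∫ x : Eu n, ‖heat s x‖ = (‖s‖ / s.re) ^ (n / 2 : ℝ) := by
  have hs0 : 0 < ‖s‖ := norm_pos_iff.2 (re_pos_ne_zero hs)
  -- up to a factor, `‖heat s‖` is the heat kernel at the real time `|s|² / Re s`
  set t : ℝ := ‖s‖ ^ 2 / s.re with ht
  have ht0 : 0 < t := by positivity
  have h1 : ∀ x : Eu n, ‖heat s x‖ = (‖s‖ / s.re) ^ (n / 2 : ℝ) * ‖heat (t : ℂ) x‖ := by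
    intro x
    rw [norm_heat, norm_heat, Complex.norm_real, Real.norm_of_nonneg ht0.le, Complex.ofReal_re,
      ← mul_assoc]
    congr 1
    · have : 4 * Real.pi * t = (‖s‖ / s.re) * (4 * Real.pi * ‖s‖) := by
        rw [ht]; field_simp
      rw [this, Real.mul_rpow (x := ‖s‖ / s.re) (y := 4 * Real.pi * ‖s‖) (by positivity)
        (by positivity), ← mul_assoc, ← Real.rpow_add (by positivity), add_neg_cancel,
        Real.rpow_zero, one_mul]
    · congr 2
      rw [ht]; field_simp
  simp_rw [h1]
  rw [integral_const_mul, integral_norm_heat_real ht0, mul_one]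

/-- Superpositions of heat kernels along a path `p` of complex times. -/
lemma heat_superposition {μ : Measure ℝ} [SFinite μ] {c p : ℝ → ℂ} (hc : Measurable c)
    (hp : Measurable p) (hpos : ∀ᵐ t ∂μ, 0 < (p t).re)
    (hint : Integrable (fun t => ‖c t‖ * (‖p t‖ / (p t).re) ^ (n / 2 : ℝ)) μ) :
    Integrable (fun x : Eu n => ∫ t, c t * heat (p t) x ∂μ) ∧
    ∀ ζ : Eu n, 𝓕 (fun x : Eu n => ∫ t, c t * heat (p t) x ∂μ) ζ =
      ∫ t, c t * Complex.exp (-(p t * (‖(2 * Real.pi) • ζ‖ : ℂ) ^ 2)) ∂μ := by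
  have hmeas : Measurable (fun q : ℝ × Eu n => c q.1 * heat (p q.1) q.2) :=
    (hc.comp measurable_fst).mul (measurable_heat.comp
      ((hp.comp measurable_fst).prodMk measurable_snd))
  have hprod : Integrable (fun q : ℝ × Eu n => c q.1 * heat (p q.1) q.2) (μ.prod volume) := by
    rw [integrable_prod_iff hmeas.aestronglyMeasurable]
    refine ⟨?_, ?_⟩
    · filter_upwards [hpos] with t ht
      exact (integrable_heat ht).const_mul _
    · refine hint.congr ?_
      filter_upwards [hpos] with t ht
      simp_rw [norm_mul]
      rw [integral_const_mul, integral_norm_heat ht]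
  refine ⟨hprod.integral_prod_right, fun ζ => ?_⟩
  rw [Real.fourier_eq]
  have h1 : ∀ x : Eu n, Real.fourierChar (-inner ℝ x ζ) • ∫ t, c t * heat (p t) x ∂μ =
      ∫ t, Real.fourierChar (-inner ℝ x ζ) • (c t * heat (p t) x) ∂μ := fun x => by
    simp only [Circle.smul_def]
    rw [integral_smul]
  simp_rw [h1]
  rw [integral_integral_swap]
  · refine integral_congr_ae ?_
    filter_upwards [hpos] with t ht
    rw [← fourier_heat ht, Real.fourier_eq, ← integral_const_mul]
    refine integral_congr_ae (Eventually.of_forall fun x => ?_)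
    simp only [Circle.smul_def, smul_eq_mul]
    ring
  · have h2 : Integrable (fun q : ℝ × Eu n =>
        Real.fourierChar (-inner ℝ q.2 ζ) • (c q.1 * heat (p q.1) q.2)) (μ.prod volume) := by
      refine hprod.mono ?_ (Eventually.of_forall fun q => ?_)
      · have hch : Continuous fun q : ℝ × Eu n => (Real.fourierChar (-inner ℝ q.2 ζ) : ℂ) := by
          fun_prop
        simp only [Circle.smul_def]
        exact hch.aestronglyMeasurable.smul hmeas.aestronglyMeasurable
      · rw [Circle.norm_smul]
    exact h2.swap

/-- The derivative of `τ ↦ heat (1 + iτ) x`. -/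
def heatDeriv (τ : ℝ) (x : Eu n) : ℂ :=
  Complex.I * (-(n / 2 : ℂ) / (1 + Complex.I * τ) +
    (‖x‖ : ℂ) ^ 2 / (4 * (1 + Complex.I * τ) ^ 2)) * heat (1 + Complex.I * τ) x

lemma measurable_heatDeriv : Measurable (fun p : ℝ × Eu n => heatDeriv p.1 p.2) := by
  unfold heatDeriv heat
  fun_prop

lemma one_add_I_mul_re (τ : ℝ) : (1 + Complex.I * τ : ℂ).re = 1 := by simp

lemma norm_one_add_I_mul (τ : ℝ) : ‖(1 + Complex.I * τ : ℂ)‖ = (1 + τ ^ 2) ^ (1 / 2 : ℝ) := by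
  rw [← Real.sqrt_eq_rpow, Complex.norm_eq_sqrt_sq_add_sq]
  simp

lemma one_le_norm_one_add_I_mul (τ : ℝ) : 1 ≤ ‖(1 + Complex.I * τ : ℂ)‖ := by
  have := Complex.abs_re_le_norm (1 + Complex.I * τ : ℂ)
  rwa [one_add_I_mul_re, abs_one] at this

lemma hasDerivAt_heat (τ : ℝ) (x : Eu n) :
    HasDerivAt (fun τ : ℝ => heat (1 + Complex.I * τ) x) (heatDeriv τ x) τ := by
  set s : ℂ := 1 + Complex.I * τ with hs
  have hs0 : s ≠ 0 := re_pos_ne_zero (by rw [hs, one_add_I_mul_re]; exact one_pos)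
  have hpi : (4 * Real.pi : ℂ) ≠ 0 := by
    simp [Real.pi_ne_zero]
  have hslit : (4 * Real.pi * s : ℂ) ∈ Complex.slitPlane := by
    left
    have : (4 * Real.pi * s : ℂ) = ((4 * Real.pi : ℝ) : ℂ) * s := by push_cast; ring
    rw [this, Complex.re_ofReal_mul, hs, one_add_I_mul_re]
    positivity
  have d1 : HasDerivAt (fun s : ℂ => (4 * Real.pi * s : ℂ)) (4 * Real.pi) s := by
    simpa using (hasDerivAt_id s).const_mul (4 * Real.pi : ℂ)
  have d2 := d1.cpow_const (c := ((-(n / 2 : ℝ) : ℝ) : ℂ)) hslit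
  have d3 : HasDerivAt (fun s : ℂ => -(‖x‖ : ℂ) ^ 2 / (4 * s)) ((‖x‖ : ℂ) ^ 2 / (4 * s ^ 2)) s := by
    have h4 : HasDerivAt (fun s : ℂ => 4 * s) 4 s := by
      simpa using (hasDerivAt_id s).const_mul (4 : ℂ)
    have h5 := (hasDerivAt_const s (-(‖x‖ : ℂ) ^ 2)).div h4 (by simpa using hs0)
    refine h5.congr_deriv ?_
    have : (4 * s) ^ 2 ≠ 0 := pow_ne_zero 2 (mul_ne_zero (by norm_num) hs0)
    rw [div_eq_div_iff this (mul_ne_zero (by norm_num) (pow_ne_zero 2 hs0))]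
    ring
  have d4 := d2.mul d3.cexp
  have d5 : HasDerivAt (fun τ : ℝ => (1 + Complex.I * τ : ℂ)) Complex.I τ := by
    have := ((hasDerivAt_id (τ : ℂ)).const_mul Complex.I).const_add 1
    simpa using this.comp_ofReal
  have d6 := HasDerivAt.scomp τ d4 d5
  refine d6.congr_deriv ?_
  rw [heatDeriv, heat, ← hs, smul_eq_mul]
  have hpow : (4 * Real.pi * s : ℂ) ^ (((-(n / 2 : ℝ) : ℝ) : ℂ) - 1) =
      (4 * Real.pi * s) ^ ((-(n / 2 : ℝ) : ℝ) : ℂ) / (4 * Real.pi * s) := by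
    rw [Complex.cpow_sub _ _ (mul_ne_zero hpi hs0), Complex.cpow_one]
  rw [hpow]
  push_cast
  field_simp

lemma norm_heat_le (τ : ℝ) (x : Eu n) :
    ‖heat (1 + Complex.I * τ) x‖ ≤ ‖(1 + Complex.I * τ : ℂ)‖ ^ (-(n / 2 : ℝ)) := by
  have h1 := one_le_norm_one_add_I_mul τ
  rw [norm_heat, one_add_I_mul_re]
  have h2 : Real.exp (-‖x‖ ^ 2 / 4 * (1 / ‖(1 + Complex.I * τ : ℂ)‖ ^ 2)) ≤ 1 := by
    rw [Real.exp_le_one_iff]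
    have : 0 ≤ ‖x‖ ^ 2 / 4 * (1 / ‖(1 + Complex.I * τ : ℂ)‖ ^ 2) := by positivity
    linarith [neg_div 4 (‖x‖ ^ 2), neg_mul (‖x‖ ^ 2 / 4) (1 / ‖(1 + Complex.I * τ : ℂ)‖ ^ 2)]
  have h3 : (4 * Real.pi * ‖(1 + Complex.I * τ : ℂ)‖) ^ (-(n / 2 : ℝ)) ≤
      ‖(1 + Complex.I * τ : ℂ)‖ ^ (-(n / 2 : ℝ)) := by
    refine Real.rpow_le_rpow_of_nonpos (by positivity) ?_ (by
      have : (0 : ℝ) ≤ n / 2 := by positivity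
      linarith)
    nlinarith [Real.pi_gt_three]
  calc _ ≤ ‖(1 + Complex.I * τ : ℂ)‖ ^ (-(n / 2 : ℝ)) * 1 :=
        mul_le_mul h3 h2 (Real.exp_pos _).le (by positivity)
    _ = _ := mul_one _

lemma norm_heat_le_one (τ : ℝ) (x : Eu n) : ‖heat (1 + Complex.I * τ) x‖ ≤ 1 := by
  refine (norm_heat_le τ x).trans ?_
  refine Real.rpow_le_one_of_one_le_of_nonpos (one_le_norm_one_add_I_mul τ) ?_
  have : (0 : ℝ) ≤ n / 2 := by positivity
  linarith

/-- Differentiation gains a factor `|1 + iτ|⁻¹`, so that the decay is integrable already for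
`n = 1`. -/
lemma norm_heatDeriv_le (hn : 1 ≤ n) (τ : ℝ) (x : Eu n) :
    ‖heatDeriv τ x‖ ≤ (n / 2 + ‖x‖ ^ 2) * (1 + ‖τ‖ ^ 2) ^ (-(3 / 2 : ℝ) / 2) := by
  set r := ‖(1 + Complex.I * τ : ℂ)‖ with hr
  have h1 : 1 ≤ r := one_le_norm_one_add_I_mul τ
  have h0 : 0 < r := by linarith
  have h2 := norm_heat_le τ x
  rw [← hr] at h2
  have hr2 : r⁻¹ * r ^ (-(n / 2 : ℝ)) ≤ (1 + ‖τ‖ ^ 2) ^ (-(3 / 2 : ℝ) / 2) := by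
    have e1 : r⁻¹ * r ^ (-(n / 2 : ℝ)) = r ^ (-1 + -(n / 2 : ℝ)) := by
      rw [Real.rpow_add h0, Real.rpow_neg_one]
    have e2 : (1 + ‖τ‖ ^ 2) ^ (-(3 / 2 : ℝ) / 2) = r ^ (-(3 / 2) : ℝ) := by
      rw [hr, norm_one_add_I_mul, ← Real.rpow_mul (by positivity), Real.norm_eq_abs, sq_abs]
      norm_num
    rw [e1, e2]
    refine Real.rpow_le_rpow_of_exponent_le h1 ?_
    have : (1 : ℝ) ≤ n := by exact_mod_cast hn
    linarith
  rw [heatDeriv, norm_mul, norm_mul, Complex.norm_I, one_mul]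
  have h3 : ‖-(n / 2 : ℂ) / (1 + Complex.I * τ) +
      (‖x‖ : ℂ) ^ 2 / (4 * (1 + Complex.I * τ) ^ 2)‖ ≤ (n / 2 + ‖x‖ ^ 2) * r⁻¹ := by
    refine (norm_add_le _ _).trans ?_
    rw [norm_div, norm_div, norm_neg, norm_div, norm_mul, norm_pow, norm_pow, ← hr,
      Complex.norm_natCast, Complex.norm_real, norm_norm]
    simp only [Complex.norm_ofNat]
    rw [add_mul, ← div_eq_mul_inv, ← div_eq_mul_inv]
    gcongr
    nlinarith
  calc _ ≤ (n / 2 + ‖x‖ ^ 2) * r⁻¹ * r ^ (-(n / 2 : ℝ)) := by gcongr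
    _ = (n / 2 + ‖x‖ ^ 2) * (r⁻¹ * r ^ (-(n / 2 : ℝ))) := by ring
    _ ≤ _ := by gcongr

lemma integrable_heatDeriv_bound :
    Integrable (fun τ : ℝ => (1 + ‖τ‖ ^ 2) ^ (-(3 / 2 : ℝ) / 2)) :=
  integrable_rpow_neg_one_add_norm_sq (by norm_num)

lemma integrable_heatDeriv (hn : 1 ≤ n) (x : Eu n) : Integrable (fun τ : ℝ => heatDeriv τ x) := by
  refine (integrable_heatDeriv_bound.const_mul (n / 2 + ‖x‖ ^ 2)).mono' ?_
    (Eventually.of_forall fun τ => norm_heatDeriv_le hn τ x)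
  exact (measurable_heatDeriv.comp (measurable_id.prodMk measurable_const)).aestronglyMeasurable

/-! ### The outgoing fundamental solution of the Helmholtz equation -/

/-- The contribution of the real times `0 < s ≤ 1`. -/
def greenNear (z : ℂ) (x : Eu n) : ℂ := ∫ s in Set.Ioc (0 : ℝ) 1, Complex.exp (s * z) * heat (s : ℂ) x

/-- The contribution of the times `1 + iτ`, `τ > 0`, after an integration by parts. -/
def greenFar (z : ℂ) (x : Eu n) : ℂ :=
  ∫ τ in Set.Ioi (0 : ℝ), Complex.exp (Complex.I * z * τ) * heatDeriv τ x

/-- The convolution kernel of `(z + Δ)⁻¹`, for `z` with `0 ≤ Im z`.  Formally it is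
`-∫ e^{sz} heat s ds` along the path that runs from `0` to `1` and then from `1` to `1 + i∞`;
on the second half an integration by parts makes the integral absolutely convergent also for
real `z`. -/
def unitGreen (z : ℂ) (x : Eu n) : ℂ :=
  -greenNear z x + Complex.exp z / z * (heat 1 x + greenFar z x)

lemma norm_exp_I_mul (z : ℂ) (τ : ℝ) : ‖Complex.exp (Complex.I * z * τ)‖ = Real.exp (-(z.im) * τ) := by
  rw [Complex.norm_exp]
  congr 1
  simp

/-- Off the real axis the integration by parts behind `unitGreen` can be undone. -/
lemma heat_add_greenFar (hn : 1 ≤ n) {z : ℂ} (hz : 0 < z.im) (x : Eu n) :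
    heat 1 x + greenFar z x =
      -(Complex.I * z) * ∫ τ in Set.Ioi (0 : ℝ),
        Complex.exp (Complex.I * z * τ) * heat (1 + Complex.I * τ) x := by
  have hexp : ∀ τ : ℝ, HasDerivAt (fun τ : ℝ => Complex.exp (Complex.I * z * τ))
      (Complex.I * z * Complex.exp (Complex.I * z * τ)) τ := by
    intro τ
    have h1 : HasDerivAt (fun w : ℂ => Complex.I * z * w) (Complex.I * z) (τ : ℂ) := by
      simpa using (hasDerivAt_id (τ : ℂ)).const_mul (Complex.I * z)
    have := h1.cexp.comp_ofReal
    simpa [mul_comm] using this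
  have hre : (Complex.I * z).re < 0 := by simpa using hz
  have hI : IntegrableOn (fun τ : ℝ => Complex.exp (Complex.I * z * τ)) (Set.Ioi 0) :=
    integrableOn_exp_mul_complex_Ioi hre 0
  have hheat : Continuous (fun τ : ℝ => heat (1 + Complex.I * τ) x) :=
    continuous_iff_continuousAt.2 fun τ => (hasDerivAt_heat τ x).continuousAt
  have hdec : Tendsto (fun τ : ℝ => Complex.exp (Complex.I * z * τ)) atTop (𝓝 0) := by
    rw [tendsto_zero_iff_norm_tendsto_zero]
    simp_rw [norm_exp_I_mul]
    refine Real.tendsto_exp_atBot.comp ?_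
    exact tendsto_id.const_mul_atTop_of_neg (by linarith)
  have key := integral_Ioi_mul_deriv_eq_deriv_mul (a := 0)
    (u := fun τ : ℝ => Complex.exp (Complex.I * z * τ))
    (u' := fun τ : ℝ => Complex.I * z * Complex.exp (Complex.I * z * τ))
    (v := fun τ : ℝ => heat (1 + Complex.I * τ) x) (v' := fun τ : ℝ => heatDeriv τ x)
    (a' := heat 1 x) (b' := 0) (fun τ _ => hexp τ) (fun τ _ => hasDerivAt_heat τ x) ?_ ?_ ?_ ?_
  · rw [greenFar, key]
    simp_rw [mul_assoc (Complex.I * z)]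
    rw [integral_const_mul]
    ring
  · refine ((integrable_heatDeriv hn x).integrableOn (s := Set.Ioi 0)).bdd_mul (c := 1)
      (by fun_prop) ?_
    filter_upwards [ae_restrict_mem measurableSet_Ioi] with τ hτ
    rw [norm_exp_I_mul, Real.exp_le_one_iff]
    have : (0 : ℝ) < τ := hτ
    nlinarith
  · refine (hI.const_mul (Complex.I * z)).mul_bdd (c := 1) hheat.aestronglyMeasurable ?_
    exact Eventually.of_forall fun τ => norm_heat_le_one τ x
  · have : Continuous ((fun τ : ℝ => Complex.exp (Complex.I * z * τ)) *
        fun τ : ℝ => heat (1 + Complex.I * τ) x) :=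
      (continuous_iff_continuousAt.2 fun τ => (hexp τ).continuousAt).mul hheat
    have h0 := this.tendsto 0
    simp only [Pi.mul_apply, Complex.ofReal_zero, mul_zero, Complex.exp_zero, add_zero,
      one_mul] at h0
    exact h0.mono_left nhdsWithin_le_nhds
  · refine squeeze_zero_norm (fun τ => ?_) (tendsto_zero_iff_norm_tendsto_zero.1 hdec)
    rw [Pi.mul_apply, norm_mul]
    exact mul_le_of_le_one_right (norm_nonneg _) (norm_heat_le_one τ x)

lemma measurable_heat_ofReal_uncurry :
    Measurable (fun p : ℝ × Eu n => heat (p.1 : ℂ) p.2) :=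
  measurable_heat.comp ((Complex.measurable_ofReal.comp measurable_fst).prodMk measurable_snd)

lemma measurable_greenNear (z : ℂ) : Measurable (greenNear z : Eu n → ℂ) := by
  have h : Measurable (fun p : Eu n × ℝ => Complex.exp (p.2 * z) * heat (p.2 : ℂ) p.1) :=
    (by fun_prop : Measurable fun p : Eu n × ℝ => Complex.exp (p.2 * z)).mul
      (measurable_heat_ofReal_uncurry.comp measurable_swap)
  have h2 := (h.stronglyMeasurable.integral_prod_right'
    (ν := volume.restrict (Set.Ioc (0 : ℝ) 1))).measurable
  unfold greenNear
  exact h2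

lemma measurable_integral_exp_mul (z : ℂ) {g : ℝ → Eu n → ℂ}
    (hg : Measurable fun p : ℝ × Eu n => g p.1 p.2) :
    Measurable fun x : Eu n => ∫ τ in Set.Ioi (0 : ℝ), Complex.exp (Complex.I * z * τ) * g τ x := by
  have ha : Measurable fun p : ℝ × Eu n => Complex.exp (Complex.I * z * p.1) := by fun_prop
  exact ((ha.mul hg).stronglyMeasurable.integral_prod_left'
    (μ := volume.restrict (Set.Ioi (0 : ℝ)))).measurable

lemma measurable_greenFar (z : ℂ) : Measurable (greenFar z : Eu n → ℂ) :=
  measurable_integral_exp_mul z measurable_heatDeriv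

lemma measurable_unitGreen (z : ℂ) : Measurable (unitGreen z : Eu n → ℂ) :=
  (measurable_greenNear z).neg.add
    (((measurable_heat.comp (measurable_const.prodMk measurable_id)).add
      (measurable_greenFar z)).const_mul _)

/-- Off the real axis, `unitGreen z` is the kernel of `(z + Δ)⁻¹`. -/
lemma unitGreen_fourier (hn : 1 ≤ n) {z : ℂ} (hz : 0 < z.im) :
    Integrable (unitGreen z : Eu n → ℂ) ∧
    ∀ ζ : Eu n, 𝓕 (unitGreen z : Eu n → ℂ) ζ = (z - (‖(2 * Real.pi) • ζ‖ : ℂ) ^ 2)⁻¹ := by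
  have hz0 : z ≠ 0 := by rintro rfl; simp at hz
  have near_int : Integrable (fun s : ℝ => ‖Complex.exp (s * z)‖ *
      (‖(s : ℂ)‖ / (s : ℂ).re) ^ (n / 2 : ℝ)) (volume.restrict (Set.Ioc (0 : ℝ) 1)) := by
    have hc : Integrable (fun s : ℝ => ‖Complex.exp (s * z)‖)
        (volume.restrict (Set.Ioc (0 : ℝ) 1)) :=
      Continuous.integrableOn_Ioc (by fun_prop)
    refine hc.congr ?_
    filter_upwards [ae_restrict_mem measurableSet_Ioc] with s hs
    have : (‖(s : ℂ)‖ / (s : ℂ).re) = 1 := by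
      rw [Complex.norm_real, Complex.ofReal_re, Real.norm_of_nonneg hs.1.le,
        div_self hs.1.ne']
    rw [this, Real.one_rpow, mul_one]
  have near_pos : ∀ᵐ s : ℝ ∂(volume.restrict (Set.Ioc (0 : ℝ) 1)), 0 < (s : ℂ).re := by
    filter_upwards [ae_restrict_mem measurableSet_Ioc] with s hs
    simpa using hs.1
  have near_c : Measurable fun s : ℝ => Complex.exp (s * z) := by fun_prop
  have near := heat_superposition (n := n) near_c Complex.measurable_ofReal near_pos near_int
  have far_int : Integrable (fun τ : ℝ => ‖Complex.exp (Complex.I * z * τ)‖ *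
      (‖(1 + Complex.I * τ : ℂ)‖ / (1 + Complex.I * τ : ℂ).re) ^ (n / 2 : ℝ))
      (volume.restrict (Set.Ioi (0 : ℝ))) := by
    have hn' : (0 : ℝ) < n := by exact_mod_cast hn
    -- the growth of `|1 + iτ|^{n/2}` is absorbed by half of the exponential decay
    set a : ℝ := z.im / n with ha
    have ha0 : 0 < a := by positivity
    have hdom := (exp_neg_integrableOn_Ioi 0 (half_pos hz)).const_mul ((1 + a⁻¹) ^ (n / 2 : ℝ))
    refine Integrable.mono' hdom ?_ ?_
    · refine Measurable.aestronglyMeasurable ?_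
      fun_prop
    · filter_upwards [ae_restrict_mem measurableSet_Ioi] with τ hτ
      have hτ' : 0 < τ := hτ
      rw [one_add_I_mul_re, div_one, Real.norm_of_nonneg (by positivity), norm_exp_I_mul]
      have h1 : ‖(1 + Complex.I * τ : ℂ)‖ ≤ (1 + a⁻¹) * Real.exp (a * τ) := by
        have e1 : ‖(1 + Complex.I * τ : ℂ)‖ ≤ 1 + τ := by
          refine (norm_add_le _ _).trans ?_
          simp [abs_of_pos hτ']
        have e2 : 1 + τ ≤ (1 + a⁻¹) * (a * τ + 1) := by
          have : (1 + a⁻¹) * (a * τ + 1) = a * τ + 1 + τ + a⁻¹ := by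
            field_simp; ring
          rw [this]
          have : 0 < a * τ := by positivity
          have : 0 < a⁻¹ := by positivity
          linarith
        exact e1.trans (e2.trans (by gcongr; exact Real.add_one_le_exp _))
      calc Real.exp (-z.im * τ) * ‖(1 + Complex.I * τ : ℂ)‖ ^ (n / 2 : ℝ)
          ≤ Real.exp (-z.im * τ) * ((1 + a⁻¹) * Real.exp (a * τ)) ^ (n / 2 : ℝ) := by gcongr
        _ = (1 + a⁻¹) ^ (n / 2 : ℝ) * (Real.exp (-z.im * τ) * Real.exp (z.im / 2 * τ)) := by
            rw [Real.mul_rpow (by positivity) (by positivity), ← Real.exp_mul]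
            have : a * τ * (n / 2) = z.im / 2 * τ := by rw [ha]; field_simp
            rw [this]; ring
        _ = _ := by rw [← Real.exp_add]; congr 2; ring
  have far_c : Measurable fun τ : ℝ => Complex.exp (Complex.I * z * τ) := by fun_prop
  have far_p : Measurable fun τ : ℝ => (1 + Complex.I * τ : ℂ) := by fun_prop
  have far := heat_superposition (n := n) far_c far_p
    (Eventually.of_forall fun τ => by rw [one_add_I_mul_re]; exact one_pos) far_int
  have hform : (unitGreen z : Eu n → ℂ) = fun x => -greenNear z x +
      (-(Complex.I * Complex.exp z)) * ∫ τ in Set.Ioi (0 : ℝ),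
        Complex.exp (Complex.I * z * τ) * heat (1 + Complex.I * τ) x := by
    ext x
    rw [unitGreen, heat_add_greenFar hn hz]
    field_simp
  rw [hform]
  have i1 : Integrable (fun x : Eu n => -greenNear z x) := near.1.neg
  have i2 := far.1.const_mul (-(Complex.I * Complex.exp z))
  refine ⟨i1.add i2, fun ζ => ?_⟩
  set w : ℂ := z - (‖(2 * Real.pi) • ζ‖ : ℂ) ^ 2 with hw
  have hwim : w.im = z.im := by
    rw [hw, Complex.sub_im, ← Complex.ofReal_pow, Complex.ofReal_im, sub_zero]
  have hw0 : w ≠ 0 := by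
    intro h
    rw [h] at hwim
    simp at hwim
    linarith
  have f1 : 𝓕 (fun x : Eu n => -greenNear z x + (-(Complex.I * Complex.exp z)) *
      ∫ τ in Set.Ioi (0 : ℝ), Complex.exp (Complex.I * z * τ) * heat (1 + Complex.I * τ) x) ζ =
      -𝓕 (fun x : Eu n => ∫ s in Set.Ioc (0 : ℝ) 1, Complex.exp (s * z) * heat (s : ℂ) x) ζ +
      (-(Complex.I * Complex.exp z)) * 𝓕 (fun x : Eu n => ∫ τ in Set.Ioi (0 : ℝ),
        Complex.exp (Complex.I * z * τ) * heat (1 + Complex.I * τ) x) ζ := by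
    simp only [Real.fourier_eq]
    rw [← integral_const_mul, ← integral_neg, ← integral_add]
    · refine integral_congr_ae (Eventually.of_forall fun x => ?_)
      simp only [Circle.smul_def, smul_eq_mul, greenNear]
      ring
    · exact ((Real.fourierIntegral_convergent_iff ζ).2 near.1).neg
    · exact ((Real.fourierIntegral_convergent_iff ζ).2 far.1).const_mul _
  rw [f1, near.2, far.2]
  -- the two halves of the path contribute `(1 - e^w)/w` and `e^w/w`
  have c1 : ∀ s : ℝ, Complex.exp (s * z) * Complex.exp (-(s * (‖(2 * Real.pi) • ζ‖ : ℂ) ^ 2)) =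
      Complex.exp (w * s) := fun s => by
    rw [← Complex.exp_add, hw]; congr 1; ring
  have c2 : ∀ τ : ℝ, Complex.exp (Complex.I * z * τ) *
      Complex.exp (-((1 + Complex.I * τ) * (‖(2 * Real.pi) • ζ‖ : ℂ) ^ 2)) =
      Complex.exp (-(‖(2 * Real.pi) • ζ‖ : ℂ) ^ 2) * Complex.exp (Complex.I * w * τ) := fun τ => by
    rw [← Complex.exp_add, ← Complex.exp_add, hw]; congr 1; ring
  simp_rw [c1, c2]
  rw [integral_const_mul, ← intervalIntegral.integral_of_le zero_le_one, integral_exp_mul_complex hw0,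
    integral_exp_mul_complex_Ioi (by simpa [hwim] using hz)]
  have c3 : Complex.exp z * Complex.exp (-(‖(2 * Real.pi) • ζ‖ : ℂ) ^ 2) = Complex.exp w := by
    rw [← Complex.exp_add, hw]; congr 1
  simp only [Complex.ofReal_one, Complex.ofReal_zero, mul_one, mul_zero, Complex.exp_zero]
  have c4 : -(Complex.I * Complex.exp z) * (Complex.exp (-(‖(2 * Real.pi) • ζ‖ : ℂ) ^ 2) *
      (-1 / (Complex.I * w))) = Complex.exp w / w := by
    rw [← c3]
    field_simp
  rw [c4]
  field_simp
  ring

/-! ### Bounds for the fundamental solution -/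

lemma rpow_le_mul_exp {b y : ℝ} (hb : 0 ≤ b) (hy : 0 ≤ y) :
    y ^ b ≤ (b + 1) ^ b * Real.exp y := by
  have h1 : y ≤ (b + 1) * Real.exp (y / (b + 1)) := by
    have := Real.add_one_le_exp (y / (b + 1))
    calc y = (b + 1) * (y / (b + 1)) := by field_simp
      _ ≤ _ := by gcongr; linarith
  calc y ^ b ≤ ((b + 1) * Real.exp (y / (b + 1))) ^ b := by gcongr
    _ = (b + 1) ^ b * Real.exp (y * (b / (b + 1))) := by
        rw [Real.mul_rpow (by positivity) (by positivity), ← Real.exp_mul]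
        congr 2
        ring
    _ ≤ _ := by
        gcongr
        exact mul_le_of_le_one_right hy (by rw [div_le_one (by positivity)]; linarith)

/-- The heat kernel is dominated by a power of `‖x‖`, at the price of a power of the time. -/
lemma norm_heat_real_le {σ : ℝ} (hσ : 0 ≤ σ) :
    ∃ C : ℝ, 0 < C ∧ ∀ (s : ℝ) (x : Eu n), 0 < s → x ≠ 0 →
      ‖heat (s : ℂ) x‖ ≤ C * ‖x‖ ^ (-σ) * s ^ (σ / 2 - n / 2) := by
  refine ⟨(4 * Real.pi) ^ (-(n / 2 : ℝ)) * ((σ / 2 + 1) ^ (σ / 2) * 4 ^ (σ / 2)), by positivity,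
    fun s x hs hx => ?_⟩
  have hx0 : 0 < ‖x‖ := norm_pos_iff.2 hx
  rw [norm_heat, Complex.norm_real, Real.norm_of_nonneg hs.le, Complex.ofReal_re]
  set y : ℝ := ‖x‖ ^ 2 / (4 * s) with hy
  have hy0 : 0 < y := by positivity
  have e1 : -‖x‖ ^ 2 / 4 * (s / s ^ 2) = -y := by rw [hy]; field_simp
  have e2 : Real.exp (-y) ≤ (σ / 2 + 1) ^ (σ / 2) * y ^ (-(σ / 2)) := by
    have := rpow_le_mul_exp (b := σ / 2) (by positivity) hy0.le
    rw [Real.exp_neg, Real.rpow_neg hy0.le, ← div_eq_mul_inv, le_div_iff₀ (by positivity),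
      ← div_eq_inv_mul, div_le_iff₀ (Real.exp_pos _)]
    exact this
  have e3 : y ^ (-(σ / 2)) = 4 ^ (σ / 2) * s ^ (σ / 2) * ‖x‖ ^ (-σ) := by
    rw [hy, Real.div_rpow (by positivity) (by positivity), ← Real.rpow_natCast,
      ← Real.rpow_mul (norm_nonneg x), Real.rpow_neg (by positivity : (0 : ℝ) ≤ 4 * s),
      Real.mul_rpow (by norm_num) hs.le, div_inv_eq_mul]
    have : ((2 : ℕ) : ℝ) * -(σ / 2) = -σ := by push_cast; ring
    rw [this]; ring
  have e4 : s ^ (σ / 2 - n / 2) = s ^ (σ / 2) * s ^ (-(n / 2 : ℝ)) := by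
    rw [← Real.rpow_add hs]; rfl
  rw [e1, Real.mul_rpow (by positivity) hs.le, e4]
  calc _ ≤ (4 * Real.pi) ^ (-(n / 2 : ℝ)) * s ^ (-(n / 2 : ℝ)) *
        ((σ / 2 + 1) ^ (σ / 2) * y ^ (-(σ / 2))) := by gcongr
    _ = _ := by rw [e3]; ring

lemma integrableOn_rpow_Ioc {r : ℝ} (hr : -1 < r) :
    IntegrableOn (fun s : ℝ => s ^ r) (Set.Ioc 0 1) := by
  have := intervalIntegral.intervalIntegrable_rpow' (a := 0) (b := 1) hr
  rwa [intervalIntegrable_iff_integrableOn_Ioc_of_le zero_le_one] at this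

lemma integrable_heat_time (hn : 1 ≤ n) {x : Eu n} (hx : x ≠ 0) :
    IntegrableOn (fun s : ℝ => heat (s : ℂ) x) (Set.Ioc 0 1) := by
  obtain ⟨C, hC, h⟩ := norm_heat_real_le (n := n) (σ := n) (by positivity)
  have hr : (-1 : ℝ) < (n : ℝ) / 2 - n / 2 := by norm_num
  refine ((integrableOn_rpow_Ioc hr).const_mul (C * ‖x‖ ^ (-(n : ℝ)))).mono' ?_ ?_
  · exact (measurable_heat_ofReal_uncurry.comp
      (measurable_id.prodMk measurable_const)).aestronglyMeasurable
  · filter_upwards [ae_restrict_mem measurableSet_Ioc] with s hs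
    exact h s x hs.1 hx

lemma norm_exp_real_mul (ε s : ℝ) :
    ‖Complex.exp (s * (1 + Complex.I * ε))‖ = Real.exp s := by
  rw [Complex.norm_exp]
  simp

lemma norm_exp_mul_le (ε : ℝ) {s : ℝ} (hs : s ≤ 1) :
    ‖Complex.exp (s * (1 + Complex.I * ε))‖ ≤ Real.exp 1 := by
  rw [norm_exp_real_mul]
  exact Real.exp_le_exp.2 hs

lemma norm_exp_I_mul_le_one {ε τ : ℝ} (hε : 0 ≤ ε) (hτ : 0 < τ) :
    ‖Complex.exp (Complex.I * (1 + Complex.I * ε) * τ)‖ ≤ 1 := by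
  rw [norm_exp_I_mul, Real.exp_le_one_iff]
  have : (1 + Complex.I * ε : ℂ).im = ε := by simp
  rw [this]
  nlinarith

/-- The small times produce the singularity at the origin; the contribution of the times `1 + iτ`
is locally bounded. -/
lemma norm_unitGreen_le (hn : 1 ≤ n) {σ : ℝ} (hσ : 0 ≤ σ) (hσn : (n : ℝ) - 2 < σ) :
    ∃ C : ℝ, 0 < C ∧ ∀ (ε : ℝ) (x : Eu n), 0 ≤ ε → x ≠ 0 →
      ‖unitGreen (1 + Complex.I * ε) x‖ ≤ C * (‖x‖ ^ (-σ) + (1 + ‖x‖ ^ 2)) := by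
  obtain ⟨C, hC, h⟩ := norm_heat_real_le (n := n) hσ
  have hr : (-1 : ℝ) < σ / 2 - n / 2 := by linarith
  set A : ℝ := ∫ s in Set.Ioc (0 : ℝ) 1, s ^ (σ / 2 - n / 2) with hA
  set J : ℝ := ∫ τ : ℝ, (1 + ‖τ‖ ^ 2) ^ (-(3 / 2 : ℝ) / 2) with hJ
  have hA0 : 0 ≤ A := integral_nonneg_of_ae (by
    filter_upwards [ae_restrict_mem measurableSet_Ioc] with s hs
    exact Real.rpow_nonneg hs.1.le _)
  have hJ0 : 0 ≤ J := integral_nonneg fun τ => by positivity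
  set D : ℝ := Real.exp 1 * (C * A + 1 + (n / 2 + 1) * J) with hD
  refine ⟨D, by positivity, fun ε x hε hx => ?_⟩
  have hx0 : 0 < ‖x‖ := norm_pos_iff.2 hx
  have near : ‖greenNear (1 + Complex.I * ε) x‖ ≤ Real.exp 1 * (C * A) * ‖x‖ ^ (-σ) := by
    rw [greenNear]
    have hdom := (integrableOn_rpow_Ioc hr).const_mul (Real.exp 1 * (C * ‖x‖ ^ (-σ)))
    refine (norm_integral_le_of_norm_le hdom ?_).trans (le_of_eq ?_)
    · filter_upwards [ae_restrict_mem measurableSet_Ioc] with s hs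
      rw [norm_mul]
      calc _ ≤ Real.exp 1 * (C * ‖x‖ ^ (-σ) * s ^ (σ / 2 - n / 2)) :=
            mul_le_mul (norm_exp_mul_le ε hs.2) (h s x hs.1 hx) (norm_nonneg _) (by positivity)
        _ = _ := by ring
    · rw [integral_const_mul, ← hA]; ring
  have far : ‖greenFar (1 + Complex.I * ε) x‖ ≤ (n / 2 + ‖x‖ ^ 2) * J := by
    rw [greenFar]
    have hdom := (integrable_heatDeriv_bound.const_mul (n / 2 + ‖x‖ ^ 2))
    refine (norm_integral_le_of_norm_le hdom.integrableOn ?_).trans ?_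
    · filter_upwards [ae_restrict_mem measurableSet_Ioi] with τ hτ
      rw [norm_mul]
      calc _ ≤ 1 * ((n / 2 + ‖x‖ ^ 2) * (1 + ‖τ‖ ^ 2) ^ (-(3 / 2 : ℝ) / 2)) :=
            mul_le_mul (norm_exp_I_mul_le_one hε hτ) (norm_heatDeriv_le hn τ x) (norm_nonneg _)
              zero_le_one
        _ = _ := one_mul _
    · rw [integral_const_mul]
      refine mul_le_mul_of_nonneg_left ?_ (by positivity)
      exact setIntegral_le_integral integrable_heatDeriv_bound
        (Eventually.of_forall fun τ => by positivity)
  have h1 : ‖(heat 1 x : ℂ)‖ ≤ 1 := by simpa using norm_heat_le_one 0 x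
  have h2 : ‖Complex.exp (1 + Complex.I * ε) / (1 + Complex.I * ε)‖ ≤ Real.exp 1 := by
    rw [norm_div]
    have := norm_exp_real_mul ε 1
    rw [Complex.ofReal_one, one_mul] at this
    rw [this]
    exact div_le_self (Real.exp_pos _).le (one_le_norm_one_add_I_mul ε)
  rw [unitGreen]
  have hX : 0 ≤ ‖x‖ ^ (-σ) := by positivity
  have hn0 : (0 : ℝ) ≤ n := by positivity
  calc _ ≤ ‖greenNear (1 + Complex.I * ε) x‖ + Real.exp 1 * (1 + (n / 2 + ‖x‖ ^ 2) * J) := by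
        refine (norm_add_le _ _).trans ?_
        rw [norm_neg, norm_mul]
        gcongr
        exact (norm_add_le _ _).trans (add_le_add h1 far)
    _ ≤ Real.exp 1 * (C * A) * ‖x‖ ^ (-σ) + Real.exp 1 * (1 + (n / 2 + ‖x‖ ^ 2) * J) := by
        gcongr
    _ ≤ D * ‖x‖ ^ (-σ) + D * (1 + ‖x‖ ^ 2) := by
        have hCA : 0 ≤ C * A := by positivity
        refine add_le_add ?_ ?_
        · refine mul_le_mul_of_nonneg_right ?_ hX
          rw [hD]
          refine mul_le_mul_of_nonneg_left ?_ (Real.exp_pos _).le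
          have : 0 ≤ (n / 2 + 1) * J := by positivity
          linarith
        · rw [hD, mul_assoc]
          refine mul_le_mul_of_nonneg_left ?_ (Real.exp_pos _).le
          have a1 : (n / 2 + ‖x‖ ^ 2) * J ≤ (n / 2 + 1) * J * (1 + ‖x‖ ^ 2) := by
            have : 0 ≤ J * (n / 2 * ‖x‖ ^ 2 + 1) := by positivity
            nlinarith
          have a2 : 0 ≤ (C * A + 1) * ‖x‖ ^ 2 := by positivity
          nlinarith
    _ = _ := by ring

/-- The limiting absorption principle for the kernels. -/
lemma tendsto_unitGreen (hn : 1 ≤ n) {x : Eu n} (hx : x ≠ 0) :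
    Tendsto (fun ε : ℝ => unitGreen (1 + Complex.I * ε) x) (𝓝[>] 0) (𝓝 (unitGreen 1 x)) := by
  have hz : Tendsto (fun ε : ℝ => (1 + Complex.I * ε : ℂ)) (𝓝[>] 0) (𝓝 1) := by
    have : Continuous fun ε : ℝ => (1 + Complex.I * ε : ℂ) := by fun_prop
    have h := this.tendsto 0
    simp only [Complex.ofReal_zero, mul_zero, add_zero] at h
    exact h.mono_left nhdsWithin_le_nhds
  have near : Tendsto (fun ε : ℝ => greenNear (1 + Complex.I * ε) x) (𝓝[>] 0)
      (𝓝 (greenNear 1 x)) := by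
    unfold greenNear
    refine tendsto_integral_filter_of_dominated_convergence
      (fun s => Real.exp 1 * ‖heat (s : ℂ) x‖) ?_ ?_ ?_ ?_
    · refine Eventually.of_forall fun ε => ?_
      have hc : Continuous fun s : ℝ => Complex.exp (s * (1 + Complex.I * ε)) := by fun_prop
      exact hc.aestronglyMeasurable.mul (integrable_heat_time hn hx).aestronglyMeasurable
    · refine Eventually.of_forall fun ε => ?_
      filter_upwards [ae_restrict_mem measurableSet_Ioc] with s hs
      rw [norm_mul]
      exact mul_le_mul_of_nonneg_right (norm_exp_mul_le ε hs.2) (norm_nonneg _)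
    · exact (integrable_heat_time hn hx).norm.const_mul _
    · refine Eventually.of_forall fun s => ?_
      exact ((Complex.continuous_exp.tendsto _).comp (hz.const_mul (s : ℂ))).mul_const _
  have far : Tendsto (fun ε : ℝ => greenFar (1 + Complex.I * ε) x) (𝓝[>] 0)
      (𝓝 (greenFar 1 x)) := by
    unfold greenFar
    refine tendsto_integral_filter_of_dominated_convergence
      (fun τ => ‖heatDeriv τ x‖) ?_ ?_ ?_ ?_
    · refine Eventually.of_forall fun ε => ?_
      have hc : Continuous fun τ : ℝ => Complex.exp (Complex.I * (1 + Complex.I * ε) * τ) := by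
        fun_prop
      exact hc.aestronglyMeasurable.mul (integrable_heatDeriv hn x).integrableOn.aestronglyMeasurable
    · filter_upwards [self_mem_nhdsWithin] with ε hε
      filter_upwards [ae_restrict_mem measurableSet_Ioi] with τ hτ
      rw [norm_mul]
      exact mul_le_of_le_one_left (norm_nonneg _) (norm_exp_I_mul_le_one (le_of_lt hε) hτ)
    · exact (integrable_heatDeriv hn x).norm.integrableOn
    · refine Eventually.of_forall fun τ => ?_
      exact ((Complex.continuous_exp.tendsto _).comp
        ((hz.const_mul Complex.I).mul_const (τ : ℂ))).mul_const _
  unfold unitGreen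
  refine near.neg.add (Tendsto.mul ?_ (tendsto_const_nhds.add far))
  exact ((Complex.continuous_exp.tendsto 1).comp hz).div hz one_ne_zero

/-- The convolution kernel of `(Δ + k² + iε)⁻¹`, obtained from `unitGreen` by scaling. -/
def green (k ε : ℝ) (x : Eu n) : ℂ :=
  ((k ^ n / k ^ 2 : ℝ) : ℂ) * unitGreen (1 + Complex.I * ((ε / k ^ 2 : ℝ) : ℂ)) (k • x)

lemma measurable_green (k ε : ℝ) : Measurable (green k ε : Eu n → ℂ) :=
  ((measurable_unitGreen _).comp (measurable_const_smul k)).const_mul _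

/-- The outgoing fundamental solution depends measurably on the wave number as well. -/
lemma measurable_green_zero : Measurable (fun p : ℝ × Eu n => green p.1 0 p.2) := by
  have h1 : Measurable fun p : ℝ × Eu n => (p.1 ^ n / p.1 ^ 2 : ℝ) := by fun_prop
  have h2 : Measurable fun p : ℝ × Eu n => p.1 • p.2 := by fun_prop
  have h3 := (Complex.measurable_ofReal.comp h1).mul
    ((measurable_unitGreen (1 + Complex.I * ((0 : ℝ) : ℂ))).comp h2)
  unfold green
  simp only [zero_div]
  exact h3

lemma tendsto_green (hn : 1 ≤ n) {k : ℝ} (hk : 0 < k) {x : Eu n} (hx : x ≠ 0) :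
    Tendsto (fun ε : ℝ => green k ε x) (𝓝[>] 0) (𝓝 (green k 0 x)) := by
  unfold green
  have h0 : (1 + Complex.I * ((0 / k ^ 2 : ℝ) : ℂ)) = 1 := by simp
  rw [h0]
  refine Tendsto.const_mul _ ?_
  have h1 : Tendsto (fun ε : ℝ => ε / k ^ 2) (𝓝[>] 0) (𝓝[>] 0) := by
    refine tendsto_nhdsWithin_iff.2 ⟨?_, ?_⟩
    · have : Continuous fun ε : ℝ => ε / k ^ 2 := by fun_prop
      simpa using (this.tendsto 0).mono_left (nhdsWithin_le_nhds (s := Set.Ioi 0))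
    · filter_upwards [self_mem_nhdsWithin] with ε hε
      have hε' : 0 < ε := hε
      exact Set.mem_Ioi.2 (by positivity)
  exact (tendsto_unitGreen hn (smul_ne_zero hk.ne' hx)).comp h1

/-- For `ε > 0` the kernel has the Fourier transform of the resolvent at `k² + iε`. -/
lemma green_fourier (hn : 1 ≤ n) {k ε : ℝ} (hk : 0 < k) (hε : 0 < ε) :
    Integrable (green k ε : Eu n → ℂ) ∧
    ∀ ζ : Eu n, 𝓕 (green k ε : Eu n → ℂ) ζ =
      ((k : ℂ) ^ 2 - (‖(2 * Real.pi) • ζ‖ : ℂ) ^ 2 + (ε : ℂ) * Complex.I)⁻¹ := by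
  set z : ℂ := 1 + Complex.I * ((ε / k ^ 2 : ℝ) : ℂ) with hz
  have hzim : 0 < z.im := by
    have : z.im = ε / k ^ 2 := by
      rw [hz, Complex.add_im, Complex.I_mul_im, Complex.ofReal_re, Complex.one_im, zero_add]
    rw [this]; positivity
  obtain ⟨h1, h2⟩ := unitGreen_fourier (n := n) hn hzim
  refine ⟨((integrable_comp_smul_iff volume _ hk.ne').2 h1).const_mul _, fun ζ => ?_⟩
  have hkc : (k : ℂ) ≠ 0 := by exact_mod_cast hk.ne'
  have h3 : 𝓕 (green k ε : Eu n → ℂ) ζ =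
      ((k ^ n / k ^ 2 : ℝ) : ℂ) * (((k ^ n)⁻¹ : ℝ) • 𝓕 (unitGreen z : Eu n → ℂ) (k⁻¹ • ζ)) := by
    rw [Real.fourier_eq, Real.fourier_eq]
    have := Measure.integral_comp_smul_of_nonneg volume
      (fun v : Eu n => Real.fourierChar (-inner ℝ v (k⁻¹ • ζ)) • unitGreen z v) k (hR := hk.le)
    rw [finrank_euclideanSpace_fin] at this
    rw [← this, ← integral_const_mul]
    refine integral_congr_ae (Eventually.of_forall fun v => ?_)
    simp only [green, Circle.smul_def, smul_eq_mul, ← hz]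
    rw [real_inner_smul_left, real_inner_smul_right, mul_inv_cancel_left₀ hk.ne']
    ring
  rw [h3, h2, Complex.real_smul]
  have h4 : (‖(2 * Real.pi) • k⁻¹ • ζ‖ : ℂ) = (‖(2 * Real.pi) • ζ‖ : ℂ) / k := by
    rw [smul_comm, norm_smul, norm_inv, Real.norm_of_nonneg hk.le]
    push_cast
    field_simp
  rw [h4]
  have h5 : (k : ℂ) ^ 2 - (‖(2 * Real.pi) • ζ‖ : ℂ) ^ 2 + (ε : ℂ) * Complex.I =
      (k : ℂ) ^ 2 * (z - ((‖(2 * Real.pi) • ζ‖ : ℂ) / k) ^ 2) := by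
    rw [hz]
    push_cast
    field_simp
    ring
  rw [h5, mul_inv]
  push_cast
  field_simp

/-- A bound for the fundamental solution that is uniform in `ε`. -/
lemma norm_green_le (hn : 1 ≤ n) {σ : ℝ} (hσ : 0 ≤ σ) (hσn : (n : ℝ) - 2 < σ) :
    ∃ C : ℝ, 0 < C ∧ ∀ (k ε : ℝ) (x : Eu n), 0 < k → 0 ≤ ε → x ≠ 0 →
      ‖green k ε x‖ ≤ C * (k ^ n / k ^ 2) * (k ^ (-σ) * ‖x‖ ^ (-σ) + (1 + k ^ 2 * ‖x‖ ^ 2)) := by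
  obtain ⟨C, hC, h⟩ := norm_unitGreen_le hn hσ hσn
  refine ⟨C, hC, fun k ε x hk hε hx => ?_⟩
  rw [green, norm_mul, Complex.norm_real, Real.norm_of_nonneg (by positivity)]
  have := h (ε / k ^ 2) (k • x) (by positivity) (smul_ne_zero hk.ne' hx)
  rw [norm_smul, Real.norm_of_nonneg hk.le, Real.mul_rpow hk.le (norm_nonneg _), mul_pow] at this
  calc _ ≤ k ^ n / k ^ 2 * (C * (k ^ (-σ) * ‖x‖ ^ (-σ) + (1 + k ^ 2 * ‖x‖ ^ 2))) := by gcongr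
    _ = _ := by ring

/-! ### The outgoing resolvent as a convolution operator -/

/-- Up to a constant, this dominates the fundamental solutions `green k ε`, uniformly in `ε`. The
exponent `n - 1/2` lies between `n - 2` and `n`, hence is admissible in `norm_green_le` and locally
integrable. -/
def greenMajorant (x : Eu n) : ℝ := ‖x‖ ^ (-((n : ℝ) - 1 / 2)) + (1 + ‖x‖ ^ 2)

lemma greenMajorant_nonneg (x : Eu n) : 0 ≤ greenMajorant x := by
  unfold greenMajorant
  positivity

lemma measurable_greenMajorant : Measurable (greenMajorant : Eu n → ℝ) := by
  unfold greenMajorant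
  fun_prop

lemma ae_ne_zero (hn : 1 ≤ n) : ∀ᵐ x : Eu n, x ≠ 0 := by
  have : Nonempty (Fin n) := ⟨⟨0, hn⟩⟩
  have : Nontrivial (Eu n) := inferInstance
  exact Measure.ae_ne volume 0

/-- The weight compensates the quadratic growth of the majorant at infinity. -/
lemma integrable_greenMajorant (hn : 1 ≤ n) :
    Integrable (fun x : Eu n => greenMajorant x * ((1 + ‖x‖) ^ (n + 3))⁻¹) := by
  have hmeas : Measurable (fun x : Eu n => greenMajorant x * ((1 + ‖x‖) ^ (n + 3))⁻¹) :=
    measurable_greenMajorant.mul (by fun_prop)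
  have hn' : (1 : ℝ) ≤ n := by exact_mod_cast hn
  have h1 : IntegrableOn (fun x : Eu n => greenMajorant x * ((1 + ‖x‖) ^ (n + 3))⁻¹)
      (Metric.ball 0 1) := by
    refine integrableOn_ball_of_norm_le_rpow (C := 3) (α := (n : ℝ) - 1 / 2) (by simpa using hn)
      (by simp) ?_ hmeas.aestronglyMeasurable
    filter_upwards [ae_restrict_mem Metric.isOpen_ball.measurableSet,
      ae_restrict_of_ae (ae_ne_zero hn)] with x hx hx0
    have hx1 : ‖x‖ < 1 := by simpa using hx
    have hx2 : 0 < ‖x‖ := norm_pos_iff.2 hx0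
    rw [Real.norm_of_nonneg (mul_nonneg (greenMajorant_nonneg x) (by positivity))]
    have e1 : ((1 + ‖x‖) ^ (n + 3))⁻¹ ≤ 1 :=
      inv_le_one_of_one_le₀ (one_le_pow₀ (by linarith))
    have e2 : 1 ≤ ‖x‖ ^ (-((n : ℝ) - 1 / 2)) :=
      Real.one_le_rpow_of_pos_of_le_one_of_nonpos hx2 hx1.le (by linarith)
    refine (mul_le_of_le_one_right (greenMajorant_nonneg x) e1).trans ?_
    unfold greenMajorant
    nlinarith
  have h2 : IntegrableOn (fun x : Eu n => greenMajorant x * ((1 + ‖x‖) ^ (n + 3))⁻¹)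
      (Metric.ball 0 1)ᶜ := by
    have hdom : Integrable (fun x : Eu n => 2 * (1 + ‖x‖) ^ (-((n : ℝ) + 1))) :=
      (integrable_one_add_norm (by simp)).const_mul 2
    refine hdom.integrableOn.mono' hmeas.aestronglyMeasurable ?_
    filter_upwards [ae_restrict_mem Metric.isOpen_ball.measurableSet.compl] with x hx
    have hx1 : 1 ≤ ‖x‖ := by simpa using hx
    rw [Real.norm_of_nonneg (mul_nonneg (greenMajorant_nonneg x) (by positivity))]
    have e1 : ‖x‖ ^ (-((n : ℝ) - 1 / 2)) ≤ 1 :=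
      Real.rpow_le_one_of_one_le_of_nonpos hx1 (by linarith)
    have e2 : greenMajorant x ≤ 2 * (1 + ‖x‖) ^ 2 := by
      unfold greenMajorant
      nlinarith
    have e3 : (1 + ‖x‖) ^ (-((n : ℝ) + 1)) = (1 + ‖x‖) ^ 2 * ((1 + ‖x‖) ^ (n + 3))⁻¹ := by
      rw [Real.rpow_neg (by positivity)]
      have : ((n : ℝ) + 1) = ((n + 1 : ℕ) : ℝ) := by push_cast; rfl
      rw [this, Real.rpow_natCast]
      field_simp
      ring
    rw [e3, ← mul_assoc]
    gcongr
  simpa using h1.union h2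

/-- The hypotheses under which `∫ g · (K * f)` can be computed by Fubini's theorem. -/
structure PairingData (A R C : ℝ) (K f g : Eu n → ℂ) : Prop where
  nonneg : 0 ≤ A ∧ 0 ≤ R ∧ 0 ≤ C
  kernel_meas : AEStronglyMeasurable K volume
  kernel_le : ∀ x, x ≠ 0 → ‖K x‖ ≤ A * greenMajorant x
  integrable : Integrable f
  supp : SupportedIn R f
  weight_meas : Continuous g
  weight_le : ∀ x, ‖g x‖ ≤ C * ((1 + ‖x‖) ^ (n + 3))⁻¹

/-- The integrand after the change of variables `(x, y) ↦ (x - y, y)`. -/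
def pairing (K f g : Eu n → ℂ) (p : Eu n × Eu n) : ℂ := g (p.1 + p.2) * (K p.1 * f p.2)

/-- An integrable majorant of `pairing`. -/
def pairingMajorant (A R C : ℝ) (f : Eu n → ℂ) (p : Eu n × Eu n) : ℝ :=
  (A * C * (1 + R) ^ (n + 3)) * ((greenMajorant p.1 * ((1 + ‖p.1‖) ^ (n + 3))⁻¹) * ‖f p.2‖)

lemma integrable_pairingMajorant (hn : 1 ≤ n) (A R C : ℝ) {f : Eu n → ℂ} (hf : Integrable f) :
    Integrable (pairingMajorant A R C f) (volume.prod volume) :=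
  ((integrable_greenMajorant hn).mul_prod hf.norm).const_mul _

namespace PairingData

variable {A R C : ℝ} {K f g : Eu n → ℂ}

/-- As `f` has bounded support, the decay of the weight in `p.1 + p.2` is a decay in `p.1`. -/
lemma norm_pairing_le (hn : 1 ≤ n) (h : PairingData A R C K f g) :
    ∀ᵐ p ∂(volume : Measure (Eu n)).prod volume,
      ‖pairing K f g p‖ ≤ pairingMajorant A R C f p := by
  obtain ⟨hA, hR, hC⟩ := h.nonneg
  have h1 := Measure.quasiMeasurePreserving_fst (μ := (volume : Measure (Eu n)))
    (ν := (volume : Measure (Eu n))) |>.ae (ae_ne_zero hn)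
  have h2 := Measure.quasiMeasurePreserving_snd (μ := (volume : Measure (Eu n)))
    (ν := (volume : Measure (Eu n))) |>.ae h.supp
  filter_upwards [h1, h2] with p hp1 hp2
  rw [pairing, pairingMajorant, norm_mul, norm_mul]
  by_cases hR2 : R < ‖p.2‖
  · rw [hp2 hR2]; simp
  · have hR3 : ‖p.2‖ ≤ R := not_lt.1 hR2
    have e1 : 1 + ‖p.1‖ ≤ (1 + R) * (1 + ‖p.1 + p.2‖) := by
      have : ‖p.1‖ ≤ ‖p.1 + p.2‖ + ‖p.2‖ := by
        simpa using norm_sub_le (p.1 + p.2) p.2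
      nlinarith [norm_nonneg (p.1 + p.2)]
    have e2 : ((1 + ‖p.1 + p.2‖) ^ (n + 3))⁻¹ ≤
        (1 + R) ^ (n + 3) * ((1 + ‖p.1‖) ^ (n + 3))⁻¹ := by
      have e3 : (1 + ‖p.1‖) ^ (n + 3) ≤ (1 + R) ^ (n + 3) * (1 + ‖p.1 + p.2‖) ^ (n + 3) := by
        rw [← mul_pow]
        gcongr
      rw [← div_eq_mul_inv, le_div_iff₀ (by positivity), ← div_eq_inv_mul,
        div_le_iff₀ (by positivity)]
      exact e3
    have hG := greenMajorant_nonneg p.1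
    calc _ ≤ (C * ((1 + R) ^ (n + 3) * ((1 + ‖p.1‖) ^ (n + 3))⁻¹)) *
          (A * greenMajorant p.1 * ‖f p.2‖) := by
          refine mul_le_mul ?_ ?_ (by positivity) (by positivity)
          · exact (h.weight_le _).trans (by gcongr)
          · exact mul_le_mul_of_nonneg_right (h.kernel_le _ hp1) (norm_nonneg _)
      _ = _ := by ring

lemma aestronglyMeasurable_pairing (h : PairingData A R C K f g) :
    AEStronglyMeasurable (pairing K f g) ((volume : Measure (Eu n)).prod volume) := by
  have h1 : AEStronglyMeasurable (fun p : Eu n × Eu n => g (p.1 + p.2))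
      ((volume : Measure (Eu n)).prod volume) :=
    (h.weight_meas.comp (continuous_fst.add continuous_snd)).aestronglyMeasurable
  exact h1.mul (h.kernel_meas.comp_fst.mul h.integrable.aestronglyMeasurable.comp_snd)

lemma integrable_pairing (hn : 1 ≤ n) (h : PairingData A R C K f g) :
    Integrable (pairing K f g) ((volume : Measure (Eu n)).prod volume) :=
  (integrable_pairingMajorant hn A R C h.integrable).mono' h.aestronglyMeasurable_pairing
    (h.norm_pairing_le hn)

/-- Fubini's theorem and the change of variables. -/
lemma integral_eq (hn : 1 ≤ n) (h : PairingData A R C K f g) :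
    Integrable (fun x => g x * convOp K f x) ∧
      ∫ x, g x * convOp K f x = ∫ p, pairing K f g p ∂(volume : Measure (Eu n)).prod volume := by
  have hmp := measurePreserving_sub_prod (volume : Measure (Eu n)) (volume : Measure (Eu n))
  have hcomp : (pairing K f g) ∘ (fun z : Eu n × Eu n => (z.1 - z.2, z.2)) =
      fun z => g z.1 * (K (z.1 - z.2) * f z.2) := by
    ext z
    simp [pairing]
  have hi : Integrable (fun z : Eu n × Eu n => g z.1 * (K (z.1 - z.2) * f z.2))
      ((volume : Measure (Eu n)).prod volume) := by
    rw [← hcomp]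
    exact hmp.integrable_comp_of_integrable (h.integrable_pairing hn)
  have hx : ∀ x, ∫ y, g x * (K (x - y) * f y) = g x * convOp K f x := fun x => by
    rw [integral_const_mul]; rfl
  refine ⟨?_, ?_⟩
  · simp_rw [← hx]
    exact hi.integral_prod_left
  · simp_rw [← hx]
    rw [← integral_prod _ hi, ← hcomp]
    have := integral_map (μ := (volume : Measure (Eu n)).prod volume)
      hmp.measurable.aemeasurable (f := pairing K f g)
      (by rw [hmp.map_eq]; exact h.aestronglyMeasurable_pairing)
    rw [hmp.map_eq] at this
    exact this.symm

end PairingData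

/-- The pointwise bound for Schwartz functions that makes them admissible in `PairingData`. -/
lemma exists_schwartz_weight_le (N : ℕ) (ψ : 𝓢(Eu n, ℂ)) :
    ∃ C, 0 ≤ C ∧ ∀ x, ‖ψ x‖ ≤ C * ((1 + ‖x‖) ^ N)⁻¹ := by
  refine ⟨2 ^ N * (Finset.Iic ((N, 0) : ℕ × ℕ)).sup (schwartzSeminormFamily ℂ (Eu n) ℂ) ψ,
    by positivity, fun x => ?_⟩
  have h1 := ψ.one_add_le_sup_seminorm_apply (𝕜 := ℂ) (m := (N, 0)) (k := N) (n := 0)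
    le_rfl le_rfl x
  rw [norm_iteratedFDeriv_zero] at h1
  rw [← div_eq_mul_inv, le_div_iff₀ (by positivity), mul_comm]
  exact h1

lemma exists_norm_green_le (hn : 1 ≤ n) {k : ℝ} (hk : 0 < k) :
    ∃ A, 0 ≤ A ∧ ∀ (ε : ℝ) (x : Eu n), 0 ≤ ε → x ≠ 0 → ‖green k ε x‖ ≤ A * greenMajorant x := by
  have hn' : (1 : ℝ) ≤ n := by exact_mod_cast hn
  obtain ⟨C, hC, h⟩ := norm_green_le (n := n) hn (σ := (n : ℝ) - 1 / 2) (by linarith) (by linarith)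
  set B : ℝ := k ^ (-((n : ℝ) - 1 / 2)) + (1 + k ^ 2) with hB
  have hB0 : 0 ≤ k ^ (-((n : ℝ) - 1 / 2)) := by positivity
  refine ⟨C * (k ^ n / k ^ 2) * B, by positivity, fun ε x hε hx => (h k ε x hk hε hx).trans ?_⟩
  rw [mul_assoc (C * _) B]
  refine mul_le_mul_of_nonneg_left ?_ (by positivity)
  unfold greenMajorant
  have h0 : 0 ≤ ‖x‖ ^ (-((n : ℝ) - 1 / 2)) := by positivity
  generalize ‖x‖ ^ (-((n : ℝ) - 1 / 2)) = X at *
  generalize k ^ (-((n : ℝ) - 1 / 2)) = Y at *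
  have h1 : 0 ≤ Y * (1 + ‖x‖ ^ 2) := by positivity
  have h2 : 0 ≤ (1 + k ^ 2) * X := by positivity
  have h3 : 1 + k ^ 2 * ‖x‖ ^ 2 ≤ (1 + k ^ 2) * (1 + ‖x‖ ^ 2) := by nlinarith [sq_nonneg k, sq_nonneg ‖x‖]
  rw [hB]
  nlinarith

lemma convOp_eq_convolution (K f : Eu n → ℂ) :
    convOp K f = convolution f K (ContinuousLinearMap.mul ℂ ℂ) volume := by
  ext x
  rw [convOp, convolution]
  refine integral_congr_ae (Eventually.of_forall fun y => ?_)
  simp [mul_comm]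

/-- The defining relation of the resolvent at `k² + iε`, tested against `ψ`. -/
lemma integral_fourier_green (hn : 1 ≤ n) {k ε : ℝ} (hk : 0 < k) (hε : 0 < ε) {f : Eu n → ℂ}
    (hf : Integrable f) (ψ : 𝓢(Eu n, ℂ)) :
    ∫ ζ : Eu n, ((k : ℂ) ^ 2 - (‖(2 * Real.pi) • ζ‖ : ℂ) ^ 2 + (ε : ℂ) * Complex.I)⁻¹ * 𝓕 f ζ * ψ ζ =
      ∫ x, (𝓕 ψ : 𝓢(Eu n, ℂ)) x * convOp (green k ε) f x := by
  obtain ⟨h1, h2⟩ := green_fourier (n := n) hn hk hε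
  have h3 : Integrable (convOp (green k ε) f) := by
    rw [convOp_eq_convolution]
    exact hf.integrable_convolution _ h1
  have h4 : ∀ ζ : Eu n, ((k : ℂ) ^ 2 - (‖(2 * Real.pi) • ζ‖ : ℂ) ^ 2 + (ε : ℂ) * Complex.I)⁻¹ *
      𝓕 f ζ * ψ ζ = 𝓕 (convOp (green k ε) f) ζ • ψ ζ := fun ζ => by
    rw [convOp_eq_convolution, Real.fourier_mul_convolution_eq hf h1, h2, smul_eq_mul]
    ring
  simp_rw [h4]
  have h5 := VectorFourier.integral_fourierIntegral_smul_eq_flip (L := innerₗ (Eu n))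
    (μ := volume) (ν := volume) Real.continuous_fourierChar continuous_inner h3 ψ.integrable
  rw [flip_innerₗ] at h5
  refine Eq.trans h5 (integral_congr_ae (Eventually.of_forall fun x => ?_))
  simp only [smul_eq_mul]
  rw [mul_comm, SchwartzMap.fourier_coe]
  rfl

/-- Convolution with the outgoing fundamental solution is the outgoing resolvent. -/
lemma isOutgoingResolvent_convOp (hn : 1 ≤ n) {k R : ℝ} (hk : 0 < k) (hR : 0 ≤ R) {f : Eu n → ℂ}
    (hf : Integrable f) (hs : SupportedIn R f) :
    IsOutgoingResolvent k f (convOp (green k 0) f) := by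
  obtain ⟨A, hA, hg⟩ := exists_norm_green_le (n := n) hn hk
  have data : ∀ {ε C : ℝ} {g : Eu n → ℂ}, 0 ≤ ε → 0 ≤ C → Continuous g →
      (∀ x, ‖g x‖ ≤ C * ((1 + ‖x‖) ^ (n + 3))⁻¹) → PairingData A R C (green k ε) f g :=
    fun hε hC hgc hgb => ⟨⟨hA, hR, hC⟩, (measurable_green k _).aestronglyMeasurable,
      fun x hx => hg _ x hε hx, hf, hs, hgc, hgb⟩
  have htemp : IsTempered (convOp (green k 0) f) := by
    refine isTempered_of_integrable (n + 3) ?_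
    have hgc : Continuous fun x : Eu n => ((((1 + ‖x‖) ^ (n + 3))⁻¹ : ℝ) : ℂ) := by
      refine Complex.continuous_ofReal.comp (Continuous.inv₀ (by fun_prop) fun x => ?_)
      positivity
    have := (data (ε := 0) (C := 1) le_rfl zero_le_one hgc fun x => by
      rw [Complex.norm_real, Real.norm_of_nonneg (by positivity), one_mul]).integral_eq hn
    simp only [Complex.real_smul]
    exact this.1
  obtain ⟨T, hT⟩ := htemp
  refine ⟨hf, T, hT, fun ψ => ?_⟩
  obtain ⟨C, hC, hψ⟩ := exists_schwartz_weight_le (n + 3) (𝓕 ψ : 𝓢(Eu n, ℂ))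
  have hcont : Continuous (𝓕 ψ : 𝓢(Eu n, ℂ)) := (𝓕 ψ : 𝓢(Eu n, ℂ)).continuous
  rw [TemperedDistribution.fourier_apply, (hT _).2, ((data le_rfl hC hcont hψ).integral_eq hn).2]
  have hev : (fun ε : ℝ => ∫ ζ : Eu n,
      ((k : ℂ) ^ 2 - (‖(2 * Real.pi) • ζ‖ : ℂ) ^ 2 + (ε : ℂ) * Complex.I)⁻¹ * 𝓕 f ζ * ψ ζ)
      =ᶠ[𝓝[>] 0] fun ε => ∫ p, pairing (green k ε) f (𝓕 ψ : 𝓢(Eu n, ℂ)) p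
        ∂(volume : Measure (Eu n)).prod volume := by
    filter_upwards [self_mem_nhdsWithin] with ε hε
    rw [integral_fourier_green hn hk hε hf, ((data (le_of_lt hε) hC hcont hψ).integral_eq hn).2]
  refine Tendsto.congr' hev.symm ?_
  refine tendsto_integral_filter_of_dominated_convergence (pairingMajorant A R C f) ?_ ?_
    (integrable_pairingMajorant hn A R C hf) ?_
  · filter_upwards [self_mem_nhdsWithin] with ε hε
    exact (data (le_of_lt hε) hC hcont hψ).aestronglyMeasurable_pairing
  · filter_upwards [self_mem_nhdsWithin] with ε hε
    exact (data (le_of_lt hε) hC hcont hψ).norm_pairing_le hn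
  · have h1 := Measure.quasiMeasurePreserving_fst (μ := (volume : Measure (Eu n)))
      (ν := (volume : Measure (Eu n))) |>.ae (ae_ne_zero hn)
    filter_upwards [h1] with p hp
    exact ((tendsto_green hn hk hp).mul_const _).const_mul _

lemma IsOutgoingResolvent.ae_unique {k : ℝ} {f u v : Eu n → ℂ} (hu : IsOutgoingResolvent k f u)
    (hv : IsOutgoingResolvent k f v) : u =ᵐ[volume] v := by
  obtain ⟨_, T, hT, hT2⟩ := hu
  obtain ⟨_, S, hS, hS2⟩ := hv
  have h1 : (𝓕 T : 𝓢'(Eu n, ℂ)) = 𝓕 S := by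
    ext ψ
    exact tendsto_nhds_unique (hT2 ψ) (hS2 ψ)
  have h2 : T = S := by
    have := congrArg (fun U : 𝓢'(Eu n, ℂ) => (𝓕⁻ U : 𝓢'(Eu n, ℂ))) h1
    simpa using this
  rw [h2] at hT
  exact hT.ae_unique hS

/-- For integrable functions of bounded support the resolvent exists and is given by convolution
with the outgoing fundamental solution. -/
lemma resolvent_ae_eq (hn : 1 ≤ n) {k R : ℝ} (hk : 0 < k) (hR : 0 ≤ R) {f : Eu n → ℂ}
    (hf : Integrable f) (hs : SupportedIn R f) :
    (∃ u, IsOutgoingResolvent k f u) ∧ resolvent k f =ᵐ[volume] convOp (green k 0) f := by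
  have h := isOutgoingResolvent_convOp hn hk hR hf hs
  have hex : ∃ u, IsOutgoingResolvent k f u := ⟨_, h⟩
  refine ⟨hex, ?_⟩
  rw [resolvent, dif_pos hex]
  exact hex.choose_spec.ae_unique h

/-! ### Multiple scattering chains with a general kernel -/

/-- The analogue of `bornChain` in which the resolvent is replaced by convolution with `K`. -/
def chain (K e : Eu n → ℂ) : List (Eu n → ℂ) → Eu n → ℂ
  | [] => 0
  | [f] => fun x => f x * e x
  | f :: g :: l => fun x => f x * convOp K (chain K e (g :: l)) x

/-- A factor of a chain: a function in `L^{1/(ρ+c)}` with support in the ball of radius `R`. -/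
structure Factor (ρ R c : ℝ) (f : Eu n → ℂ) : Prop where
  pos : 0 < c
  memLp : MemLp f (recipExp (ρ + c)) volume
  supp : SupportedIn R f

variable {ι : Type*} {f g : ι → Eu n → ℂ} {K K' e : Eu n → ℂ} {c : ι → ℝ} {ρ R : ℝ}

lemma convOp_congr {K g h : Eu n → ℂ} (hgh : g =ᵐ[volume] h) : convOp K g = convOp K h := by
  ext x
  refine integral_congr_ae ?_
  filter_upwards [hgh] with y hy
  rw [hy]

lemma chain_congr (L : List ι) (h : ∀ a ∈ L, f a =ᵐ[volume] g a) :
    chain K e (L.map f) =ᵐ[volume] chain K e (L.map g) := by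
  induction L with
  | nil => rfl
  | cons i L ih =>
    have ih' := ih fun a ha => h a (List.mem_cons_of_mem i ha)
    cases L with
    | nil =>
      filter_upwards [h i (by simp)] with x hx
      simp only [List.map_cons, List.map_nil, chain, hx]
    | cons i' L =>
      simp only [List.map_cons, chain] at ih' ⊢
      rw [convOp_congr ih']
      filter_upwards [h i (by simp)] with x hx
      rw [hx]

lemma supportedIn_chain (i : ι) (L : List ι) (h : SupportedIn R (f i)) :
    SupportedIn R (chain K e ((i :: L).map f)) := by
  filter_upwards [h] with x hx hR
  cases L with
  | nil => simp [chain, hx hR]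
  | cons i' L => simp [chain, hx hR]

/-- Only the values of the kernel on the ball of radius `2R` matter. -/
lemma chain_congr_kernel (hK : ∀ x, ‖x‖ ≤ 2 * R → K x = K' x) (L : List ι)
    (h : ∀ a ∈ L, SupportedIn R (f a)) :
    chain K e (L.map f) =ᵐ[volume] chain K' e (L.map f) := by
  induction L with
  | nil => rfl
  | cons i L ih =>
    have ih' := ih fun a ha => h a (List.mem_cons_of_mem i ha)
    cases L with
    | nil => rfl
    | cons i' L =>
      have hs := supportedIn_chain (K := K') (e := e) i' L (h i' (by simp))
      simp only [List.map_cons, chain] at ih' hs ⊢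
      rw [convOp_congr ih']
      filter_upwards [h i (by simp)] with x hx
      by_cases hxR : R < ‖x‖
      · rw [hx hxR, zero_mul, zero_mul]
      · congr 1
        refine integral_congr_ae ?_
        filter_upwards [hs] with y hy
        by_cases hyR : R < ‖y‖
        · rw [hy hyR, mul_zero, mul_zero]
        · rw [hK]
          refine (norm_sub_le x y).trans ?_
          linarith

lemma aestronglyMeasurable_chain (hK : AEStronglyMeasurable K volume)
    (he : AEStronglyMeasurable e volume) (L : List ι)
    (h : ∀ a ∈ L, AEStronglyMeasurable (f a) volume) :
    AEStronglyMeasurable (chain K e (L.map f)) volume := by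
  induction L with
  | nil => exact aestronglyMeasurable_zero
  | cons i L ih =>
    have ih' := ih fun a ha => h a (List.mem_cons_of_mem i ha)
    cases L with
    | nil => exact (h i (by simp)).mul he
    | cons i' L => exact (h i (by simp)).mul (aestronglyMeasurable_convOp hK ih')

lemma sum_map_pos (i : ι) (L : List ι) (hc : ∀ a ∈ i :: L, 0 < c a) :
    0 < ((i :: L).map c).sum := by
  refine List.sum_pos _ (fun x hx => ?_) (by simp)
  obtain ⟨a, ha, rfl⟩ := List.mem_map.1 hx
  exact hc a ha

/-- The size of a chain is controlled by the kernel norm, uniformly in the kernel and in the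
incoming wave. -/
lemma exists_eLpNorm_chain_le (hρ : 0 ≤ ρ) (i : ι) (L : List ι)
    (h : ∀ a ∈ i :: L, Factor ρ R (c a) (f a)) (hsum : ρ + ((i :: L).map c).sum ≤ 1) :
    ∃ D : ℝ≥0∞, D ≠ ⊤ ∧ ∀ K e : Eu n → ℂ, AEStronglyMeasurable K volume →
      AEStronglyMeasurable e volume → (∀ x, ‖e x‖ ≤ 1) →
      eLpNorm (chain K e ((i :: L).map f)) (recipExp (ρ + ((i :: L).map c).sum)) volume ≤
        D * eLpNorm K (recipExp (1 - ρ)) volume ^ L.length := by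
  induction L generalizing i with
  | nil =>
    refine ⟨_, (h i (by simp)).memLp.2.ne, fun K e hK he he1 => ?_⟩
    simp only [List.map_cons, List.map_nil, List.sum_cons, List.sum_nil, add_zero,
      List.length_nil, pow_zero, mul_one, chain]
    refine eLpNorm_mono fun x => ?_
    rw [norm_mul]
    exact mul_le_of_le_one_right (norm_nonneg _) (he1 x)
  | cons i' L ih =>
    have hi := h i (by simp)
    have h' : ∀ a ∈ i' :: L, Factor ρ R (c a) (f a) := fun a ha => h a (List.mem_cons_of_mem i ha)
    have hpos := sum_map_pos i' L fun a ha => (h' a ha).pos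
    rw [List.map_cons, List.sum_cons] at hsum
    have hsum' : ρ + ((i' :: L).map c).sum ≤ 1 := by linarith [hi.pos]
    obtain ⟨D, hD, hb⟩ := ih i' h' hsum'
    refine ⟨_, ENNReal.mul_ne_top hi.memLp.2.ne hD, fun K e hK he he1 => ?_⟩
    have hm := aestronglyMeasurable_chain hK he (i' :: L) fun a ha => (h' a ha).memLp.1
    have key := eLpNorm_mul_convOp_le hρ (add_pos_of_nonneg_of_pos hρ hi.pos) hpos hsum'
      hi.memLp.1 hK hm
    rw [List.map_cons (f := c), List.sum_cons, ← add_assoc]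
    refine key.trans ?_
    rw [List.length_cons, pow_succ]
    calc _ ≤ eLpNorm (f i) (recipExp (ρ + c i)) volume * (eLpNorm K (recipExp (1 - ρ)) volume *
          (D * eLpNorm K (recipExp (1 - ρ)) volume ^ L.length)) := by
          gcongr
          exact hb K e hK he he1
      _ = _ := by ring

lemma memLp_chain (hρ : 0 ≤ ρ) (hK : MemLp K (recipExp (1 - ρ)) volume)
    (he : AEStronglyMeasurable e volume) (he1 : ∀ x, ‖e x‖ ≤ 1) (i : ι) (L : List ι)
    (h : ∀ a ∈ i :: L, Factor ρ R (c a) (f a)) (hsum : ρ + ((i :: L).map c).sum ≤ 1) :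
    MemLp (chain K e ((i :: L).map f)) (recipExp (ρ + ((i :: L).map c).sum)) volume := by
  obtain ⟨D, hD, hb⟩ := exists_eLpNorm_chain_le hρ i L h hsum
  refine ⟨aestronglyMeasurable_chain hK.1 he (i :: L) fun a ha => (h a ha).memLp.1, ?_⟩
  refine (hb K e hK.1 he he1).trans_lt ?_
  exact ENNReal.mul_lt_top hD.lt_top (ENNReal.pow_lt_top hK.2)

lemma integrable_chain (hρ : 0 ≤ ρ) (hK : MemLp K (recipExp (1 - ρ)) volume)
    (he : AEStronglyMeasurable e volume) (he1 : ∀ x, ‖e x‖ ≤ 1) (i : ι) (L : List ι)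
    (h : ∀ a ∈ i :: L, Factor ρ R (c a) (f a)) (hsum : ρ + ((i :: L).map c).sum ≤ 1) :
    Integrable (chain K e ((i :: L).map f)) := by
  have hpos := sum_map_pos i L fun a ha => (h a ha).pos
  have h1 := memLp_chain hρ hK he he1 i L h hsum
  exact memLp_one_iff_integrable.1 ((supportedIn_chain i L (h i (by simp)).supp).memLp_mono
    (one_le_recipExp (add_pos_of_nonneg_of_pos hρ hpos) hsum) h1)

lemma ae_integrable_conv {K g : Eu n → ℂ} (hK : Integrable K) (hg : Integrable g) :
    ∀ᵐ x, Integrable (fun y => K (x - y) * g y) := by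
  have := (hg.convolution_integrand (ContinuousLinearMap.mul ℂ ℂ) hK).prod_right_ae
  filter_upwards [this] with x hx
  refine hx.congr (Eventually.of_forall fun y => ?_)
  simp [mul_comm]

/-- Chains depend continuously on their factors. -/
lemma tendsto_eLpNorm_chain_sub (hρ : 0 ≤ ρ) (hK : MemLp K (recipExp (1 - ρ)) volume)
    (hKi : Integrable K) (he : AEStronglyMeasurable e volume) (he1 : ∀ x, ‖e x‖ ≤ 1)
    (F : ℕ → ι → Eu n → ℂ) (i : ι) (L : List ι)
    (hF : ∀ a ∈ i :: L, ∀ k, Factor ρ R (c a) (F k a))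
    (h : ∀ a ∈ i :: L, Factor ρ R (c a) (f a)) (hsum : ρ + ((i :: L).map c).sum ≤ 1)
    (hlim : ∀ a ∈ i :: L,
      Tendsto (fun k => eLpNorm (F k a - f a) (recipExp (ρ + c a)) volume) atTop (𝓝 0)) :
    Tendsto (fun k => eLpNorm (chain K e ((i :: L).map (F k)) - chain K e ((i :: L).map f))
      (recipExp (ρ + ((i :: L).map c).sum)) volume) atTop (𝓝 0) := by
  induction L generalizing i with
  | nil =>
    refine tendsto_of_tendsto_of_tendsto_of_le_of_le tendsto_const_nhds (hlim i (by simp))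
      (fun k => zero_le) fun k => ?_
    simp only [List.map_cons, List.map_nil, List.sum_cons, List.sum_nil, add_zero, chain]
    refine eLpNorm_mono fun x => ?_
    rw [Pi.sub_apply, Pi.sub_apply, ← sub_mul, norm_mul]
    exact mul_le_of_le_one_right (norm_nonneg _) (he1 x)
  | cons i' L ih =>
    have hi := h i (by simp)
    have h' : ∀ a ∈ i' :: L, Factor ρ R (c a) (f a) := fun a ha => h a (List.mem_cons_of_mem i ha)
    have hF' : ∀ a ∈ i' :: L, ∀ k, Factor ρ R (c a) (F k a) :=
      fun a ha => hF a (List.mem_cons_of_mem i ha)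
    have hpos := sum_map_pos i' L fun a ha => (h' a ha).pos
    rw [List.map_cons, List.sum_cons] at hsum
    have hsum' : ρ + ((i' :: L).map c).sum ≤ 1 := by linarith [hi.pos]
    have ih' := ih i' hF' h' hsum' fun a ha => hlim a (List.mem_cons_of_mem i ha)
    set A : ℕ → Eu n → ℂ := fun k => chain K e ((i' :: L).map (F k)) with hA
    set B : Eu n → ℂ := chain K e ((i' :: L).map f) with hB
    have hAi : ∀ k, Integrable (A k) := fun k =>
      integrable_chain hρ hK he he1 i' L (fun a ha => hF' a ha k) hsum'
    have hBi : Integrable B := integrable_chain hρ hK he he1 i' L h' hsum'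
    have hBm : MemLp B (recipExp (ρ + ((i' :: L).map c).sum)) volume :=
      memLp_chain hρ hK he he1 i' L h' hsum'
    rw [List.map_cons (f := c), List.sum_cons, ← add_assoc]
    set s : ℝ := ((i' :: L).map c).sum with hs
    have hρs : 0 < ρ + s := add_pos_of_nonneg_of_pos hρ hpos
    have hρi : 0 < ρ + c i := add_pos_of_nonneg_of_pos hρ hi.pos
    -- the difference splits into the variation of the first factor and that of the tail
    have hsplit : ∀ k, chain K e ((i :: i' :: L).map (F k)) - chain K e ((i :: i' :: L).map f)
        =ᵐ[volume] (fun x => (F k i - f i) x * convOp K (A k) x) +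
          fun x => f i x * convOp K (A k - B) x := by
      intro k
      filter_upwards [ae_integrable_conv hKi (hAi k), ae_integrable_conv hKi hBi] with x h1 h2
      have e1 : convOp K (A k - B) x = convOp K (A k) x - convOp K B x := by
        simp only [convOp, Pi.sub_apply, mul_sub]
        exact integral_sub h1 h2
      have e2 : chain K e ((i :: i' :: L).map (F k)) x = F k i x * convOp K (A k) x := rfl
      have e3 : chain K e ((i :: i' :: L).map f) x = f i x * convOp K B x := rfl
      rw [Pi.sub_apply, Pi.add_apply, e1, e2, e3, Pi.sub_apply]
      ring
    set N := eLpNorm K (recipExp (1 - ρ)) volume with hN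
    have hbound : ∀ k, eLpNorm (chain K e ((i :: i' :: L).map (F k)) -
        chain K e ((i :: i' :: L).map f)) (recipExp (ρ + c i + s)) volume ≤
        eLpNorm (F k i - f i) (recipExp (ρ + c i)) volume *
          (N * (eLpNorm (A k - B) (recipExp (ρ + s)) volume +
            eLpNorm B (recipExp (ρ + s)) volume)) +
        eLpNorm (f i) (recipExp (ρ + c i)) volume *
          (N * eLpNorm (A k - B) (recipExp (ρ + s)) volume) := by
      intro k
      have m1 : AEStronglyMeasurable (F k i - f i) volume :=
        (hF i (by simp) k).memLp.1.sub hi.memLp.1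
      have m2 : AEStronglyMeasurable (A k - B) volume := (hAi k).1.sub hBi.1
      rw [eLpNorm_congr_ae (hsplit k)]
      refine (eLpNorm_add_le (m1.mul (aestronglyMeasurable_convOp hK.1 (hAi k).1))
        (hi.memLp.1.mul (aestronglyMeasurable_convOp hK.1 m2))
        (one_le_recipExp (by positivity) (by linarith))).trans ?_
      refine add_le_add ?_ ?_
      · refine (eLpNorm_mul_convOp_le hρ hρi hpos hsum' m1 hK.1 (hAi k).1).trans ?_
        gcongr
        have e4 : A k = (A k - B) + B := by simp
        calc eLpNorm (A k) (recipExp (ρ + s)) volume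
            = eLpNorm ((A k - B) + B) (recipExp (ρ + s)) volume := by rw [← e4]
          _ ≤ _ := eLpNorm_add_le m2 hBi.1 (one_le_recipExp hρs hsum')
      · exact eLpNorm_mul_convOp_le hρ hρi hpos hsum' hi.memLp.1 hK.1 m2
    have hNt : N ≠ ⊤ := hK.2.ne
    refine tendsto_of_tendsto_of_tendsto_of_le_of_le tendsto_const_nhds ?_
      (fun k => zero_le) hbound
    have t1 : Tendsto (fun k => N * (eLpNorm (A k - B) (recipExp (ρ + s)) volume +
        eLpNorm B (recipExp (ρ + s)) volume)) atTop
        (𝓝 (N * (0 + eLpNorm B (recipExp (ρ + s)) volume))) :=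
      ENNReal.Tendsto.const_mul (ih'.add tendsto_const_nhds) (Or.inr hNt)
    have t2 := ENNReal.Tendsto.mul (hlim i (by simp))
      (Or.inr (by
        rw [zero_add]
        exact ENNReal.mul_ne_top hNt hBm.2.ne)) t1 (Or.inr ENNReal.zero_ne_top)
    have t3 : Tendsto (fun k => eLpNorm (f i) (recipExp (ρ + c i)) volume *
        (N * eLpNorm (A k - B) (recipExp (ρ + s)) volume)) atTop
        (𝓝 (eLpNorm (f i) (recipExp (ρ + c i)) volume * (N * 0))) :=
      ENNReal.Tendsto.const_mul (ENNReal.Tendsto.const_mul ih' (Or.inr hNt))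
        (Or.inr hi.memLp.2.ne)
    simpa using t2.add t3

/-- Joint measurability of chains in a parameter and in the space variable. -/
lemma measurable_chain_param {Ξ : Type*} [MeasurableSpace Ξ] {K e : Ξ → Eu n → ℂ}
    (hK : Measurable fun p : Ξ × Eu n => K p.1 p.2) (he : Measurable fun p : Ξ × Eu n => e p.1 p.2)
    (L : List ι) (h : ∀ a ∈ L, Measurable (f a)) :
    Measurable fun p : Ξ × Eu n => chain (K p.1) (e p.1) (L.map f) p.2 := by
  induction L with
  | nil => exact measurable_const
  | cons i L ih =>
    have ih' := ih fun a ha => h a (List.mem_cons_of_mem i ha)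
    have hi : Measurable fun p : Ξ × Eu n => f i p.2 := (h i (by simp)).comp measurable_snd
    cases L with
    | nil => exact hi.mul he
    | cons i' L =>
      have h1 : Measurable fun p : (Ξ × Eu n) × Eu n => K p.1.1 (p.1.2 - p.2) :=
        hK.comp (f := fun p : (Ξ × Eu n) × Eu n => (p.1.1, p.1.2 - p.2)) (by fun_prop)
      have h2 : Measurable fun p : (Ξ × Eu n) × Eu n =>
          chain (K p.1.1) (e p.1.1) ((i' :: L).map f) p.2 :=
        ih'.comp (g := fun p : Ξ × Eu n => chain (K p.1) (e p.1) ((i' :: L).map f) p.2)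
          (f := fun p : (Ξ × Eu n) × Eu n => (p.1.1, p.2)) (by fun_prop)
      exact hi.mul ((h1.mul h2).stronglyMeasurable.integral_prod_right' (ν := volume)).measurable

/-! ### Estimates for the Born symbols -/

/-- The outgoing fundamental solution truncated to the ball of radius `2R`. -/
def localGreen (R k : ℝ) : Eu n → ℂ := (Metric.closedBall (0 : Eu n) (2 * R)).indicator (green k 0)

lemma measurable_localGreen (R k : ℝ) : Measurable (localGreen R k : Eu n → ℂ) :=
  (measurable_green k 0).indicator Metric.isClosed_closedBall.measurableSet

lemma supportedIn_localGreen (R k : ℝ) : SupportedIn (2 * R) (localGreen R k : Eu n → ℂ) := by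
  refine Eventually.of_forall fun x hx => Set.indicator_of_notMem ?_ _
  simpa using hx

lemma localGreen_eq {R k : ℝ} (x : Eu n) (hx : ‖x‖ ≤ 2 * R) : green k 0 x = localGreen R k x :=
  (Set.indicator_of_mem (by simpa using hx) _).symm

/-- Admissible exponents: `ρ` governs the integrability of the potential, and `σ` the singularity
that is allowed for the fundamental solution. -/
structure Exponents (n : ℕ) (ρ σ : ℝ) : Prop where
  dim : 1 ≤ n
  rho_pos : 0 < ρ
  rho_lt : ρ < 1
  sigma_nonneg : 0 ≤ σ
  lt_sigma : (n : ℝ) - 2 < σ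
  sigma_lt : σ < n * (1 - ρ)

lemma rpow_le_add_rpow {k a b c : ℝ} (hk : 0 < k) (hab : a ≤ b) (hbc : b ≤ c) :
    k ^ b ≤ k ^ a + k ^ c := by
  have ha : 0 ≤ k ^ a := by positivity
  have hc : 0 ≤ k ^ c := by positivity
  rcases le_total k 1 with h | h
  · linarith [Real.rpow_le_rpow_of_exponent_ge hk h hab]
  · linarith [Real.rpow_le_rpow_of_exponent_le h hbc]

/-- The condition `σ < n (1 - ρ)` is exactly what makes the singularity `‖x‖ ^ (-σ)` integrable to
the power `1/(1 - ρ)`. -/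
lemma memLp_truncated_power {ρ σ : ℝ} (h : Exponents n ρ σ) (r : ℝ) :
    MemLp ((Metric.closedBall (0 : Eu n) r).indicator fun x => ‖x‖ ^ (-σ)) (recipExp (1 - ρ))
      volume := by
  have hρ : 0 < 1 - ρ := by linarith [h.rho_lt]
  have hm : Measurable ((Metric.closedBall (0 : Eu n) r).indicator fun x => ‖x‖ ^ (-σ)) :=
    Measurable.indicator (by fun_prop) Metric.isClosed_closedBall.measurableSet
  rw [← integrable_norm_rpow_iff hm.aestronglyMeasurable (recipExp_ne_zero hρ)
    (recipExp_ne_top _), recipExp_toReal hρ]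
  have hm2 : Measurable fun x : Eu n =>
      ‖(Metric.closedBall (0 : Eu n) r).indicator (fun x => ‖x‖ ^ (-σ)) x‖ ^ (1 - ρ)⁻¹ :=
    hm.norm.pow_const _
  rw [← integrableOn_iff_integrable_of_support_subset (s := Metric.ball 0 (r + 1))]
  · refine integrableOn_ball_of_norm_le_rpow (C := 1) (α := σ * (1 - ρ)⁻¹) (by simpa using h.dim)
      ?_ (Eventually.of_forall fun x => ?_) hm2.aestronglyMeasurable
    · rw [finrank_euclideanSpace_fin, ← div_eq_mul_inv, div_lt_iff₀ hρ]
      exact h.sigma_lt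
    · rw [one_mul, Real.norm_of_nonneg (by positivity)]
      by_cases hx : x ∈ Metric.closedBall (0 : Eu n) r
      · rw [Set.indicator_of_mem hx, Real.norm_of_nonneg (by positivity),
          ← Real.rpow_mul (norm_nonneg x), neg_mul]
      · rw [Set.indicator_of_notMem hx, norm_zero, Real.zero_rpow (by positivity)]
        positivity
  · intro x hx
    by_contra hx2
    refine hx ?_
    have : x ∉ Metric.closedBall (0 : Eu n) r := by
      simp only [Metric.mem_ball, dist_zero_right, not_lt, Metric.mem_closedBall, not_le] at hx2 ⊢
      linarith
    simp only [Set.indicator_of_notMem this, norm_zero]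
    exact Real.zero_rpow (by positivity)

/-- The norm of the truncated fundamental solution at wave number `k`. -/
lemma exists_eLpNorm_localGreen_le {ρ σ R : ℝ} (h : Exponents n ρ σ) (hR : 0 < R) :
    ∃ N : ℝ, 0 ≤ N ∧ ∀ k : ℝ, 0 < k →
      eLpNorm (localGreen R k : Eu n → ℂ) (recipExp (1 - ρ)) volume ≤
        ENNReal.ofReal (N * (k ^ ((n : ℝ) - 2 - σ) + k ^ (n : ℝ))) := by
  obtain ⟨C, hC, hg⟩ := norm_green_le (n := n) h.dim h.sigma_nonneg h.lt_sigma
  have hM := memLp_truncated_power h (2 * R)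
  set M := (Metric.closedBall (0 : Eu n) (2 * R)).indicator fun x => ‖x‖ ^ (-σ) with hMdef
  set C' : ℝ := C * (1 + 2 * ((1 + 4 * R ^ 2) * (2 * R) ^ σ)) with hC'
  have hC'0 : 0 ≤ C' := by positivity
  refine ⟨C' * (eLpNorm M (recipExp (1 - ρ)) volume).toReal, by positivity, fun k hk => ?_⟩
  set Y : ℝ := k ^ ((n : ℝ) - 2 - σ) + k ^ (n : ℝ) with hY
  have hY0 : 0 ≤ Y := by positivity
  have hpt : ∀ᵐ x : Eu n, ‖localGreen R k x‖ ≤ ‖((C' * Y) • M) x‖ := by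
    filter_upwards [ae_ne_zero h.dim] with x hx
    by_cases hx2 : x ∈ Metric.closedBall (0 : Eu n) (2 * R)
    · rw [localGreen, Set.indicator_of_mem hx2, Pi.smul_apply, hMdef, Set.indicator_of_mem hx2,
        norm_smul, Real.norm_of_nonneg (by positivity), Real.norm_of_nonneg (by positivity)]
      have hx3 : ‖x‖ ≤ 2 * R := by simpa using hx2
      have hx0 : 0 < ‖x‖ := norm_pos_iff.2 hx
      set X := ‖x‖ ^ (-σ) with hX
      have hX0 : 0 ≤ X := by positivity
      have h1 : 1 ≤ (2 * R) ^ σ * X := by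
        rw [hX, Real.rpow_neg hx0.le, ← div_eq_mul_inv, one_le_div (by positivity)]
        exact Real.rpow_le_rpow hx0.le hx3 h.sigma_nonneg
      have h2 : k ^ n / k ^ 2 = k ^ ((n : ℝ) - 2) := by
        rw [Real.rpow_sub hk, Real.rpow_natCast, Real.rpow_two]
      have h3 : k ^ n / k ^ 2 * k ^ (-σ) = k ^ ((n : ℝ) - 2 - σ) := by
        rw [h2, ← Real.rpow_add hk]; rfl
      have h4 : k ^ n / k ^ 2 ≤ Y := by
        rw [h2]
        exact rpow_le_add_rpow hk (by linarith [h.sigma_nonneg]) (by linarith)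
      have h5 : k ^ n / k ^ 2 * k ^ 2 ≤ Y := by
        have : k ^ n / k ^ 2 * k ^ 2 = k ^ (n : ℝ) := by
          rw [Real.rpow_natCast]; field_simp
        rw [this, hY]
        have : 0 ≤ k ^ ((n : ℝ) - 2 - σ) := by positivity
        linarith
      have h6 : k ^ ((n : ℝ) - 2 - σ) ≤ Y := by
        have : 0 ≤ k ^ (n : ℝ) := by positivity
        rw [hY]; linarith
      have h7 : ‖x‖ ^ 2 ≤ 4 * R ^ 2 := by nlinarith
      refine (hg k 0 x hk le_rfl hx).trans ?_
      calc C * (k ^ n / k ^ 2) * (k ^ (-σ) * X + (1 + k ^ 2 * ‖x‖ ^ 2))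
          = C * ((k ^ n / k ^ 2 * k ^ (-σ)) * X +
            (k ^ n / k ^ 2 + (k ^ n / k ^ 2 * k ^ 2) * ‖x‖ ^ 2)) := by ring
        _ ≤ C * (Y * X + (Y + Y * (4 * R ^ 2)) * ((2 * R) ^ σ * X)) := by
            rw [h3]
            gcongr C * (?_ * X + ?_)
            calc _ ≤ Y + Y * (4 * R ^ 2) := by gcongr
              _ ≤ _ := le_mul_of_one_le_right (by positivity) h1
        _ ≤ C * (Y * X + 2 * ((Y + Y * (4 * R ^ 2)) * ((2 * R) ^ σ * X))) := by
            have : 0 ≤ (Y + Y * (4 * R ^ 2)) * ((2 * R) ^ σ * X) := by positivity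
            refine mul_le_mul_of_nonneg_left ?_ hC.le
            linarith
        _ = C' * Y * X := by rw [hC']; ring
    · rw [localGreen, Set.indicator_of_notMem hx2, norm_zero]
      positivity
  refine (eLpNorm_mono_ae hpt).trans ?_
  have hswap : C' * (eLpNorm M (recipExp (1 - ρ)) volume).toReal * Y =
      C' * Y * (eLpNorm M (recipExp (1 - ρ)) volume).toReal := by ring
  have hCY : 0 ≤ C' * Y := by positivity
  rw [eLpNorm_const_smul, hswap, ENNReal.ofReal_mul hCY, ENNReal.ofReal_toReal hM.2.ne,
    Real.enorm_of_nonneg hCY]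

lemma memLp_localGreen {ρ σ R : ℝ} (h : Exponents n ρ σ) (hR : 0 < R) {k : ℝ} (hk : 0 < k) :
    MemLp (localGreen R k : Eu n → ℂ) (recipExp (1 - ρ)) volume := by
  obtain ⟨N, _, hb⟩ := exists_eLpNorm_localGreen_le h hR
  exact ⟨(measurable_localGreen R k).aestronglyMeasurable, (hb k hk).trans_lt ENNReal.ofReal_lt_top⟩

lemma integrable_localGreen {ρ σ R : ℝ} (h : Exponents n ρ σ) (hR : 0 < R) {k : ℝ} (hk : 0 < k) :
    Integrable (localGreen R k : Eu n → ℂ) :=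
  memLp_one_iff_integrable.1 ((supportedIn_localGreen R k).memLp_mono
    (one_le_recipExp (by linarith [h.rho_lt]) (by linarith [h.rho_pos])) (memLp_localGreen h hR hk))

variable {ι : Type*} {f g : ι → Eu n → ℂ} {e : Eu n → ℂ} {c : ι → ℝ} {ρ σ R : ℝ}

/-- For admissible factors the chain of resolvents exists and is given by the fundamental
solution. -/
lemma bornChain_ae_eq (hE : Exponents n ρ σ) (hR : 0 < R) {k : ℝ} (hk : 0 < k)
    (he : AEStronglyMeasurable e volume) (he1 : ∀ x, ‖e x‖ ≤ 1) (i : ι) (L : List ι)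
    (h : ∀ a ∈ i :: L, Factor ρ R (c a) (f a)) (hsum : ρ + ((i :: L).map c).sum ≤ 1) :
    BornChainDefined k e ((i :: L).map f) ∧
      bornChain k e ((i :: L).map f) =ᵐ[volume] chain (localGreen R k) e ((i :: L).map f) := by
  induction L generalizing i with
  | nil => exact ⟨trivial, EventuallyEq.rfl⟩
  | cons i' L ih =>
    have hi := h i (by simp)
    have h' : ∀ a ∈ i' :: L, Factor ρ R (c a) (f a) := fun a ha => h a (List.mem_cons_of_mem i ha)
    have hsum' : ρ + ((i' :: L).map c).sum ≤ 1 := by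
      rw [List.map_cons, List.sum_cons] at hsum
      linarith [hi.pos]
    obtain ⟨h1, h2⟩ := ih i' h' hsum'
    have hint := integrable_chain hE.rho_pos.le (memLp_localGreen hE hR hk) he he1 i' L h' hsum'
    have hsupp := supportedIn_chain (K := localGreen R k) (e := e) i' L (h' i' (by simp)).supp
    have hsupp2 : SupportedIn R (bornChain k e ((i' :: L).map f)) := by
      filter_upwards [h2, hsupp] with x hx1 hx2 hx3
      rw [hx1, hx2 hx3]
    obtain ⟨h3, h4⟩ := resolvent_ae_eq hE.dim hk hR.le (hint.congr h2.symm) hsupp2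
    refine ⟨⟨h3, h1⟩, ?_⟩
    have h5 : chain (green k 0) e ((i :: i' :: L).map f) =ᵐ[volume]
        chain (localGreen R k) e ((i :: i' :: L).map f) :=
      chain_congr_kernel (fun x hx => localGreen_eq x hx) _ fun a ha => (h a ha).supp
    have h6 : chain (green k 0) e ((i' :: L).map f) =ᵐ[volume]
        chain (localGreen R k) e ((i' :: L).map f) :=
      chain_congr_kernel (fun x hx => localGreen_eq x hx) _ fun a ha => (h' a ha).supp
    refine EventuallyEq.trans ?_ h5
    rw [convOp_congr (h2.trans h6.symm)] at h4
    filter_upwards [h4] with x hx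
    simp only [List.map_cons, bornChain, chain] at hx ⊢
    rw [hx]

/-- The incoming plane wave at frequency `ξ`. -/
abbrev incoming (ξ : Eu n) : Eu n → ℂ := planeWave (waveNumber ξ) (direction ξ)

lemma incoming_eq (ξ y : Eu n) :
    incoming ξ y = Complex.exp (Complex.I * ((-(inner ℝ ξ y) / 2 : ℝ) : ℂ)) := by
  unfold incoming planeWave waveNumber direction
  congr 3
  rw [inner_neg_left, real_inner_smul_left]
  rcases eq_or_ne ξ 0 with rfl | hξ
  · simp
  · have := norm_ne_zero_iff.2 hξ
    field_simp

lemma norm_incoming (ξ y : Eu n) : ‖incoming ξ y‖ = 1 := by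
  rw [incoming_eq, mul_comm, Complex.norm_exp_ofReal_mul_I]

lemma measurable_incoming_uncurry : Measurable fun p : Eu n × Eu n => incoming p.1 p.2 := by
  simp_rw [incoming_eq]
  fun_prop

lemma continuous_incoming (ξ : Eu n) : Continuous (incoming ξ) := by
  have : incoming ξ = fun y => Complex.exp (Complex.I * ((-(inner ℝ ξ y) / 2 : ℝ) : ℂ)) :=
    funext (incoming_eq ξ)
  rw [this]
  fun_prop

lemma waveNumber_pos {ξ : Eu n} (hξ : ξ ≠ 0) : 0 < waveNumber ξ := by
  have := norm_pos_iff.2 hξ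
  rw [waveNumber]; positivity

lemma bornFourierDefined_of_factor (hE : Exponents n ρ σ) (hR : 0 < R) (i : ι) (L : List ι)
    (h : ∀ a ∈ i :: L, Factor ρ R (c a) (f a)) (hsum : ρ + ((i :: L).map c).sum ≤ 1) :
    BornFourierDefined ((i :: L).map f) := by
  intro ξ hξ
  have hk := waveNumber_pos hξ
  have hec := (continuous_incoming ξ).aestronglyMeasurable (μ := (volume : Measure (Eu n)))
  obtain ⟨h1, h2⟩ := bornChain_ae_eq hE hR hk hec (fun y => (norm_incoming ξ y).le) i L h hsum
  refine ⟨h1, ?_⟩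
  have h3 := integrable_chain hE.rho_pos.le (memLp_localGreen hE hR hk) hec
    (fun y => (norm_incoming ξ y).le) i L h hsum
  exact (h3.congr h2.symm).bdd_mul (c := 1) hec
    (Eventually.of_forall fun y => (norm_incoming ξ y).le)

lemma bornFourier_eq (hE : Exponents n ρ σ) (hR : 0 < R) (i : ι) (L : List ι)
    (h : ∀ a ∈ i :: L, Factor ρ R (c a) (f a)) (hsum : ρ + ((i :: L).map c).sum ≤ 1)
    {ξ : Eu n} (hξ : ξ ≠ 0) :
    bornFourier ((i :: L).map f) ξ =
      ∫ y, incoming ξ y * chain (localGreen R (waveNumber ξ)) (incoming ξ) ((i :: L).map f) y := by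
  have hk := waveNumber_pos hξ
  have hec := (continuous_incoming ξ).aestronglyMeasurable (μ := (volume : Measure (Eu n)))
  obtain ⟨h1, h2⟩ := bornChain_ae_eq hE hR hk hec (fun y => (norm_incoming ξ y).le) i L h hsum
  refine integral_congr_ae ?_
  filter_upwards [h2] with y hy
  rw [bornIntegrand, hy]

lemma norm_integral_incoming_mul_le {u : Eu n → ℂ} (ξ : Eu n) :
    ‖∫ y, incoming ξ y * u y‖ₑ ≤ eLpNorm u 1 volume := by
  refine (enorm_integral_le_lintegral_enorm _).trans (le_of_eq ?_)
  rw [eLpNorm_one_eq_lintegral_enorm]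
  refine lintegral_congr fun y => ?_
  rw [enorm_mul, ← ofReal_norm, norm_incoming, ENNReal.ofReal_one, one_mul]

/-- Born integrals are bounded by powers of the wave number, one for small and one for large
frequencies. -/
lemma exists_norm_bornFourier_le (hE : Exponents n ρ σ) (hR : 0 < R) (i : ι) (L : List ι)
    (h : ∀ a ∈ i :: L, Factor ρ R (c a) (f a)) (hsum : ρ + ((i :: L).map c).sum = 1) :
    ∃ D : ℝ, 0 ≤ D ∧ ∀ ξ : Eu n, ξ ≠ 0 → ‖bornFourier ((i :: L).map f) ξ‖ ≤
      D * (waveNumber ξ ^ ((n : ℝ) - 2 - σ) + waveNumber ξ ^ (n : ℝ)) ^ L.length := by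
  obtain ⟨D, hD, hb⟩ := exists_eLpNorm_chain_le hE.rho_pos.le i L h hsum.le
  obtain ⟨N, hN, hg⟩ := exists_eLpNorm_localGreen_le (n := n) hE hR
  refine ⟨D.toReal * N ^ L.length, by positivity, fun ξ hξ => ?_⟩
  have hk := waveNumber_pos hξ
  have hec := (continuous_incoming ξ).aestronglyMeasurable (μ := (volume : Measure (Eu n)))
  have h1 := hb (localGreen R (waveNumber ξ)) (incoming ξ)
    (measurable_localGreen _ _).aestronglyMeasurable hec (fun y => (norm_incoming ξ y).le)
  rw [hsum, recipExp_one] at h1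
  set Y : ℝ := waveNumber ξ ^ ((n : ℝ) - 2 - σ) + waveNumber ξ ^ (n : ℝ) with hY
  have hY0 : 0 ≤ Y := by positivity
  have h2 : ‖bornFourier ((i :: L).map f) ξ‖ₑ ≤
      ENNReal.ofReal (D.toReal * N ^ L.length * Y ^ L.length) := by
    rw [bornFourier_eq hE hR i L h hsum.le hξ]
    refine (norm_integral_incoming_mul_le ξ).trans (h1.trans ?_)
    rw [mul_assoc, ← mul_pow, ENNReal.ofReal_mul (by positivity), ENNReal.ofReal_toReal hD,
      ENNReal.ofReal_pow (by positivity)]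
    gcongr
    exact hg _ hk
  rw [← ofReal_norm] at h2
  exact (ENNReal.ofReal_le_ofReal_iff (by positivity)).1 h2

/-- Since `resolvent` is obtained by choice, the measurability of a Born integral in the frequency is
read off from its expression through the fundamental solution, with Borel measurable factors. -/
lemma exists_measurable_bornFourier (hE : Exponents n ρ σ) (hR : 0 < R) (i : ι) (L : List ι)
    (h : ∀ a ∈ i :: L, Factor ρ R (c a) (f a)) (hsum : ρ + ((i :: L).map c).sum ≤ 1) :
    ∃ w : Eu n → ℂ, Measurable w ∧ ∀ ξ : Eu n, ξ ≠ 0 → bornFourier ((i :: L).map f) ξ = w ξ := by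
  classical
  set f' : ι → Eu n → ℂ := fun a =>
    if ha : AEStronglyMeasurable (f a) (volume : Measure (Eu n)) then ha.mk else 0 with hf'
  have hmeas : ∀ a, Measurable (f' a) := by
    intro a
    simp only [hf']
    split_ifs with ha
    · exact ha.stronglyMeasurable_mk.measurable
    · exact measurable_const
  have hae : ∀ a ∈ i :: L, f a =ᵐ[volume] f' a := by
    intro a ha
    have := (h a ha).memLp.1
    simp only [hf', dif_pos this]
    exact this.ae_eq_mk
  have hwm : Measurable fun ξ : Eu n => waveNumber ξ := by
    unfold waveNumber; fun_prop
  have hK : Measurable fun p : Eu n × Eu n => (green (waveNumber p.1) 0 p.2 : ℂ) :=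
    measurable_green_zero.comp (f := fun p : Eu n × Eu n => (waveNumber p.1, p.2))
      ((hwm.comp measurable_fst).prodMk measurable_snd)
  have hjoint := measurable_chain_param (Ξ := Eu n) (K := fun ξ => green (waveNumber ξ) 0)
    (e := incoming) hK measurable_incoming_uncurry (i :: L) fun a _ => hmeas a
  refine ⟨fun ξ => ∫ y, incoming ξ y *
    chain (green (waveNumber ξ) 0) (incoming ξ) ((i :: L).map f') y, ?_, fun ξ hξ => ?_⟩
  · exact ((measurable_incoming_uncurry.mul hjoint).stronglyMeasurable.integral_prod_right'
      (ν := volume)).measurable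
  · rw [bornFourier_eq hE hR i L h hsum hξ]
    refine integral_congr_ae ?_
    have h1 : chain (localGreen R (waveNumber ξ)) (incoming ξ) ((i :: L).map f) =ᵐ[volume]
        chain (green (waveNumber ξ) 0) (incoming ξ) ((i :: L).map f) :=
      chain_congr_kernel (fun x hx => (localGreen_eq x hx).symm) _ fun a ha => (h a ha).supp
    filter_upwards [h1.trans (chain_congr (i :: L) hae)] with y hy
    rw [hy]

/-- An integrable singularity at the origin and polynomial growth at infinity are tempered. -/
lemma isTempered_of_norm_le (hn : 1 ≤ n) {u w : Eu n → ℂ} (hw : Measurable w)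
    (huw : ∀ ζ, ζ ≠ 0 → u ζ = w ζ) {A a : ℝ} {N : ℕ} (ha : 0 ≤ a) (han : a < n) (hA : 0 ≤ A)
    (hb : ∀ ζ, ζ ≠ 0 → ‖u ζ‖ ≤ A * (‖ζ‖ ^ (-a) + (1 + ‖ζ‖) ^ N)) : IsTempered u := by
  refine isTempered_of_integrable (N + (n + 1)) ?_
  have hae : (fun x : Eu n => ((1 + ‖x‖) ^ (N + (n + 1)))⁻¹ • w x) =ᵐ[volume]
      fun x => ((1 + ‖x‖) ^ (N + (n + 1)))⁻¹ • u x := by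
    filter_upwards [ae_ne_zero hn] with x hx
    rw [huw x hx]
  have hm : AEStronglyMeasurable (fun x : Eu n => ((1 + ‖x‖) ^ (N + (n + 1)))⁻¹ • u x) volume := by
    refine AEStronglyMeasurable.congr (Measurable.aestronglyMeasurable ?_) hae
    have h1 : Measurable fun x : Eu n => ((1 + ‖x‖) ^ (N + (n + 1)))⁻¹ := by fun_prop
    exact h1.smul hw
  have hone : Integrable fun x : Eu n => (1 + ‖x‖) ^ (-((n : ℝ) + 1)) :=
    integrable_one_add_norm (by simp)
  have hball : Integrable ((Metric.ball (0 : Eu n) 1).indicator fun x => ‖x‖ ^ (-a)) := by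
    refine (integrable_indicator_iff Metric.isOpen_ball.measurableSet).2 ?_
    refine integrableOn_ball_of_norm_le_rpow (C := 1) (α := a) (by simpa using hn)
      (by simpa using han) (Eventually.of_forall fun x => ?_)
      (by fun_prop : Measurable fun x : Eu n => ‖x‖ ^ (-a)).aestronglyMeasurable
    rw [one_mul, Real.norm_of_nonneg (by positivity)]
  refine ((hball.add (hone.const_mul 2)).const_mul A).mono' hm ?_
  filter_upwards [ae_ne_zero hn] with x hx
  have hx0 : 0 < ‖x‖ := norm_pos_iff.2 hx
  have e3 : (1 + ‖x‖) ^ (-((n : ℝ) + 1)) = ((1 + ‖x‖) ^ (n + 1))⁻¹ := by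
    rw [Real.rpow_neg (by positivity)]
    have : ((n : ℝ) + 1) = ((n + 1 : ℕ) : ℝ) := by push_cast; rfl
    rw [this, Real.rpow_natCast]
  rw [norm_smul, norm_inv, norm_pow, Real.norm_of_nonneg (by positivity : (0 : ℝ) ≤ 1 + ‖x‖)]
  simp only [Pi.add_apply]
  rw [e3]
  set P := (1 + ‖x‖) ^ N with hP
  set S := (1 + ‖x‖) ^ (n + 1) with hS
  have hP1 : 1 ≤ P := one_le_pow₀ (by linarith)
  have hS1 : 1 ≤ S := one_le_pow₀ (by linarith)
  rw [pow_add, mul_inv]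
  have hkey : P⁻¹ * S⁻¹ * (‖x‖ ^ (-a) + P) ≤
      (Metric.ball (0 : Eu n) 1).indicator (fun x => ‖x‖ ^ (-a)) x + 2 * S⁻¹ := by
    have hi : P⁻¹ ≤ 1 := inv_le_one_of_one_le₀ hP1
    have hi2 : S⁻¹ ≤ 1 := inv_le_one_of_one_le₀ hS1
    have hP0 : 0 < P := by linarith
    have hS0 : 0 < S := by linarith
    have e1 : P⁻¹ * S⁻¹ * P = S⁻¹ := by field_simp
    rw [mul_add, e1]
    have hX : 0 ≤ ‖x‖ ^ (-a) := by positivity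
    by_cases hxb : x ∈ Metric.ball (0 : Eu n) 1
    · rw [Set.indicator_of_mem hxb]
      have : P⁻¹ * S⁻¹ * ‖x‖ ^ (-a) ≤ 1 * 1 * ‖x‖ ^ (-a) := by gcongr
      have : 0 ≤ S⁻¹ := by positivity
      linarith
    · rw [Set.indicator_of_notMem hxb]
      have hx1 : 1 ≤ ‖x‖ := by simpa using hxb
      have : ‖x‖ ^ (-a) ≤ 1 := Real.rpow_le_one_of_one_le_of_nonpos hx1 (by linarith)
      have : P⁻¹ * S⁻¹ * ‖x‖ ^ (-a) ≤ 1 * S⁻¹ * 1 := by gcongr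
      linarith
  calc _ ≤ P⁻¹ * S⁻¹ * (A * (‖x‖ ^ (-a) + P)) := by gcongr; exact hb x hx
    _ = A * (P⁻¹ * S⁻¹ * (‖x‖ ^ (-a) + P)) := by ring
    _ ≤ _ := by gcongr

lemma waveNumber_two_pi (ζ : Eu n) : waveNumber ((2 * Real.pi) • ζ) = Real.pi * ‖ζ‖ := by
  rw [waveNumber, norm_smul, Real.norm_of_nonneg (by positivity)]
  ring

lemma two_pi_smul_ne_zero {ζ : Eu n} (hζ : ζ ≠ 0) : (2 * Real.pi) • ζ ≠ 0 :=
  smul_ne_zero (by positivity) hζ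

/-- The full Born symbols are tempered as soon as their singularity at the origin is integrable. -/
lemma isTempered_bornSymbol (hE : Exponents n ρ σ) (hR : 0 < R) (i : ι) (L : List ι)
    (h : ∀ a ∈ i :: L, Factor ρ R (c a) (f a)) (hsum : ρ + ((i :: L).map c).sum = 1)
    (hL : (σ - n + 2) * L.length < n) : IsTempered (bornSymbol ((i :: L).map f)) := by
  obtain ⟨D, hD, hb⟩ := exists_norm_bornFourier_le hE hR i L h hsum
  obtain ⟨w, hw, hbw⟩ := exists_measurable_bornFourier hE hR i L h hsum.le
  set δ : ℝ := σ - n + 2 with hδ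
  have hδ0 : 0 < δ := by linarith [hE.lt_sigma]
  set l := L.length with hl
  have hpi := Real.pi_gt_three
  refine isTempered_of_norm_le hE.dim (w := fun ζ => w ((2 * Real.pi) • ζ)) (a := δ * l)
    (N := n * l) (A := D * (2 ^ l * (Real.pi ^ n) ^ l)) (hw.comp (measurable_const_smul _))
    (fun ζ hζ => hbw _ (two_pi_smul_ne_zero hζ)) (by positivity) hL (by positivity)
    fun ζ hζ => ?_
  have h1 := hb _ (two_pi_smul_ne_zero hζ)
  rw [waveNumber_two_pi] at h1
  have hz : 0 < ‖ζ‖ := norm_pos_iff.2 hζ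
  refine h1.trans ?_
  rw [mul_assoc]
  refine mul_le_mul_of_nonneg_left ?_ hD
  have e1 : (Real.pi * ‖ζ‖) ^ ((n : ℝ) - 2 - σ) ≤ Real.pi ^ n * ‖ζ‖ ^ (-δ) := by
    have : (n : ℝ) - 2 - σ = -δ := by rw [hδ]; ring
    rw [this, Real.mul_rpow (by positivity) hz.le]
    gcongr
    calc Real.pi ^ (-δ) ≤ 1 := Real.rpow_le_one_of_one_le_of_nonpos (by linarith) (by linarith)
      _ ≤ _ := one_le_pow₀ (by linarith)
  have e2 : (Real.pi * ‖ζ‖) ^ (n : ℝ) = Real.pi ^ n * ‖ζ‖ ^ n := by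
    rw [Real.rpow_natCast, mul_pow]
  have e3 : (‖ζ‖ ^ (-δ)) ^ l = ‖ζ‖ ^ (-(δ * l)) := by
    rw [← Real.rpow_natCast, ← Real.rpow_mul hz.le, neg_mul]
  calc _ ≤ (Real.pi ^ n * ‖ζ‖ ^ (-δ) + Real.pi ^ n * ‖ζ‖ ^ n) ^ l := by
        rw [← e2]
        gcongr
    _ = (Real.pi ^ n) ^ l * (‖ζ‖ ^ (-δ) + ‖ζ‖ ^ n) ^ l := by rw [← mul_add, mul_pow]
    _ ≤ (Real.pi ^ n) ^ l * (2 ^ l * ((‖ζ‖ ^ (-δ)) ^ l + (‖ζ‖ ^ n) ^ l)) := by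
        gcongr
        refine (add_pow_le (by positivity) (by positivity) l).trans ?_
        gcongr
        · norm_num
        · omega
    _ ≤ (Real.pi ^ n) ^ l * (2 ^ l * (‖ζ‖ ^ (-(δ * l)) + (1 + ‖ζ‖) ^ (n * l))) := by
        have e4 : (‖ζ‖ ^ n) ^ l ≤ (1 + ‖ζ‖) ^ (n * l) := by
          rw [← pow_mul]
          exact pow_le_pow_left₀ hz.le (by linarith) _
        rw [e3]
        gcongr
    _ = _ := by ring

lemma IsHighFrequencyCutoff.exists_bound {C₀ : ℝ} {χ : ℝ → ℝ} (hχ : IsHighFrequencyCutoff C₀ χ) :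
    ∃ B, 0 ≤ B ∧ ∀ t, |χ t| ≤ B := by
  obtain ⟨B, hB⟩ := (isCompact_Icc (a := C₀) (b := 2 * C₀)).exists_bound_of_continuousOn
    hχ.smooth.continuous.continuousOn
  refine ⟨max B 1, le_max_of_le_right zero_le_one, fun t => ?_⟩
  rcases lt_or_ge t C₀ with h1 | h1
  · rw [hχ.eq_zero t h1, abs_zero]
    exact le_max_of_le_right zero_le_one
  rcases le_or_gt (2 * C₀) t with h2 | h2
  · rw [hχ.eq_one t h2, abs_one]
    exact le_max_right _ _
  · exact (hB t ⟨h1, h2.le⟩).trans (le_max_left _ _)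

/-- The truncated Born symbols are always tempered, as the cutoff removes the singularity at the
origin. -/
lemma isTempered_bornSymbolCut (hE : Exponents n ρ σ) (hR : 0 < R) (i : ι) (L : List ι)
    (h : ∀ a ∈ i :: L, Factor ρ R (c a) (f a)) (hsum : ρ + ((i :: L).map c).sum = 1)
    {C₀ : ℝ} {χ : ℝ → ℝ} (hC₀ : 0 < C₀) (hχ : IsHighFrequencyCutoff C₀ χ) :
    IsTempered (bornSymbolCut χ ((i :: L).map f)) := by
  obtain ⟨D, hD, hb⟩ := exists_norm_bornFourier_le hE hR i L h hsum
  obtain ⟨w, hw, hbw⟩ := exists_measurable_bornFourier hE hR i L h hsum.le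
  obtain ⟨B, hB, hχB⟩ := hχ.exists_bound
  set l := L.length with hl
  have hpi := Real.pi_gt_three
  set q : ℝ := C₀ ^ ((n : ℝ) - 2 - σ) with hq
  have hq0 : 0 ≤ q := by positivity
  have hn' : (0 : ℝ) < n := by exact_mod_cast hE.dim
  have hm : Measurable fun ζ : Eu n =>
      (χ (‖(2 * Real.pi) • ζ‖ / 2) : ℂ) * w ((2 * Real.pi) • ζ) := by
    have h1 : Measurable χ := hχ.smooth.continuous.measurable
    have h2 : Measurable fun ζ : Eu n => ‖(2 * Real.pi) • ζ‖ / 2 := by fun_prop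
    exact (Complex.measurable_ofReal.comp (h1.comp h2)).mul (hw.comp (measurable_const_smul _))
  refine isTempered_of_norm_le hE.dim (w := _) (a := 0)
    (N := n * l) (A := B * (D * (q + Real.pi ^ n) ^ l)) hm
    (fun ζ hζ => by rw [bornSymbolCut, bornSymbol, hbw _ (two_pi_smul_ne_zero hζ)])
    le_rfl hn' (by positivity) fun ζ hζ => ?_
  rw [bornSymbolCut, norm_mul, Complex.norm_real, Real.norm_eq_abs]
  rcases lt_or_ge (‖(2 * Real.pi) • ζ‖ / 2) C₀ with h1 | h1
  · rw [hχ.eq_zero _ h1, abs_zero, zero_mul]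
    positivity
  have h2 := hb _ (two_pi_smul_ne_zero hζ)
  rw [waveNumber_two_pi] at h2
  have h3 : C₀ ≤ Real.pi * ‖ζ‖ := by
    rw [← waveNumber_two_pi]; exact h1
  have hz : 0 < ‖ζ‖ := norm_pos_iff.2 hζ
  have e1 : (Real.pi * ‖ζ‖) ^ ((n : ℝ) - 2 - σ) ≤ q * (1 + ‖ζ‖) ^ n := by
    calc _ ≤ q := Real.rpow_le_rpow_of_nonpos hC₀ h3 (by linarith [hE.lt_sigma])
      _ ≤ _ := le_mul_of_one_le_right hq0 (one_le_pow₀ (by linarith))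
  have e2 : (Real.pi * ‖ζ‖) ^ (n : ℝ) ≤ Real.pi ^ n * (1 + ‖ζ‖) ^ n := by
    rw [Real.rpow_natCast, mul_pow]
    gcongr
    linarith
  calc _ ≤ B * (D * ((Real.pi * ‖ζ‖) ^ ((n : ℝ) - 2 - σ) + (Real.pi * ‖ζ‖) ^ (n : ℝ)) ^ l) :=
        mul_le_mul (hχB _) h2 (norm_nonneg _) hB
    _ ≤ B * (D * ((q + Real.pi ^ n) * (1 + ‖ζ‖) ^ n) ^ l) := by
        gcongr
        rw [add_mul]
        exact add_le_add e1 e2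
    _ = B * (D * (q + Real.pi ^ n) ^ l) * (1 + ‖ζ‖) ^ (n * l) := by
        rw [mul_pow, ← pow_mul]; ring
    _ ≤ _ := by
        gcongr
        have : 0 ≤ ‖ζ‖ ^ (-(0 : ℝ)) := by positivity
        linarith

/-! ### The Leibniz rule for chains of test functions -/

/-- The lists obtained from `L` by applying `s` to one entry. -/
def leibniz {ι : Type*} (s : ι → ι) : List ι → List (List ι)
  | [] => []
  | a :: L => (s a :: L) :: (leibniz s L).map (a :: ·)

lemma mem_of_mem_leibniz {ι : Type*} {s : ι → ι} {L L' : List ι} (h : L' ∈ leibniz s L) {b : ι}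
    (hb : b ∈ L') : b ∈ L ∨ ∃ a ∈ L, b = s a := by
  induction L generalizing L' with
  | nil => simp [leibniz] at h
  | cons a L ih =>
    rw [leibniz, List.mem_cons, List.mem_map] at h
    rcases h with rfl | ⟨L'', h1, rfl⟩
    · rcases List.mem_cons.1 hb with rfl | hb
      · exact Or.inr ⟨a, by simp, rfl⟩
      · exact Or.inl (List.mem_cons_of_mem _ hb)
    · rcases List.mem_cons.1 hb with rfl | hb
      · exact Or.inl (by simp)
      · rcases ih h1 hb with h2 | ⟨a', h2, h3⟩
        · exact Or.inl (List.mem_cons_of_mem _ h2)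
        · exact Or.inr ⟨a', List.mem_cons_of_mem _ h2, h3⟩

lemma length_of_mem_leibniz {ι : Type*} {s : ι → ι} {L L' : List ι} (h : L' ∈ leibniz s L) :
    L'.length = L.length := by
  induction L generalizing L' with
  | nil => simp [leibniz] at h
  | cons a L ih =>
    rw [leibniz, List.mem_cons, List.mem_map] at h
    rcases h with rfl | ⟨L'', h1, rfl⟩
    · rfl
    · simp [ih h1]

/-- Compactly supported functions of class `C¹`. -/
structure IsTest (f : Eu n → ℂ) : Prop where
  contDiff : ContDiff ℝ 1 f
  compact : HasCompactSupport f

namespace IsTest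

variable {f g K e : Eu n → ℂ}

lemma integrable (hf : IsTest f) : Integrable f :=
  hf.contDiff.continuous.integrable_of_hasCompactSupport hf.compact

lemma mul_smooth (hf : IsTest f) (hg : ContDiff ℝ 1 g) : IsTest (fun x => f x * g x) :=
  ⟨hf.contDiff.mul hg, hf.compact.mul_right⟩

end IsTest

lemma convOp_eq_convolution_mul (K g : Eu n → ℂ) :
    convOp K g = convolution K g (ContinuousLinearMap.mul ℝ ℂ) volume := by
  ext x
  rw [convolution_eq_swap]
  rfl

lemma contDiff_convOp {K g : Eu n → ℂ} (hK : Integrable K) (hg : IsTest g) :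
    ContDiff ℝ 1 (convOp K g) := by
  rw [convOp_eq_convolution_mul]
  exact hg.compact.contDiff_convolution_right (n := 1) _ hK.locallyIntegrable hg.contDiff

lemma fderiv_convOp {K g : Eu n → ℂ} (hK : Integrable K) (hg : IsTest g) (x v : Eu n) :
    fderiv ℝ (convOp K g) x v = convOp K (fun y => fderiv ℝ g y v) x := by
  rw [convOp_eq_convolution_mul, convOp_eq_convolution_mul]
  rw [(hg.compact.hasFDerivAt_convolution_right (ContinuousLinearMap.mul ℝ ℂ) hK.locallyIntegrable
    hg.contDiff x).fderiv]
  exact convolution_precompR_apply (ContinuousLinearMap.mul ℝ ℂ) hK.locallyIntegrable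
    (hg.compact.fderiv ℝ) (hg.contDiff.continuous_fderiv one_ne_zero) x v

lemma integrable_conv_test {K g : Eu n → ℂ} (hK : Integrable K) (hg : IsTest g) (x : Eu n) :
    Integrable fun y => K (x - y) * g y := by
  have h := hg.compact.convolutionExists_right (ContinuousLinearMap.mul ℝ ℂ) hK.locallyIntegrable
    hg.contDiff.continuous x
  exact h.integrable_swap

variable {ι : Type*} {f : ι → Eu n → ℂ} {K e : Eu n → ℂ}

lemma isTest_chain (hK : Integrable K) (he : ContDiff ℝ 1 e) (L : List ι)
    (h : ∀ a ∈ L, IsTest (f a)) : IsTest (chain K e (L.map f)) := by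
  induction L with
  | nil => exact ⟨contDiff_const, HasCompactSupport.zero⟩
  | cons i L ih =>
    have ih' := ih fun a ha => h a (List.mem_cons_of_mem i ha)
    cases L with
    | nil => exact (h i (by simp)).mul_smooth he
    | cons i' L => exact (h i (by simp)).mul_smooth (contDiff_convOp hK ih')

lemma convOp_add_sum {l : List (List ι)} {G : List ι → Eu n → ℂ} {g : Eu n → ℂ} (z : ℂ) {x : Eu n}
    (hg : Integrable fun y => K (x - y) * g y)
    (hG : ∀ L ∈ l, Integrable fun y => K (x - y) * G L y) :
    Integrable (fun y => K (x - y) * (z * g y + (l.map fun L => G L y).sum)) ∧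
    convOp K (fun y => z * g y + (l.map fun L => G L y).sum) x =
      z * convOp K g x + (l.map fun L => convOp K (G L) x).sum := by
  induction l with
  | nil =>
    simp only [List.map_nil, List.sum_nil, add_zero, convOp, mul_left_comm (K _) z]
    exact ⟨hg.const_mul z, integral_const_mul _ _⟩
  | cons L l ih =>
    obtain ⟨h1, h2⟩ := ih fun L' hL' => hG L' (List.mem_cons_of_mem L hL')
    have h3 := hG L (by simp)
    have h4 : ∀ y, K (x - y) * (z * g y + (((L :: l).map fun L => G L y).sum)) =
        K (x - y) * G L y + K (x - y) * (z * g y + ((l.map fun L => G L y).sum)) := fun y => by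
      rw [List.map_cons, List.sum_cons]; ring
    simp only [convOp] at h2 ⊢
    simp_rw [h4]
    refine ⟨h3.add h1, ?_⟩
    rw [integral_add h3 h1, h2, List.map_cons, List.sum_cons]
    ring

/-- The derivative of a chain falls on the incoming wave, which is an eigenfunction of the
derivative, or on one of the factors; convolutions commute with it. -/
lemma fderiv_chain (hK : Integrable K) (he : ContDiff ℝ 1 e) {v : Eu n} {z : ℂ}
    (hev : ∀ x, fderiv ℝ e x v = z * e x) {s : ι → ι} (i : ι) (L : List ι)
    (h : ∀ a ∈ i :: L, IsTest (f a)) (hs : ∀ a ∈ i :: L, IsTest (f (s a)))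
    (hd : ∀ a ∈ i :: L, ∀ x, fderiv ℝ (f a) x v = f (s a) x) (x : Eu n) :
    fderiv ℝ (chain K e ((i :: L).map f)) x v = z * chain K e ((i :: L).map f) x +
      ((leibniz s (i :: L)).map fun L' => chain K e (L'.map f) x).sum := by
  have hmul : ∀ {u w : Eu n → ℂ} (x : Eu n), ContDiff ℝ 1 u → ContDiff ℝ 1 w →
      fderiv ℝ (fun y => u y * w y) x v = u x * fderiv ℝ w x v + w x * fderiv ℝ u x v := by
    intro u w x hu hw
    rw [fderiv_fun_mul (hu.differentiable one_ne_zero x) (hw.differentiable one_ne_zero x)]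
    simp
  induction L generalizing i x with
  | nil =>
    have hi := h i (by simp)
    have e1 : chain K e ([i].map f) = fun y => f i y * e y := rfl
    rw [e1, hmul x hi.contDiff he, hev, hd i (by simp)]
    simp [leibniz, chain]
    ring
  | cons i' L ih =>
    have hi := h i (by simp)
    have h' : ∀ a ∈ i' :: L, IsTest (f a) := fun a ha => h a (List.mem_cons_of_mem i ha)
    have hs' : ∀ a ∈ i' :: L, IsTest (f (s a)) := fun a ha => hs a (List.mem_cons_of_mem i ha)
    have ih' := ih i' h' hs' fun a ha => hd a (List.mem_cons_of_mem i ha)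
    have hC := isTest_chain hK he (i' :: L) h'
    have e1 : ∀ (a : ι) (M : List ι), M ≠ [] → chain K e ((a :: M).map f) =
        fun y => f a y * convOp K (chain K e (M.map f)) y := by
      intro a M hM
      cases M with
      | nil => exact absurd rfl hM
      | cons b M => rfl
    have hlen : ∀ L' ∈ leibniz s (i' :: L), L' ≠ [] := by
      intro L' hL' h0
      have := length_of_mem_leibniz hL'
      rw [h0] at this
      simp at this
    have htest : ∀ L' ∈ leibniz s (i' :: L), IsTest (chain K e (L'.map f)) := by
      intro L' hL'
      refine isTest_chain hK he L' fun b hb => ?_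
      rcases mem_of_mem_leibniz hL' hb with h1 | ⟨a, h1, rfl⟩
      · exact h' b h1
      · exact hs' a h1
    rw [e1 i (i' :: L) (by simp), hmul x hi.contDiff (contDiff_convOp hK hC), fderiv_convOp hK hC,
      hd i (by simp)]
    have e2 : (fun y => fderiv ℝ (chain K e ((i' :: L).map f)) y v) = fun y =>
        z * chain K e ((i' :: L).map f) y +
          ((leibniz s (i' :: L)).map fun L' => chain K e (L'.map f) y).sum := funext ih'
    rw [e2, (convOp_add_sum z (integrable_conv_test hK hC x)
      fun L' hL' => integrable_conv_test hK (htest L' hL') x).2]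
    have e3 : leibniz s (i :: i' :: L) =
        (s i :: i' :: L) :: (leibniz s (i' :: L)).map (i :: ·) := rfl
    rw [e3, List.map_cons (f := fun L' : List ι => chain K e (L'.map f) x), List.sum_cons, List.map_map,
      e1 (s i) (i' :: L) (by simp)]
    have e4 : ((leibniz s (i' :: L)).map ((fun L' => chain K e (L'.map f) x) ∘ (i :: ·))).sum =
        f i x * ((leibniz s (i' :: L)).map fun L' => convOp K (chain K e (L'.map f)) x).sum := by
      rw [← List.sum_map_mul_left]
      congr 1
      refine List.map_congr_left fun L' hL' => ?_
      simp only [Function.comp_apply]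
      rw [e1 i L' (hlen L' hL')]
    rw [e4]
    ring

lemma integral_sum_list {l : List (List ι)} {G : List ι → Eu n → ℂ} (h : ∀ L ∈ l, Integrable (G L)) :
    Integrable (fun y => (l.map fun L => G L y).sum) ∧
    ∫ y, (l.map fun L => G L y).sum = (l.map fun L => ∫ y, G L y).sum := by
  induction l with
  | nil => simp
  | cons L l ih =>
    obtain ⟨h1, h2⟩ := ih fun L' hL' => h L' (List.mem_cons_of_mem L hL')
    simp only [List.map_cons, List.sum_cons]
    exact ⟨(h L (by simp)).add h1, by rw [integral_add (h L (by simp)) h1, h2]⟩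

/-- Integration by parts turns the Leibniz rule for chains into a multiplication rule for the
Born integrals. -/
lemma integral_leibniz (hK : Integrable K) (he : ContDiff ℝ 1 e) {v : Eu n} {z : ℂ}
    (hev : ∀ x, fderiv ℝ e x v = z * e x) {s : ι → ι} (i : ι) (L : List ι)
    (h : ∀ a ∈ i :: L, IsTest (f a)) (hs : ∀ a ∈ i :: L, IsTest (f (s a)))
    (hd : ∀ a ∈ i :: L, ∀ x, fderiv ℝ (f a) x v = f (s a) x) :
    -(2 * z) * ∫ y, e y * chain K e ((i :: L).map f) y =
      ((leibniz s (i :: L)).map fun L' => ∫ y, e y * chain K e (L'.map f) y).sum := by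
  have hC := isTest_chain hK he (i :: L) h
  have htest : ∀ L' ∈ leibniz s (i :: L), IsTest (chain K e (L'.map f)) := by
    intro L' hL'
    refine isTest_chain hK he L' fun b hb => ?_
    rcases mem_of_mem_leibniz hL' hb with h1 | ⟨a, h1, rfl⟩
    · exact h b h1
    · exact hs a h1
  have hint : ∀ {u : Eu n → ℂ}, IsTest u → Integrable fun y => e y * u y := by
    intro u hu
    have := (hu.mul_smooth he).integrable
    simpa only [mul_comm] using this
  have hsum := integral_sum_list (l := leibniz s (i :: L))
    (G := fun L' y => e y * chain K e (L'.map f) y) fun L' hL' => hint (htest L' hL')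
  have e1 : ∀ y, e y * fderiv ℝ (chain K e ((i :: L).map f)) y v =
      z * (e y * chain K e ((i :: L).map f) y) +
        ((leibniz s (i :: L)).map fun L' => e y * chain K e (L'.map f) y).sum := by
    intro y
    rw [fderiv_chain hK he hev i L h hs hd, List.sum_map_mul_left]
    ring
  have e2 : ∀ y, fderiv ℝ e y v * chain K e ((i :: L).map f) y =
      z * (e y * chain K e ((i :: L).map f) y) := fun y => by rw [hev]; ring
  have key := integral_mul_fderiv_eq_neg_fderiv_mul_of_integrable (𝕜 := ℂ)
    (μ := (volume : Measure (Eu n))) (f := e) (g := chain K e ((i :: L).map f)) (v := v)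
    (by simp_rw [e2]; exact (hint hC).const_mul z)
    (by simp_rw [e1]; exact ((hint hC).const_mul z).add hsum.1)
    (hint hC) (fun x _ => he.differentiable one_ne_zero x)
    (fun x _ => hC.contDiff.differentiable one_ne_zero x)
  simp_rw [e1, e2] at key
  rw [integral_add ((hint hC).const_mul z) hsum.1, integral_const_mul, hsum.2] at key
  linear_combination -key

/-! ### The Leibniz rule for Sobolev potentials -/

/-- The sum of the orders of the multi-indices in a list. -/
def totalOrder (L : List (Fin n → ℕ)) : ℕ := (L.map fun β => ∑ i, β i).sum

lemma order_le_totalOrder {L : List (Fin n → ℕ)} {β : Fin n → ℕ} (h : β ∈ L) :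
    ∑ i, β i ≤ totalOrder L :=
  List.le_sum_of_mem (List.mem_map.2 ⟨β, h, rfl⟩)

lemma totalOrder_of_mem_leibniz {i : Fin n} {L L' : List (Fin n → ℕ)}
    (h : L' ∈ leibniz (fun β => β + Pi.single i 1) L) : totalOrder L' = totalOrder L + 1 := by
  induction L generalizing L' with
  | nil => simp [leibniz] at h
  | cons β L ih =>
    rw [leibniz, List.mem_cons, List.mem_map] at h
    rcases h with rfl | ⟨L'', h1, rfl⟩
    · simp only [totalOrder, List.map_cons, List.sum_cons]
      rw [sum_add_single]
      ring
    · have := ih h1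
      simp only [totalOrder, List.map_cons, List.sum_cons] at this ⊢
      omega

/-- A family of functions behaving like the weak derivatives up to order `m` of a compactly
supported Sobolev function, with the exponents needed to control multiple scattering. -/
structure Setting (m : ℕ) (ρ κ σ R : ℝ) (v : (Fin n → ℕ) → Eu n → ℂ) : Prop where
  jet : WeakJet m R v
  radius_pos : 0 < R
  exps : Exponents n ρ σ
  kappa_nonneg : 0 ≤ κ
  le_half : ρ + m * κ ≤ 1 / 2
  memLp : ∀ β, ∑ i, β i ≤ m → MemLp (v β) (recipExp (ρ + (∑ i, β i : ℕ) * κ)) volume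

/-- The exponents attached to the entries of a list: what is left of `1 - ρ` after the share
`|β| κ` of every `β` is distributed evenly, so that the total is `1 - ρ`. -/
def listExp (ρ κ : ℝ) (L : List (Fin n → ℕ)) (β : Fin n → ℕ) : ℝ :=
  (∑ i, β i : ℕ) * κ + (1 - ρ - totalOrder L * κ) / L.length

lemma sum_map_listExp {ρ κ : ℝ} {L : List (Fin n → ℕ)} (hL : L ≠ []) :
    ρ + (L.map (listExp ρ κ L)).sum = 1 := by
  have h : ∀ (M : List (Fin n → ℕ)) (t : ℝ),
      (M.map fun β => ((∑ i, β i : ℕ) : ℝ) * κ + t).sum = totalOrder M * κ + M.length * t := by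
    intro M t
    induction M with
    | nil => simp [totalOrder]
    | cons β M ih =>
      simp only [totalOrder, List.map_cons, List.sum_cons, List.length_cons] at ih ⊢
      rw [ih]
      push_cast
      ring
  have hlen : (L.length : ℝ) ≠ 0 := by
    simpa using hL
  unfold listExp
  rw [h]
  field_simp
  ring

namespace Setting

variable {m : ℕ} {ρ κ σ R : ℝ} {v : (Fin n → ℕ) → Eu n → ℂ}

/-- The exponents attached to the entries leave room for the integrability of the derivatives, since
`ρ + m κ ≤ 1/2`. -/
lemma listExp_bounds (S : Setting m ρ κ σ R v) {L : List (Fin n → ℕ)} (hL : L ≠ [])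
    (hm : totalOrder L ≤ m) {β : Fin n → ℕ} (hβ : β ∈ L) :
    (∑ i, β i : ℕ) * κ < listExp ρ κ L β ∧ ρ + listExp ρ κ L β ≤ 1 := by
  have hlen : (0 : ℝ) < L.length := by
    have : 0 < L.length := List.length_pos_iff.2 hL
    exact_mod_cast this
  have hpos : ∀ b ∈ L, ((∑ i, b i : ℕ) : ℝ) * κ < listExp ρ κ L b := by
    intro b _
    have h1 : (totalOrder L : ℝ) * κ ≤ m * κ := by
      have : (totalOrder L : ℝ) ≤ m := by exact_mod_cast hm
      exact mul_le_mul_of_nonneg_right this S.kappa_nonneg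
    have h2 : 0 < (1 - ρ - totalOrder L * κ) / L.length :=
      div_pos (by linarith [S.le_half]) hlen
    unfold listExp
    linarith
  refine ⟨hpos β hβ, ?_⟩
  have h3 : listExp ρ κ L β ≤ (L.map (listExp ρ κ L)).sum := by
    refine List.single_le_sum (fun x hx => ?_) _ (List.mem_map.2 ⟨β, hβ, rfl⟩)
    obtain ⟨b, hb, rfl⟩ := List.mem_map.1 hx
    have := hpos b hb
    have h4 : 0 ≤ ((∑ i, b i : ℕ) : ℝ) * κ := mul_nonneg (by positivity) S.kappa_nonneg
    linarith
  linarith [sum_map_listExp (ρ := ρ) (κ := κ) hL]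

lemma factor (S : Setting m ρ κ σ R v) {L : List (Fin n → ℕ)} (hL : L ≠ [])
    (hm : totalOrder L ≤ m) : ∀ β ∈ L, Factor ρ R (listExp ρ κ L β) (v β) := by
  intro β hβ
  have hord := (order_le_totalOrder hβ).trans hm
  have hs := S.jet.supp β hord
  have hb := (S.listExp_bounds hL hm hβ).1
  have h0 : 0 ≤ ((∑ i, β i : ℕ) : ℝ) * κ := mul_nonneg (by positivity) S.kappa_nonneg
  refine ⟨by linarith, hs.memLp_mono (recipExp_le ?_ (by linarith)) (S.memLp β hord), hs⟩
  linarith [S.exps.rho_pos]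

end Setting

lemma SupportedIn.mono {R R' : ℝ} {f : Eu n → ℂ} (hf : SupportedIn R f) (h : R ≤ R') :
    SupportedIn R' f := by
  filter_upwards [hf] with x hx hR
  exact hx (by linarith)

lemma Factor.mono {ρ R R' c : ℝ} {f : Eu n → ℂ} (hf : Factor ρ R c f) (h : R ≤ R') :
    Factor ρ R' c f := ⟨hf.pos, hf.memLp, hf.supp.mono h⟩

lemma Factor.mollify {ρ R c : ℝ} {f : Eu n → ℂ} (hf : Factor ρ R c f) (hρ : 0 ≤ ρ)
    (hc : ρ + c ≤ 1) (k : ℕ) : Factor ρ (R + 1) c (mollify k f) := by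
  refine ⟨hf.pos, ⟨aestronglyMeasurable_mollify k hf.memLp.1, ?_⟩,
    Eventually.of_forall fun x hx => mollify_eq_zero k hf.supp hx⟩
  exact (eLpNorm_mollify_le k (add_pos_of_nonneg_of_pos hρ hf.pos) hc hf.memLp.1).trans_lt
    hf.memLp.2

lemma fderiv_incoming (ξ x : Eu n) (i : Fin n) :
    fderiv ℝ (incoming ξ) x (EuclideanSpace.single i 1) =
      -(Complex.I * (ξ i : ℂ) / 2) * incoming ξ x := by
  have h1 : incoming ξ = fun y => Complex.exp (Complex.I * ((-(inner ℝ ξ y) / 2 : ℝ) : ℂ)) :=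
    funext (incoming_eq ξ)
  have h2 : HasFDerivAt (fun y : Eu n => -(inner ℝ ξ y) / 2) ((-(1 / 2 : ℝ)) • innerSL ℝ ξ) x := by
    have h3 := (innerSL ℝ ξ).hasFDerivAt (x := x) |>.const_smul (-(1 / 2 : ℝ))
    refine h3.congr_of_eventuallyEq (Eventually.of_forall fun y => ?_)
    simp only [Pi.smul_apply, innerSL_apply_apply, smul_eq_mul]
    ring
  have h4 := (Complex.ofRealCLM.hasFDerivAt.comp x h2).const_mul Complex.I |>.cexp
  rw [h1]
  have h5 := h4.fderiv
  have h6 : (fun y : Eu n => Complex.exp (Complex.I * ((-(inner ℝ ξ y) / 2 : ℝ) : ℂ))) =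
      fun y => Complex.exp (Complex.I * (Complex.ofRealCLM ∘ fun y : Eu n => -(inner ℝ ξ y) / 2) y) :=
    rfl
  rw [h6, h5]
  have h7 : inner ℝ ξ (EuclideanSpace.single i (1 : ℝ)) = ξ i := by
    rw [EuclideanSpace.inner_single_right]; simp
  simp [h7]
  ring

lemma contDiff_incoming (ξ : Eu n) : ContDiff ℝ 1 (incoming ξ) := by
  have h1 : incoming ξ = fun y => Complex.exp (Complex.I * ((-(inner ℝ ξ y) / 2 : ℝ) : ℂ)) :=
    funext (incoming_eq ξ)
  rw [h1]
  have h2 : ContDiff ℝ 1 fun y : Eu n => -(inner ℝ ξ y) / 2 :=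
    (contDiff_const.inner ℝ contDiff_id).neg.div_const 2
  exact (contDiff_const.mul (Complex.ofRealCLM.contDiff.comp h2)).cexp

namespace Setting

variable {m : ℕ} {ρ κ σ R : ℝ} {v : (Fin n → ℕ) → Eu n → ℂ}

/-- The Born integrals of the mollified family converge to those of the family itself. -/
lemma tendsto_born (S : Setting m ρ κ σ R v) {L : List (Fin n → ℕ)} (hL : L ≠ [])
    (hm : totalOrder L ≤ m) {ξ : Eu n} (hξ : ξ ≠ 0) :
    Tendsto (fun k => ∫ y, incoming ξ y * chain (localGreen (R + 1) (waveNumber ξ)) (incoming ξ)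
      (L.map fun β => mollify k (v β)) y) atTop (𝓝 (bornFourier (L.map v) ξ)) := by
  have hf := S.factor hL hm
  have hsum := sum_map_listExp (ρ := ρ) (κ := κ) hL
  have hb : ∀ β ∈ L, ρ + listExp ρ κ L β ≤ 1 := fun β hβ => (S.listExp_bounds hL hm hβ).2
  generalize listExp ρ κ L = c at hf hsum hb
  obtain ⟨β₀, L, rfl⟩ := List.exists_cons_of_ne_nil hL
  have hρ := S.exps.rho_pos
  have hR : 0 < R + 1 := by linarith [S.radius_pos]
  have hk := waveNumber_pos hξ
  have hK := memLp_localGreen (n := n) S.exps hR hk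
  have hKi := integrable_localGreen (n := n) S.exps hR hk
  have hec := (continuous_incoming ξ).aestronglyMeasurable (μ := (volume : Measure (Eu n)))
  have he1 : ∀ y, ‖incoming ξ y‖ ≤ 1 := fun y => (norm_incoming ξ y).le
  have hf1 : ∀ a ∈ β₀ :: L, Factor ρ (R + 1) (c a) (v a) :=
    fun a ha => (hf a ha).mono (by linarith)
  have hf2 : ∀ a ∈ β₀ :: L, ∀ k, Factor ρ (R + 1) (c a) (mollify k (v a)) :=
    fun a ha k => (hf a ha).mollify hρ.le (hb a ha) k
  have hconv := tendsto_eLpNorm_chain_sub hρ.le hK hKi hec he1 (fun k a => mollify k (v a)) β₀ L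
    hf2 hf1 hsum.le fun a ha => tendsto_eLpNorm_mollify_sub
      (add_pos hρ (hf a ha).pos) (hb a ha) (hf a ha).memLp
  rw [hsum, recipExp_one] at hconv
  rw [bornFourier_eq S.exps hR β₀ L hf1 hsum.le hξ, tendsto_iff_edist_tendsto_0]
  refine tendsto_of_tendsto_of_tendsto_of_le_of_le tendsto_const_nhds hconv
    (fun k => zero_le) fun k => ?_
  have hint : ∀ {u : Eu n → ℂ}, Integrable u → Integrable fun y => incoming ξ y * u y :=
    fun hu => hu.bdd_mul (c := 1) hec (Eventually.of_forall he1)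
  have i1 := hint (integrable_chain hρ.le hK hec he1 β₀ L (fun a ha => hf2 a ha k) hsum.le)
  have i2 := hint (integrable_chain hρ.le hK hec he1 β₀ L hf1 hsum.le)
  rw [edist_eq_enorm_sub, ← integral_sub i1 i2]
  simp_rw [← mul_sub]
  exact norm_integral_incoming_mul_le ξ

/-- Multiplying a Born integral by `iξ_i` distributes a derivative over the factors. -/
lemma mul_bornFourier (S : Setting m ρ κ σ R v) {L : List (Fin n → ℕ)} (hL : L ≠ [])
    (i : Fin n) (hm : totalOrder L + 1 ≤ m) {ξ : Eu n} (hξ : ξ ≠ 0) :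
    Complex.I * (ξ i : ℂ) * bornFourier (L.map v) ξ =
      ((leibniz (fun β => β + Pi.single i 1) L).map fun L' => bornFourier (L'.map v) ξ).sum := by
  set s : (Fin n → ℕ) → (Fin n → ℕ) := fun β => β + Pi.single i 1 with hs
  have hR : 0 < R + 1 := by linarith [S.radius_pos]
  have hk := waveNumber_pos hξ
  have hKi := integrable_localGreen (n := n) S.exps hR hk
  have h1 := (S.tendsto_born hL (by omega) hξ).const_mul (Complex.I * (ξ i : ℂ))
  have h2 := tendsto_list_sum (x := atTop)
    (f := fun (L' : List (Fin n → ℕ)) (k : ℕ) => ∫ y, incoming ξ y *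
      chain (localGreen (R + 1) (waveNumber ξ)) (incoming ξ)
        (L'.map fun β => mollify k (v β)) y)
    (a := fun L' => bornFourier (L'.map v) ξ) (leibniz s L) (fun L' hL' => by
      refine S.tendsto_born ?_ ?_ hξ
      · intro h0
        have := length_of_mem_leibniz hL'
        rw [h0] at this
        exact hL (List.length_eq_zero_iff.1 this.symm)
      · rw [totalOrder_of_mem_leibniz hL']; exact hm)
  refine tendsto_nhds_unique h1 (h2.congr fun k => ?_)
  have htest : ∀ β : Fin n → ℕ, ∑ i, β i ≤ m → IsTest (mollify k (v β)) := fun β hβ =>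
    ⟨(contDiff_mollify k (S.jet.locallyIntegrable hβ)).of_le (by exact_mod_cast le_top),
      hasCompactSupport_mollify k (S.jet.supp β hβ)⟩
  have hord : ∀ β ∈ L, ∑ i, β i + 1 ≤ m := fun β hβ => by
    have := order_le_totalOrder hβ
    omega
  obtain ⟨β₀, L, rfl⟩ := List.exists_cons_of_ne_nil hL
  rw [← integral_leibniz (f := fun β => mollify k (v β)) hKi (contDiff_incoming ξ)
    (fun x => fderiv_incoming ξ x i) (s := s) β₀ L
    (fun a ha => htest a (by have := hord a ha; omega))
    (fun a ha => htest (s a) (by rw [hs]; simp only; rw [sum_add_single]; exact hord a ha))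
    (fun a ha x => fderiv_mollify k S.jet (hord a ha) x)]
  ring

end Setting

/-! ### The multinomial expansion -/

lemma mem_splittings {j : ℕ} {α : Fin n → ℕ} {B : Fin j → Fin n → ℕ} :
    B ∈ splittings j α ↔ ∑ l, B l = α := by
  rw [splittings, Finset.mem_filter, and_iff_right_iff_imp]
  rintro rfl
  simp only [Fintype.mem_piFinset, Finset.mem_range, Finset.sum_apply]
  intro l i
  exact Nat.lt_succ_of_le (Finset.single_le_sum (f := fun l => B l i) (fun _ _ => Nat.zero_le _)
    (Finset.mem_univ l))

/-- Raise the `i`-th entry of the `l`-th multi-index by one. -/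
def raise {j : ℕ} (i : Fin n) (B : Fin j → Fin n → ℕ) (l : Fin j) : Fin j → Fin n → ℕ :=
  Function.update B l (B l + Pi.single i 1)

lemma raise_apply {j : ℕ} (i : Fin n) (B : Fin j → Fin n → ℕ) (l l' : Fin j) (i' : Fin n) :
    raise i B l l' i' = if l' = l ∧ i' = i then B l' i' + 1 else B l' i' := by
  rw [raise]
  by_cases h : l' = l
  · subst h
    by_cases h2 : i' = i
    · subst h2; simp
    · simp [h2]
  · simp [h]

lemma sum_raise {j : ℕ} (i : Fin n) (B : Fin j → Fin n → ℕ) (l : Fin j) :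
    ∑ l', raise i B l l' = ∑ l', B l' + Pi.single i 1 := by
  ext i'
  simp only [Finset.sum_apply, Pi.add_apply, raise_apply]
  have h1 : ∀ l', (if l' = l ∧ i' = i then B l' i' + 1 else B l' i') =
      B l' i' + if l' = l then (if i' = i then 1 else 0) else 0 := fun l' => by
    by_cases h : l' = l <;> by_cases h2 : i' = i <;> simp [h, h2]
  rw [Finset.sum_congr rfl fun l' _ => h1 l', Finset.sum_add_distrib, Finset.sum_ite_eq' _ l,
    if_pos (Finset.mem_univ l), Pi.single_apply]

lemma leibniz_ofFn {ι : Type*} (s : ι → ι) {j : ℕ} (B : Fin j → ι) (G : List ι → ℂ) :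
    ((leibniz s (List.ofFn B)).map G).sum =
      ∑ l, G (List.ofFn (Function.update B l (s (B l)))) := by
  induction j generalizing G with
  | zero => simp [leibniz]
  | succ j ih =>
    rw [List.ofFn_succ, leibniz, List.map_cons, List.sum_cons, List.map_map, ih, Fin.sum_univ_succ]
    congr 1
    · simp [List.ofFn_succ, Function.update_of_ne]
    · refine Finset.sum_congr rfl fun l _ => ?_
      have h0 : (0 : Fin (j + 1)) ≠ l.succ := (Fin.succ_ne_zero l).symm
      rw [Function.comp_apply, List.ofFn_succ, Function.update_of_ne h0]
      congr 3
      ext l'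
      by_cases h : l' = l
      · subst h; simp
      · rw [Function.update_of_ne h, Function.update_of_ne (by simpa using h)]

lemma prod_factorial_raise {α : Fin n → ℕ} (i : Fin n) :
    ∏ i', (((α + Pi.single i 1 : Fin n → ℕ) i')! : ℂ) = (α i + 1) * ∏ i', ((α i')! : ℂ) := by
  have h : ∀ i', (((α + Pi.single i 1 : Fin n → ℕ) i')! : ℂ) =
      (if i' = i then (α i' + 1 : ℂ) else 1) * ((α i')! : ℂ) := by
    intro i'
    by_cases h : i' = i
    · subst h
      simp only [Pi.add_apply, Pi.single_eq_same, if_true]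
      rw [Nat.factorial_succ]
      push_cast
      ring
    · simp [h]
  simp_rw [h, Finset.prod_mul_distrib]
  simp

lemma prod_factorial_raise_list {j : ℕ} (B : Fin j → Fin n → ℕ) (l : Fin j) (i : Fin n) :
    ∏ l', ∏ i', ((raise i B l l' i')! : ℂ) = (B l i + 1) * ∏ l', ∏ i', ((B l' i')! : ℂ) := by
  have h : ∀ l', ∏ i', ((raise i B l l' i')! : ℂ) =
      (if l' = l then (B l' i + 1 : ℂ) else 1) * ∏ i', ((B l' i')! : ℂ) := by
    intro l'
    by_cases h : l' = l
    · subst h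
      rw [if_pos rfl, ← prod_factorial_raise]
      simp [raise]
    · simp [raise, h]
  simp_rw [h, Finset.prod_mul_distrib]
  simp

lemma coeff_raise {j : ℕ} {α : Fin n → ℕ} (B : Fin j → Fin n → ℕ) (l : Fin j) (i : Fin n) :
    coeff α B = (raise i B l l i : ℂ) / (α i + 1) * coeff (α + Pi.single i 1) (raise i B l) := by
  have h1 : (α i + 1 : ℂ) ≠ 0 := Nat.cast_add_one_ne_zero _
  have h2 : (B l i + 1 : ℂ) ≠ 0 := Nat.cast_add_one_ne_zero _
  have h3 : ∏ l', ∏ i', ((B l' i')! : ℂ) ≠ 0 :=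
    Finset.prod_ne_zero_iff.2 fun l' _ => Finset.prod_ne_zero_iff.2 fun i' _ => by
      exact_mod_cast Nat.factorial_ne_zero _
  rw [coeff, coeff, prod_factorial_raise, prod_factorial_raise_list]
  have h4 : (raise i B l l i : ℂ) = B l i + 1 := by
    rw [raise_apply]; simp
  rw [h4]
  field_simp

lemma raise_injective {j : ℕ} (i : Fin n) (l : Fin j) :
    Function.Injective fun B : Fin j → Fin n → ℕ => raise i B l := by
  intro B B' h
  ext l' i'
  have := congrFun (congrFun h l') i'
  simp only [raise_apply] at this
  split_ifs at this <;> omega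

/-- The recursion of the multinomial coefficients, as a summation formula. -/
lemma sum_coeff_raise {j : ℕ} (α : Fin n → ℕ) (i : Fin n) (G : (Fin j → Fin n → ℕ) → ℂ) :
    ∑ B ∈ splittings j α, coeff α B * ∑ l, G (raise i B l) =
      ∑ B ∈ splittings j (α + Pi.single i 1), coeff (α + Pi.single i 1) B * G B := by
  have h1 : (α i + 1 : ℂ) ≠ 0 := Nat.cast_add_one_ne_zero _
  -- split each term on the right according to the factor `l` that receives the extra derivative,
  -- with weight `B l i / (α i + 1)`; these weights add up to one
  have h2 : ∀ B ∈ splittings j (α + Pi.single i 1), coeff (α + Pi.single i 1) B * G B =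
      ∑ l, (B l i : ℂ) / (α i + 1) * coeff (α + Pi.single i 1) B * G B := by
    intro B hB
    have h3 : (∑ l, (B l i : ℂ)) = α i + 1 := by
      have := congrFun (mem_splittings.1 hB) i
      simp only [Finset.sum_apply, Pi.add_apply, Pi.single_eq_same] at this
      exact_mod_cast this
    simp_rw [mul_assoc, ← Finset.sum_mul, ← Finset.sum_div]
    rw [h3, div_self h1, one_mul]
  rw [Finset.sum_congr rfl h2, Finset.sum_comm]
  simp_rw [Finset.mul_sum]
  rw [Finset.sum_comm]
  refine Finset.sum_congr rfl fun l _ => ?_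
  refine Finset.sum_of_injOn (fun B => raise i B l) ((raise_injective i l).injOn) ?_ ?_ ?_
  · intro B hB
    simp only [Finset.mem_coe, mem_splittings] at hB ⊢
    rw [sum_raise, hB]
  · intro B hB hB2
    have h4 : B l i = 0 := by
      by_contra h5
      refine hB2 ⟨Function.update B l (B l - Pi.single i 1), ?_, ?_⟩
      · have h6 : raise i (Function.update B l (B l - Pi.single i 1)) l = B := by
          ext l' i'
          rw [raise_apply]
          by_cases hl : l' = l
          · subst hl
            by_cases hi : i' = i
            · subst hi; simp; omega
            · simp [hi]
          · simp [hl]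
        have h7 := sum_raise i (Function.update B l (B l - Pi.single i 1)) l
        rw [h6, mem_splittings.1 hB] at h7
        exact mem_splittings.2 (add_right_cancel h7).symm
      · ext l' i'
        simp only
        rw [raise_apply]
        by_cases hl : l' = l
        · subst hl
          by_cases hi : i' = i
          · subst hi; simp; omega
          · simp [hi]
        · simp [hl]
    rw [h4]
    simp
  · intro B _
    rw [coeff_raise B l i]

lemma splittings_zero (j : ℕ) : splittings j (0 : Fin n → ℕ) = {0} := by
  ext B
  rw [mem_splittings, Finset.mem_singleton]
  refine ⟨fun h => ?_, fun h => by simp [h]⟩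
  ext l i
  have := congrFun h i
  simp only [Finset.sum_apply, Pi.zero_apply, Finset.sum_eq_zero_iff, Finset.mem_univ,
    forall_const] at this
  exact this l

lemma coeff_zero (j : ℕ) : coeff (0 : Fin n → ℕ) (0 : Fin j → Fin n → ℕ) = 1 := by
  simp [coeff]

lemma totalOrder_ofFn {j : ℕ} {α : Fin n → ℕ} {B : Fin j → Fin n → ℕ} (h : B ∈ splittings j α) :
    totalOrder (List.ofFn B) = ∑ i, α i := by
  rw [totalOrder, List.map_ofFn, List.sum_ofFn, ← mem_splittings.1 h]
  simp only [Function.comp_apply, Finset.sum_apply]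
  exact Finset.sum_comm

/-- The multinomial expansion on the Fourier side. -/
lemma Setting.prod_mul_bornFourier {m : ℕ} {ρ κ σ R : ℝ} {v : (Fin n → ℕ) → Eu n → ℂ}
    (S : Setting m ρ κ σ R v) {j : ℕ} (hj : j ≠ 0) {ξ : Eu n} (hξ : ξ ≠ 0) (α : Fin n → ℕ)
    (hα : ∑ i, α i ≤ m) :
    (∏ i, (Complex.I * (ξ i : ℂ)) ^ α i) * bornFourier (List.replicate j (v 0)) ξ =
      ∑ B ∈ splittings j α, coeff α B * bornFourier (List.ofFn fun l => v (B l)) ξ := by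
  induction hN : ∑ i, α i generalizing α with
  | zero =>
    have h0 : α = 0 := by
      ext i
      exact Finset.sum_eq_zero_iff.1 hN i (Finset.mem_univ i)
    subst h0
    rw [splittings_zero, Finset.sum_singleton, coeff_zero]
    simp [List.ofFn_const]
  | succ N ih =>
    obtain ⟨i, hi⟩ : ∃ i, α i ≠ 0 := by
      by_contra! h
      simp [h] at hN
    set α' : Fin n → ℕ := α - Pi.single i 1 with hα'
    have hα2 : α = α' + Pi.single i 1 := by
      ext i'
      by_cases h : i' = i
      · subst h; simp [hα']; omega
      · simp [hα', h]
    have hsum : ∑ i, α i = ∑ i, α' i + 1 := by rw [hα2, sum_add_single]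
    rw [hα2, ← sum_coeff_raise]
    have h1 : ∏ i', (Complex.I * (ξ i' : ℂ)) ^ (α' + Pi.single i 1 : Fin n → ℕ) i' =
        Complex.I * (ξ i : ℂ) * ∏ i', (Complex.I * (ξ i' : ℂ)) ^ α' i' := by
      simp_rw [Pi.add_apply, pow_add, Finset.prod_mul_distrib]
      rw [mul_comm]
      congr 1
      rw [Finset.prod_eq_single i]
      · simp
      · intro b _ hb; simp [hb]
      · simp
    rw [h1, mul_assoc, ih α' (by omega) (by omega), Finset.mul_sum]
    refine Finset.sum_congr rfl fun B hB => ?_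
    rw [mul_left_comm]
    congr 1
    have hlist : ∀ B : Fin j → Fin n → ℕ, (List.ofFn fun l => v (B l)) = (List.ofFn B).map v :=
      fun B => by rw [List.map_ofFn]; rfl
    simp_rw [hlist]
    rw [S.mul_bornFourier (by simpa using hj) i (by rw [totalOrder_ofFn hB]; omega) hξ, leibniz_ofFn]
    rfl

/-! ### From the symbols to the distributions -/

/-- An identity between symbols yields the corresponding identity between distributions. -/
lemma multiDeriv_eq_sum {ι : Type*} (hn : 1 ≤ n) (s : Finset ι) (α : Fin n → ℕ) {u : Eu n → ℂ}
    {w : ι → Eu n → ℂ} (a : ι → ℂ) (hu : IsTempered u) (hw : ∀ B ∈ s, IsTempered (w B))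
    (h : ∀ ζ : Eu n, ζ ≠ 0 → derivSymbol α ζ * u ζ = ∑ B ∈ s, a B * w B ζ) :
    multiDeriv α (𝓕⁻ (toDistribution u) : 𝓢'(Eu n, ℂ)) =
      ∑ B ∈ s, a B • (𝓕⁻ (toDistribution (w B)) : 𝓢'(Eu n, ℂ)) := by
  rw [multiDeriv_fourierInv]
  have h1 := hu.isFunction.smulLeft (hasTemperateGrowth_derivSymbol α)
  have h2 : IsFunction (∑ B ∈ s, a B • toDistribution (w B)) fun ζ => ∑ B ∈ s, a B * w B ζ :=
    IsFunction.sum s fun B hB => (hw B hB).isFunction.const_smul (a B)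
  have h3 : (fun ζ => derivSymbol α ζ * u ζ) =ᵐ[volume] fun ζ => ∑ B ∈ s, a B * w B ζ := by
    filter_upwards [ae_ne_zero hn] with ζ hζ
    exact h ζ hζ
  rw [(h1.congr h3).eq h2]
  have h4 : ∀ S : 𝓢'(Eu n, ℂ), (𝓕⁻ S : 𝓢'(Eu n, ℂ)) =
      FourierTransform.fourierInvCLM ℂ 𝓢'(Eu n, ℂ) S := fun _ => rfl
  simp_rw [h4, map_sum, map_smul]

lemma derivSymbol_eq (α : Fin n → ℕ) (ζ : Eu n) :
    derivSymbol α ζ = ∏ i, (Complex.I * ((((2 * Real.pi) • ζ) i : ℝ) : ℂ)) ^ α i := by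
  refine Finset.prod_congr rfl fun i _ => ?_
  congr 1
  rw [PiLp.smul_apply, smul_eq_mul]
  push_cast
  ring

variable {ι : Type*} {f g : ι → Eu n → ℂ} {c : ι → ℝ} {ρ σ R : ℝ}

lemma Factor.congr {c : ℝ} {f g : Eu n → ℂ} (hf : Factor ρ R c f) (h : f =ᵐ[volume] g) :
    Factor ρ R c g := by
  refine ⟨hf.pos, hf.memLp.ae_eq h, ?_⟩
  filter_upwards [hf.supp, h] with x hx hfg hR
  rw [← hfg, hx hR]

lemma bornFourier_congr (hE : Exponents n ρ σ) (hR : 0 < R) (i : ι) (L : List ι)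
    (hf : ∀ a ∈ i :: L, Factor ρ R (c a) (f a)) (hsum : ρ + ((i :: L).map c).sum ≤ 1)
    (hfg : ∀ a ∈ i :: L, f a =ᵐ[volume] g a) {ξ : Eu n} (hξ : ξ ≠ 0) :
    bornFourier ((i :: L).map f) ξ = bornFourier ((i :: L).map g) ξ := by
  rw [bornFourier_eq hE hR i L hf hsum hξ,
    bornFourier_eq hE hR i L (fun a ha => (hf a ha).congr (hfg a ha)) hsum hξ]
  refine integral_congr_ae ?_
  filter_upwards [chain_congr (K := localGreen R (waveNumber ξ)) (e := incoming ξ) (i :: L) hfg]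
    with y hy
  rw [hy]

/-- The singularity allowed for the fundamental solution can be chosen so that the resulting
singularity of the Born symbols at zero frequency is integrable, except in dimension one. -/
lemma exists_exponents (hn : 1 ≤ n) (hρ : 0 < ρ) (hρn : ρ * n < 2) (hρ1 : ρ < 1) (l : ℕ) :
    ∃ σ, Exponents n ρ σ ∧ (2 ≤ n → (σ - n + 2) * l < n) := by
  rcases hn.lt_or_eq with h2 | h1
  · have hn2 : (2 : ℝ) ≤ n := by exact_mod_cast h2
    set δ : ℝ := min ((2 - ρ * n) / 2) (n / (2 * (l + 1))) with hδ
    have hδ0 : 0 < δ := lt_min (by linarith) (by positivity)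
    have hδ1 : δ ≤ (2 - ρ * n) / 2 := min_le_left _ _
    have hδ2 : δ ≤ n / (2 * (l + 1)) := min_le_right _ _
    refine ⟨n - 2 + δ, ⟨hn, hρ, hρ1, by linarith, by linarith, by nlinarith⟩, fun _ => ?_⟩
    have e : (n : ℝ) - 2 + δ - n + 2 = δ := by ring
    rw [e]
    rw [le_div_iff₀ (by positivity)] at hδ2
    have : (0 : ℝ) ≤ l := by positivity
    nlinarith
  · refine ⟨0, ⟨hn, hρ, hρ1, le_rfl, ?_, ?_⟩, fun h => by omega⟩
    · rw [← h1]; norm_num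
    · rw [← h1]; norm_num; linarith

namespace Setting

variable {m : ℕ} {κ : ℝ} {v : (Fin n → ℕ) → Eu n → ℂ}

/-- Everything that is needed about the terms built from derivatives of the potential. -/
lemma symbols (S : Setting m ρ κ σ R v) {j : ℕ} {α : Fin n → ℕ} (hα : ∑ i, α i ≤ m)
    {B : Fin (j + 1) → Fin n → ℕ} (hB : B ∈ splittings (j + 1) α) :
    BornFourierDefined (List.ofFn fun l => v (B l)) ∧
    ((σ - n + 2) * j < n → IsTempered (bornSymbol (List.ofFn fun l => v (B l)))) ∧
    ∀ (C₀ : ℝ) (χ : ℝ → ℝ), 0 < C₀ → IsHighFrequencyCutoff C₀ χ →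
      IsTempered (bornSymbolCut χ (List.ofFn fun l => v (B l))) := by
  have hm : totalOrder (List.ofFn B) ≤ m := by rwa [totalOrder_ofFn hB]
  have hL : List.ofFn B ≠ [] := by simp
  have hf := S.factor hL hm
  have hsum := sum_map_listExp (ρ := ρ) (κ := κ) hL
  have hlen : (List.ofFn B).length = j + 1 := by simp
  have e : (List.ofFn fun l => v (B l)) = (List.ofFn B).map v := by
    rw [List.map_ofFn]; rfl
  rw [e]
  generalize listExp ρ κ (List.ofFn B) = c at hf hsum
  generalize List.ofFn B = L at *
  obtain ⟨β, L, rfl⟩ := List.exists_cons_of_ne_nil hL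
  have hlen' : L.length = j := by simpa using hlen
  refine ⟨bornFourierDefined_of_factor S.exps S.radius_pos β L hf hsum.le, fun hj => ?_,
    fun C₀ χ hC₀ hχ => isTempered_bornSymbolCut S.exps S.radius_pos β L hf hsum hC₀ hχ⟩
  refine isTempered_bornSymbol S.exps S.radius_pos β L hf hsum ?_
  rwa [hlen']

/-- Everything that is needed about the term built from the potential itself. -/
lemma symbols_replicate (S : Setting m ρ κ σ R v) {q : Eu n → ℂ} (hq : v 0 =ᵐ[volume] q) (j : ℕ) :
    BornFourierDefined (List.replicate (j + 1) q) ∧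
    ((σ - n + 2) * j < n → IsTempered (bornSymbol (List.replicate (j + 1) q))) ∧
    (∀ (C₀ : ℝ) (χ : ℝ → ℝ), 0 < C₀ → IsHighFrequencyCutoff C₀ χ →
      IsTempered (bornSymbolCut χ (List.replicate (j + 1) q))) ∧
    ∀ ξ : Eu n, ξ ≠ 0 →
      bornFourier (List.replicate (j + 1) q) ξ = bornFourier (List.replicate (j + 1) (v 0)) ξ := by
  have hL : List.replicate (j + 1) (0 : Fin n → ℕ) ≠ [] := by simp
  have hm : totalOrder (List.replicate (j + 1) (0 : Fin n → ℕ)) ≤ m := by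
    simp [totalOrder, List.map_replicate]
  have hf0 := S.factor hL hm 0 (by simp)
  have hsum := sum_map_listExp (ρ := ρ) (κ := κ) hL
  rw [List.map_replicate] at hsum
  generalize listExp ρ κ (List.replicate (j + 1) (0 : Fin n → ℕ)) 0 = t at hf0 hsum
  have hf : ∀ a ∈ () :: List.replicate j (), Factor ρ R ((fun _ : Unit => t) a)
      ((fun _ : Unit => q) a) := fun a _ => hf0.congr hq
  have hs : ρ + ((() :: List.replicate j ()).map fun _ : Unit => t).sum = 1 := by
    rw [← List.replicate_succ, List.map_replicate]; exact hsum
  have e : ∀ w : Eu n → ℂ, List.replicate (j + 1) w =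
      (() :: List.replicate j ()).map fun _ : Unit => w := fun w => by
    rw [← List.replicate_succ, List.map_replicate]
  have hlen : (List.replicate j ()).length = j := by simp
  rw [e q, e (v 0)]
  refine ⟨bornFourierDefined_of_factor S.exps S.radius_pos () _ hf hs.le, fun hj => ?_,
    fun C₀ χ hC₀ hχ => isTempered_bornSymbolCut S.exps S.radius_pos () _ hf hs hC₀ hχ,
    fun ξ hξ => bornFourier_congr S.exps S.radius_pos () _ hf hs.le (fun _ _ => hq.symm) hξ⟩
  refine isTempered_bornSymbol S.exps S.radius_pos () _ hf hs ?_
  rwa [hlen]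

/-- The Leibniz formula in the frequency variable of `𝓕`. -/
lemma derivSymbol_mul_bornSymbol (S : Setting m ρ κ σ R v) {q : Eu n → ℂ}
    (hq : v 0 =ᵐ[volume] q) {j : ℕ} {α : Fin n → ℕ} (hα : ∑ i, α i ≤ m) {ζ : Eu n} (hζ : ζ ≠ 0) :
    derivSymbol α ζ * bornSymbol (List.replicate (j + 1) q) ζ =
      ∑ B ∈ splittings (j + 1) α, coeff α B * bornSymbol (List.ofFn fun l => v (B l)) ζ := by
  have hξ := two_pi_smul_ne_zero hζ
  rw [derivSymbol_eq, bornSymbol, (S.symbols_replicate hq j).2.2.2 _ hξ,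
    S.prod_mul_bornFourier (Nat.succ_ne_zero j) hξ α hα]
  rfl

end Setting

end Backscattering

end

theorem mainTheorem9 (n : ℕ) (hn : 1 ≤ n) (α : Fin n → ℕ) (j : ℕ) (hj : 2 ≤ j)
    (q : Backscattering.Eu n → ℂ) (hq : MemLp q 2 volume) (hsupp : HasCompactSupport q)
    (hsob : TemperedDistribution.MemSobolev ((∑ i, α i : ℕ) : ℝ) 2
      (Lp.toTemperedDistribution (hq.toLp q)))
    (hdim : 4 + 2 * ∑ i, α i ≤ n → ∃ r : ℝ≥0∞, (n : ℝ≥0∞) / 2 < r ∧ MemLp q r volume) :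
    -- every expression occurring in the formulas is meaningful on the Fourier side
    Backscattering.BornFourierDefined (List.replicate j q) ∧
    (∀ β ∈ Backscattering.splittings j α,
      (∀ l, Backscattering.IsFunction
        (Backscattering.multiDeriv (β l) (Lp.toTemperedDistribution (hq.toLp q)))
        (Backscattering.weakDeriv (β l) q)) ∧
      Backscattering.BornFourierDefined (Backscattering.derivList β q)) ∧
    -- the formula for the full terms
    (2 ≤ n →
      Backscattering.IsTempered (Backscattering.bornSymbol (List.replicate j q)) ∧
      (∀ β ∈ Backscattering.splittings j α,
        Backscattering.IsTempered
          (Backscattering.bornSymbol (Backscattering.derivList β q))) ∧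
      Backscattering.multiDeriv α (Backscattering.Q (List.replicate j q)) =
        ∑ β ∈ Backscattering.splittings j α,
          Backscattering.coeff α β • Backscattering.Q (Backscattering.derivList β q)) ∧
    -- the formula for the high-frequency terms
    (∀ (C₀ : ℝ) (χ : ℝ → ℝ), 0 < C₀ → Backscattering.IsHighFrequencyCutoff C₀ χ →
      Backscattering.IsTempered (Backscattering.bornSymbolCut χ (List.replicate j q)) ∧
      (∀ β ∈ Backscattering.splittings j α,
        Backscattering.IsTempered
          (Backscattering.bornSymbolCut χ (Backscattering.derivList β q))) ∧
      Backscattering.multiDeriv α (Backscattering.Qtilde χ (List.replicate j q)) =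
        ∑ β ∈ Backscattering.splittings j α,
          Backscattering.coeff α β •
            Backscattering.Qtilde χ (Backscattering.derivList β q)) := by
  obtain ⟨j, rfl⟩ : ∃ j', j = j' + 1 := ⟨j - 1, by omega⟩
  obtain ⟨hF, h0, R, hR, hjet⟩ := Backscattering.exists_weakJet (m := ∑ i, α i) hq hsupp hsob
  obtain ⟨ρ, κ, hρ, hρn, hκ, hhalf, hmem⟩ := hjet.exists_exponents hn fun h => by
    obtain ⟨r, hr, hqr⟩ := hdim h
    exact ⟨r, hr, hqr.ae_eq h0.symm⟩
  have hρ1 : ρ < 1 := by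
    have : 0 ≤ ((∑ i, α i : ℕ) : ℝ) * κ := mul_nonneg (Nat.cast_nonneg _) hκ
    linarith
  obtain ⟨σ, hexps, hσ⟩ := Backscattering.exists_exponents hn hρ hρn hρ1 j
  have S : Backscattering.Setting (∑ i, α i) ρ κ σ R fun β => Backscattering.weakDeriv β q :=
    ⟨hjet, hR, hexps, hκ, hhalf, hmem⟩
  obtain ⟨hdef, htemp, hcut, -⟩ := S.symbols_replicate h0 j
  -- the definability of all terms, then the formulas for the full and for the truncated symbols;
  -- the full symbols have an integrable singularity only for `n ≥ 2`
  refine ⟨hdef, fun β hβ => ⟨fun l => hF _ ?_, (S.symbols le_rfl hβ).1⟩, fun hn2 => ?_,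
    fun C₀ χ hC₀ hχ => ?_⟩
  · rw [← Backscattering.mem_splittings.1 hβ]
    refine Finset.sum_le_sum fun i _ => ?_
    rw [Finset.sum_apply]
    exact Finset.single_le_sum (f := fun l => β l i) (fun _ _ => Nat.zero_le _)
      (Finset.mem_univ l)
  · have hB := fun β hβ => (S.symbols (j := j) (α := α) le_rfl (B := β) hβ).2.1 (hσ hn2)
    exact ⟨htemp (hσ hn2), hB, Backscattering.multiDeriv_eq_sum hn _ α _ (htemp (hσ hn2)) hB
      fun ζ hζ => S.derivSymbol_mul_bornSymbol h0 le_rfl hζ⟩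
  · have hB := fun β hβ => (S.symbols (j := j) (α := α) le_rfl (B := β) hβ).2.2 C₀ χ hC₀ hχ
    refine ⟨hcut C₀ χ hC₀ hχ, hB, Backscattering.multiDeriv_eq_sum hn _ α _ (hcut C₀ χ hC₀ hχ) hB
      fun ζ hζ => ?_⟩
    simp only [Backscattering.bornSymbolCut]
    rw [mul_left_comm, S.derivSymbol_mul_bornSymbol h0 le_rfl hζ, Finset.mul_sum]
    exact Finset.sum_congr rfl fun B _ => mul_left_comm _ _ _
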